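/- Consider the discrete-time single-server preemptive priority queue with two classes of customers. In every time slot a high-priority customer arrives with probability $p$ and a low-priority customer arrives with probability $q$; afterwards, if a high-priority customer is present, the server works on it and completes its service in this slot with probability $\mu_h$; if no high-priority customer but some low-priority customer is present, the server works on a low-priority customer and completes its service in this slot with probability $\mu_l$. All trials are independent. Let $(Q_1(n),Q_2(n))$ be the Markov chain of the numbers of high- and low-priority customers in the system at the slot boundaries. Assume $p,q,\mu_h,\mu_l>0$, $p+q+\mu_h+\mu_l=1$, $\mu_l\le\mu_h$ and $\rho=\frac{p}{\mu_h}+\frac{q}{\mu_l}<1$, and let $(\pi_{i,j})_{i,j\ge0}$ be the stationary distribution of the chain ($i$ high-priority, $j$ low-priority customers). Write $\bar x=1-x$, and $f(j)\sim g(j)$ if $f(j)/g(j)\to1$ as $j\to\infty$. Put $$a(y)=p\bar\mu_h(qy+\bar q),\quad b(y)=(p\mu_h+\bar p\bar\mu_h)(qy+\bar q)-1,\quad c(y)=\bar p\mu_h(qy+\bar q),\quad \Delta(y)=b(y)^2-4a(y)c(y),$$ $$x_0(y)=\frac{-b(y)-\sqrt{\Delta(y)}}{2a(y)},\qquad y_{0},y_1=\frac{p\mu_h+\bar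 p\bar\mu_h\mp2\sqrt{p\mu_h\bar p\bar\mu_h}}{(p\mu_h-\bar p\bar\mu_h)^2q}-\frac{\bar q}{q}\quad(y_0\text{ with the minus sign}),$$ $$b_2(y)=\bar p\bar q\mu_l+(\bar p\bar q\bar\mu_l+p\bar q\mu_h+\bar pq\mu_l-1)y+(pq\mu_h+\bar pq\bar\mu_l)y^2,\qquad h_2(x,y)=y\,a(y)\,x+b_2(y),$$ $$F(y)=(\bar p+\mu_h-2\bar p\mu_l)qy^2+\big[(\bar p+\mu_h-2\bar p\mu_l)\bar q+2\bar pq\mu_l-1\big]y+2\bar p\bar q\mu_l,$$ $$B=1-\mu_h\bar q-\bar p\bar q\bar\mu_l-\bar pq\mu_l,\qquad \eta_{1},\eta_2=\frac{B\pm\sqrt{B^2+4\bar p\bar q(\mu_h-\bar p\mu_l)\bar\mu_lq}}{2\bar p\bar q\mu_l}\quad(\eta_1\text{ with the plus sign}),$$ $$\alpha=\frac{1-\rho}{2\bar p^2\bar q\mu_l}\,\frac{\eta_1}{\eta_1-\eta_2},\qquad \beta=\frac{1-\rho}{2\bar p^2\bar q\mu_l}\,\frac{\eta_2}{\eta_2-\eta_1},$$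 $$C_{l,1}=\frac{2\alpha F(1/\eta_1)}{q\eta_1^{-1}+\bar q},\qquad C_{l,2}=\frac{\alpha(\bar p-\mu_h)qy_0\sqrt{y_0(y_1-y_0)}}{(qy_0+\bar q)\sqrt\pi},$$ $$C_{l,3}=\left[\frac{\alpha}{(qy_0+\bar q)(1-\eta_1y_0)}+\frac{\beta}{(qy_0+\bar q)(1-\eta_2y_0)}\right]\frac{(\mu_h-\bar p)q\,y_0}{2\sqrt\pi}\sqrt{y_0(y_1-y_0)}.$$ Then for every fixed $i\ge1$, as $j\to\infty$: (i) if $F(y_0)>0$, then $\pi_{i,j}\sim C_{i,1}\,\eta_1^{\,j}$, where $$C_{i,1}=\frac{1-(p\mu_h+\bar p\bar\mu_l)(q\eta_1^{-1}+\bar q)-\bar p\mu_l(q+\bar q\eta_1)}{\bar p\mu_h(q\eta_1^{-1}+\bar q)}\left[\frac{p\bar\mu_h}{\bar p\mu_h-\bar p\mu_l(1-\eta_1)}\right]^{i-1}C_{l,1};$$ (ii) if $F(y_0)=0$, then $\pi_{i,j}\sim C_{i,2}\,j^{-1/2}\,y_0^{-j}$, where $$C_{i,2}=\frac{1-(p\mu_h+\bar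 p\bar\mu_l)(qy_0+\bar q)-\bar p\mu_l(q+\bar qy_0^{-1})}{\bar p\mu_h(qy_0+\bar q)}\left[\frac{p\bar\mu_h}{\bar p\mu_h-\bar p\mu_l(1-y_0^{-1})}\right]^{i-1}C_{l,2};$$ (iii) if $F(y_0)<0$, then $\pi_{i,j}\sim C_{i,3}\,j^{-3/2}\,y_0^{-j}$, where $$C_{i,3}=-\left[\frac{b_2(y_0)}{y_0c(y_0)}+\frac{h_2(x_0(y_0),y_0)}{y_0c(y_0)}(i-1)\right]\left[\frac{2p\bar\mu_h(qy_0+\bar q)}{1-(p\mu_h+\bar p\bar\mu_h)(qy_0+\bar q)}\right]^{i-1}C_{l,3}.$$ -/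

import Mathlib

open Filter Topology

namespace PriorityQueue

noncomputable section

/-! The Markov chain of the discrete-time preemptive priority queue.  A state `(m, n)` records the
numbers of high- and low-priority customers in the system, including the one in service. -/

/-- One time slot: potential arrivals first (`aH`, `aL`), then a potential service completion.
If a high-priority customer is present, the server works on it (`dH` tells whether that service
is completed); otherwise it works on a low-priority customer, if there is one (`dL`). -/
def nextState (s : ℕ × ℕ) (aH aL dH dL : Bool) : ℕ × ℕ :=
  if 0 < s.1 + aH.toNat then (s.1 + aH.toNat - dH.toNat, s.2 + aL.toNat)
  else (0, s.2 + aL.toNat - dL.toNat)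

/-- The Bernoulli weight of the outcome `b` when success has probability `r`. -/
def bern (r : ℝ) (b : Bool) : ℝ := if b then r else 1 - r

/-- One-step transition probability from `s` to `t`, all four trials being independent. -/
def transProb (p q muH muL : ℝ) (s t : ℕ × ℕ) : ℝ :=
  ∑ aH : Bool, ∑ aL : Bool, ∑ dH : Bool, ∑ dL : Bool,
    if nextState s aH aL dH dL = t then
      bern p aH * bern q aL * bern muH dH * bern muL dL
    else 0

/-- `π` is a stationary probability distribution of the chain. -/
structure IsStationary (p q muH muL : ℝ) (π : ℕ → ℕ → ℝ) : Prop where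
  nonneg : ∀ i j, 0 ≤ π i j
  hasSum_one : HasSum (fun s : ℕ × ℕ => π s.1 s.2) 1
  balance : ∀ t : ℕ × ℕ,
    HasSum (fun s : ℕ × ℕ => π s.1 s.2 * transProb p q muH muL s t) (π t.1 t.2)

/-- `f(n) ∼ g(n)`: the quotient `f(n) / g(n)` tends to `1`. -/
def TailEquiv (f g : ℕ → ℝ) : Prop := Tendsto (fun n => f n / g n) atTop (𝓝 1)

/-! Explicit quantities.  Throughout, `1 - x` is written where the literature writes a bar over `x`. -/

/-- Traffic intensity. -/
def rho (p q muH muL : ℝ) : ℝ := p / muH + q / muL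

/-- Probability of the empty system. -/
def pi00 (p q muH muL : ℝ) : ℝ := (1 - rho p q muH muL) / ((1 - p) * (1 - q))

/-- Coefficients of the key kernel `K(x, y) = a(y) x² + b(y) x + c(y)`. -/
def kerA (p q muH y : ℝ) : ℝ := p * (1 - muH) * (q * y + (1 - q))

def kerB (p q muH y : ℝ) : ℝ := (p * muH + (1 - p) * (1 - muH)) * (q * y + (1 - q)) - 1

def kerC (p q muH y : ℝ) : ℝ := (1 - p) * muH * (q * y + (1 - q))

/-- Discriminant of the key kernel as a quadratic polynomial in `x`. -/
def disc (p q muH y : ℝ) : ℝ := kerB p q muH y ^ 2 - 4 * kerA p q muH y * kerC p q muH y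

/-- The branch `x₀(y)` of the solutions of `K(x, y) = 0`. -/
def xZero (p q muH y : ℝ) : ℝ :=
  (-kerB p q muH y - √(disc p q muH y)) / (2 * kerA p q muH y)

/-- The branch point `y₀`, the smaller zero of `disc`. -/
def yZero (p q muH : ℝ) : ℝ :=
  (p * muH + (1 - p) * (1 - muH) - 2 * √(p * muH * (1 - p) * (1 - muH))) /
    ((p * muH - (1 - p) * (1 - muH)) ^ 2 * q) - (1 - q) / q

/-- The branch point `y₁`, the larger zero of `disc`. -/
def yOne (p q muH : ℝ) : ℝ :=
  (p * muH + (1 - p) * (1 - muH) + 2 * √(p * muH * (1 - p) * (1 - muH))) /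
    ((p * muH - (1 - p) * (1 - muH)) ^ 2 * q) - (1 - q) / q

/-- The quadratic polynomial `F` whose sign at `y₀` separates the three regimes. -/
def F (p q muH muL y : ℝ) : ℝ :=
  ((1 - p) + muH - 2 * (1 - p) * muL) * q * y ^ 2 +
    (((1 - p) + muH - 2 * (1 - p) * muL) * (1 - q) + 2 * (1 - p) * q * muL - 1) * y +
    2 * (1 - p) * (1 - q) * muL

/-- The common linear part `B` of the formulas for `η₁` and `η₂`. -/
def etaB (p q muH muL : ℝ) : ℝ :=
  1 - muH * (1 - q) - (1 - p) * (1 - q) * (1 - muL) - (1 - p) * q * muL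

/-- The expression under the square root in the formulas for `η₁` and `η₂`. -/
def etaDisc (p q muH muL : ℝ) : ℝ :=
  etaB p q muH muL ^ 2 + 4 * (1 - p) * (1 - q) * (muH - (1 - p) * muL) * (1 - muL) * q

def eta1 (p q muH muL : ℝ) : ℝ :=
  (etaB p q muH muL + √(etaDisc p q muH muL)) / (2 * (1 - p) * (1 - q) * muL)

def eta2 (p q muH muL : ℝ) : ℝ :=
  (etaB p q muH muL - √(etaDisc p q muH muL)) / (2 * (1 - p) * (1 - q) * muL)

def coefA (p q muH muL : ℝ) : ℝ :=
  pi00 p q muH muL / (2 * (1 - p) * muL) *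
    (eta1 p q muH muL / (eta1 p q muH muL - eta2 p q muH muL))

def coefB (p q muH muL : ℝ) : ℝ :=
  pi00 p q muH muL / (2 * (1 - p) * muL) *
    (eta2 p q muH muL / (eta2 p q muH muL - eta1 p q muH muL))

/-- `h₂(x, y) = y (∑ p⁽²⁾ᵢⱼ xⁱ yʲ - 1) = a₂(y) x + b₂(y)`, where `p⁽²⁾ᵢⱼ` is the probability of the
increment `(i, j)` from a state `(0, n)`, `n ≥ 1`.  This is `b₂(y)`. -/
def bTwo (p q muH muL y : ℝ) : ℝ :=
  (1 - p) * (1 - q) * muL +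
    ((1 - p) * (1 - q) * (1 - muL) + p * (1 - q) * muH + (1 - p) * q * muL - 1) * y +
    (p * q * muH + (1 - p) * q * (1 - muL)) * y ^ 2

/-- This is `a₂(y)`. -/
def aTwo (p q muH y : ℝ) : ℝ := p * (1 - q) * (1 - muH) * y + p * q * (1 - muH) * y ^ 2

def hTwo (p q muH muL x y : ℝ) : ℝ := aTwo p q muH y * x + bTwo p q muH muL y

/-! Constants for the boundary probabilities (no high-priority customer). -/

def Cl1 (p q muH muL : ℝ) : ℝ :=
  2 * coefA p q muH muL * F p q muH muL (1 / eta1 p q muH muL) /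
    (q * (eta1 p q muH muL)⁻¹ + (1 - q))

def Cl2 (p q muH muL : ℝ) : ℝ :=
  coefA p q muH muL * ((1 - p) - muH) * q * yZero p q muH *
      √(yZero p q muH * (yOne p q muH - yZero p q muH)) /
    ((q * yZero p q muH + (1 - q)) * √Real.pi)

def Cl3 (p q muH muL : ℝ) : ℝ :=
  (coefA p q muH muL /
        ((q * yZero p q muH + (1 - q)) * (1 - eta1 p q muH muL * yZero p q muH)) +
      coefB p q muH muL /
        ((q * yZero p q muH + (1 - q)) * (1 - eta2 p q muH muL * yZero p q muH))) *
    ((muH - (1 - p)) * q * yZero p q muH / (2 * √Real.pi)) *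
    √(yZero p q muH * (yOne p q muH - yZero p q muH))

/-! Constants for the probabilities with `i ≥ 1` high-priority customers. -/

def C1 (p q muH muL : ℝ) (i : ℕ) : ℝ :=
  (1 - (p * muH + (1 - p) * (1 - muL)) * (q * (eta1 p q muH muL)⁻¹ + (1 - q)) -
        (1 - p) * muL * (q + (1 - q) * eta1 p q muH muL)) /
      ((1 - p) * muH * (q * (eta1 p q muH muL)⁻¹ + (1 - q))) *
    (p * (1 - muH) / ((1 - p) * muH - (1 - p) * muL * (1 - eta1 p q muH muL))) ^ (i - 1) *
    Cl1 p q muH muL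

def C2 (p q muH muL : ℝ) (i : ℕ) : ℝ :=
  (1 - (p * muH + (1 - p) * (1 - muL)) * (q * yZero p q muH + (1 - q)) -
        (1 - p) * muL * (q + (1 - q) * (yZero p q muH)⁻¹)) /
      ((1 - p) * muH * (q * yZero p q muH + (1 - q))) *
    (p * (1 - muH) / ((1 - p) * muH - (1 - p) * muL * (1 - (yZero p q muH)⁻¹))) ^ (i - 1) *
    Cl2 p q muH muL

def C3 (p q muH muL : ℝ) (i : ℕ) : ℝ :=
  -(bTwo p q muH muL (yZero p q muH) / (yZero p q muH * kerC p q muH (yZero p q muH)) +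
      hTwo p q muH muL (xZero p q muH (yZero p q muH)) (yZero p q muH) /
        (yZero p q muH * kerC p q muH (yZero p q muH)) * ((i : ℝ) - 1)) *
    (2 * p * (1 - muH) * (q * yZero p q muH + (1 - q)) /
      (1 - (p * muH + (1 - p) * (1 - muH)) * (q * yZero p q muH + (1 - q)))) ^ (i - 1) *
    Cl3 p q muH muL

end

end PriorityQueue

/-!
Write `Πᵢ(y) = ∑ⱼ πᵢⱼ yʲ`. The balance equations at states with a high-priority customer are a linear
recurrence of order two in `i` for the series `Πᵢ`. Its characteristic equation is the kernel equation
`r = (q y + 1 - q) P(r)` with `P(z) = p (1 - μ_h) + (p μ_h + (1 - p) (1 - μ_h)) z + (1 - p) μ_h z²`, and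
boundedness of `π` leaves only the branch `r` that is a power series: `Πᵢ = Π₀ rⁱ` (`genFun_eq`). The
balance equations at states without a high-priority customer and the normalisation `∑ π = 1` then give
two formulas for `Π₀`, with `K = μ_l (1 - ρ)`:

* `Π₀ W(r) = K (1 - r) P(r)` for an explicit quadratic polynomial `W` (`genFun_mul_quadSer`);
* `Π₀ (F - y √Δ) = 2 K (1 - y)`, and after rationalisation
  `Π₀ (1 - η₁ y) · 4 (1 - p)² (1 - q) μ_l² (q y + 1 - q) (1 - η₂ y) = 2 K (F + y √Δ)`
  (`genFun_mul_fSer_sub`, `genFun_mul_eta`).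

The first formula decides where `Π₀` is singular. The branch `r` has nonnegative coefficients and a
square-root singularity at `y₀` (`Params.exists_isBranch`), so `|r| ≤ r(y₀) < 1` on the disc `|y| ≤ y₀`.
The polynomial `W` has one zero `w` in `(0, 1)`, and its other linear factor has no zero in the disc of
radius `r(y₀)` (`Params.exists_quadFactor`). Therefore `W(r)` vanishes in the disc `|y| ≤ y₀` exactly
when `w ≤ r(y₀)`, namely at the point `1 / η₁`, where `r = w` (`Params.exists_pole`), and `F(y₀)` has the
sign of `r(y₀) - w` (`Params.F_yZero`). Accordingly the dominant singularity of `Πᵢ` is a simple pole at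
`1 / η₁ < y₀`, a pole and a branch point coinciding at `y₀`, or the branch point `y₀` alone. The second
formula supplies the constants.

The transfer from singularities to coefficients uses no complex analysis. Everything is expressed by the
predicate `Tail R A c`, that is `Aⱼ Rʲ j ^ (3/2) → c`. It holds for `√(1 - y / R)` by the asymptotics of
the Catalan numbers (`tail_sqrtSeries`), and is preserved by sums, by products (`Tail.mul`) and by
`A ↦ 1 / (1 - A)` when `∑ |Aⱼ| Rʲ < 1` (`Tail.inv_one_sub`). Division by `1 - η y` turns coefficients into
partial sums, which gives a limit at a simple pole (`tendsto_coeff_of_simple_pole`) and the order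
`j ^ (-1/2)` at a branch point where the numerator vanishes (`Tail.sqrtTail_of_mul_one_sub`).
-/

namespace PriorityQueue

open PowerSeries

/-! ### Evaluation of absolutely convergent power series -/

/-- The power series `A` converges absolutely at the real number `R`. -/
def AbsConv (R : ℝ) (A : ℝ⟦X⟧) : Prop := Summable fun j => |coeff j A * R ^ j|

/-- The value of the power series `A` at `R`; it is meaningful under `AbsConv R A`. -/
noncomputable def ev (R : ℝ) (A : ℝ⟦X⟧) : ℝ := ∑' j, coeff j A * R ^ j

lemma AbsConv.summable {R : ℝ} {A : ℝ⟦X⟧} (hA : AbsConv R A) :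
    Summable fun j => coeff j A * R ^ j := Summable.of_abs hA

lemma absConv_iff_norm {R : ℝ} {A : ℝ⟦X⟧} :
    AbsConv R A ↔ Summable fun j => ‖coeff j A * R ^ j‖ := by
  simp only [Real.norm_eq_abs]; rfl

lemma AbsConv.add {R : ℝ} {A B : ℝ⟦X⟧} (hA : AbsConv R A) (hB : AbsConv R B) :
    AbsConv R (A + B) := by
  refine Summable.of_nonneg_of_le (fun _ => abs_nonneg _) (fun j => ?_) (Summable.add hA hB)
  rw [map_add, add_mul]
  exact abs_add_le _ _

lemma AbsConv.neg {R : ℝ} {A : ℝ⟦X⟧} (hA : AbsConv R A) : AbsConv R (-A) := by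
  simpa [AbsConv] using hA

lemma AbsConv.sub {R : ℝ} {A B : ℝ⟦X⟧} (hA : AbsConv R A) (hB : AbsConv R B) :
    AbsConv R (A - B) := by
  rw [sub_eq_add_neg]; exact hA.add hB.neg

lemma coeff_mul_pow_mul (R : ℝ) (A B : ℝ⟦X⟧) (j : ℕ) :
    coeff j (A * B) * R ^ j = ∑ kl ∈ Finset.HasAntidiagonal.antidiagonal j,
      (coeff kl.1 A * R ^ kl.1) * (coeff kl.2 B * R ^ kl.2) := by
  rw [coeff_mul, Finset.sum_mul]
  refine Finset.sum_congr rfl fun kl hkl => ?_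
  rw [← Finset.HasAntidiagonal.mem_antidiagonal.mp hkl, pow_add]
  ring

lemma AbsConv.mul {R : ℝ} {A B : ℝ⟦X⟧} (hA : AbsConv R A) (hB : AbsConv R B) :
    AbsConv R (A * B) := by
  rw [absConv_iff_norm] at *
  refine (summable_norm_sum_mul_antidiagonal_of_summable_norm hA hB).congr fun j => ?_
  rw [coeff_mul_pow_mul]

lemma absConv_of_coeff_eq_zero {R : ℝ} {A : ℝ⟦X⟧} (N : ℕ) (h : ∀ j, N ≤ j → coeff j A = 0) :
    AbsConv R A := by
  refine summable_of_ne_finset_zero (s := Finset.range N) fun j hj => ?_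
  rw [h j (by simpa using hj)]; simp

lemma absConv_C (R c : ℝ) : AbsConv R (C c) :=
  absConv_of_coeff_eq_zero 1 fun j hj => by rw [coeff_C, if_neg (by omega)]

lemma absConv_X (R : ℝ) : AbsConv R X :=
  absConv_of_coeff_eq_zero 2 fun j hj => by rw [coeff_X, if_neg (by omega)]

lemma absConv_one (R : ℝ) : AbsConv R 1 := by simpa using absConv_C R 1

lemma AbsConv.pow {R : ℝ} {A : ℝ⟦X⟧} (hA : AbsConv R A) (n : ℕ) : AbsConv R (A ^ n) := by
  induction n with
  | zero => simpa using absConv_one R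
  | succ n ih => rw [pow_succ]; exact ih.mul hA

lemma AbsConv.mono {R R' : ℝ} {A : ℝ⟦X⟧} (hA : AbsConv R A) (h0 : 0 ≤ R') (h : R' ≤ R) :
    AbsConv R' A := by
  refine Summable.of_nonneg_of_le (fun _ => abs_nonneg _) (fun j => ?_) hA
  rw [abs_mul, abs_mul, abs_of_nonneg (pow_nonneg h0 j), abs_of_nonneg (pow_nonneg (h0.trans h) j)]
  gcongr

lemma ev_add {R : ℝ} {A B : ℝ⟦X⟧} (hA : AbsConv R A) (hB : AbsConv R B) :
    ev R (A + B) = ev R A + ev R B := by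
  simp only [ev, map_add, add_mul]
  exact hA.summable.tsum_add hB.summable

lemma ev_neg {R : ℝ} {A : ℝ⟦X⟧} : ev R (-A) = -ev R A := by
  simp only [ev, map_neg, neg_mul, tsum_neg]

lemma ev_sub {R : ℝ} {A B : ℝ⟦X⟧} (hA : AbsConv R A) (hB : AbsConv R B) :
    ev R (A - B) = ev R A - ev R B := by
  rw [sub_eq_add_neg, ev_add hA hB.neg, ev_neg, sub_eq_add_neg]

lemma ev_mul {R : ℝ} {A B : ℝ⟦X⟧} (hA : AbsConv R A) (hB : AbsConv R B) :
    ev R (A * B) = ev R A * ev R B := by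
  rw [absConv_iff_norm] at *
  refine Eq.trans (tsum_congr fun j => ?_)
    (tsum_mul_tsum_eq_tsum_sum_antidiagonal_of_summable_norm hA hB).symm
  rw [coeff_mul_pow_mul]

lemma ev_C (R c : ℝ) : ev R (C c) = c := by
  rw [ev, tsum_eq_single 0 fun j hj => by rw [coeff_C, if_neg hj, zero_mul]]
  simp

lemma ev_X (R : ℝ) : ev R X = R := by
  rw [ev, tsum_eq_single 1 fun j hj => by rw [coeff_X, if_neg hj, zero_mul]]
  simp

lemma ev_one (R : ℝ) : ev R 1 = 1 := by simpa using ev_C R 1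

lemma ev_pow {R : ℝ} {A : ℝ⟦X⟧} (hA : AbsConv R A) (n : ℕ) : ev R (A ^ n) = ev R A ^ n := by
  induction n with
  | zero => simpa using ev_one R
  | succ n ih => rw [pow_succ, pow_succ, ev_mul (hA.pow n) hA, ih]

lemma ev_nonneg {R : ℝ} {A : ℝ⟦X⟧} (hR : 0 ≤ R) (hA : ∀ j, 0 ≤ coeff j A) : 0 ≤ ev R A :=
  tsum_nonneg fun j => mul_nonneg (hA j) (pow_nonneg hR j)

lemma ev_mono {R R' : ℝ} {A : ℝ⟦X⟧} (hA : AbsConv R A) (h : ∀ j, 0 ≤ coeff j A) (h0 : 0 ≤ R')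
    (hR : R' ≤ R) : ev R' A ≤ ev R A := by
  refine (hA.mono h0 hR).summable.tsum_le_tsum (fun j => ?_) hA.summable
  have := h j
  gcongr

lemma coeff_zero_le_ev {R : ℝ} {A : ℝ⟦X⟧} (hA : AbsConv R A) (hR : 0 ≤ R)
    (h : ∀ j, 0 ≤ coeff j A) : coeff 0 A ≤ ev R A := by
  have := hA.summable.le_tsum 0 fun j _ => mul_nonneg (h j) (pow_nonneg hR j)
  simpa [ev] using this

lemma tsum_abs_eq_ev {R : ℝ} {A : ℝ⟦X⟧} (hR : 0 ≤ R) (h : ∀ j, 0 ≤ coeff j A) :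
    ∑' j, |coeff j A * R ^ j| = ev R A :=
  tsum_congr fun j => abs_of_nonneg (mul_nonneg (h j) (pow_nonneg hR j))

lemma coeff_mul_nonneg {A B : ℝ⟦X⟧} (hA : ∀ j, 0 ≤ coeff j A) (hB : ∀ j, 0 ≤ coeff j B) (j : ℕ) :
    0 ≤ coeff j (A * B) := by
  rw [coeff_mul]
  exact Finset.sum_nonneg fun kl _ => mul_nonneg (hA _) (hB _)

/-- A power series `B = A + E * B` with nonnegative data and `E(0) < 1` has nonnegative
coefficients. -/
lemma coeff_nonneg_of_eq_add_mul {A B E : ℝ⟦X⟧} (hA : ∀ j, 0 ≤ coeff j A)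
    (hE : ∀ j, 0 ≤ coeff j E) (hE0 : coeff 0 E < 1) (h : B = A + E * B) (j : ℕ) :
    0 ≤ coeff j B := by
  induction j using Nat.strong_induction_on with
  | _ j ih =>
    have h1 : coeff j B = coeff j A + coeff j (E * B) := by
      conv_lhs => rw [h]
      exact map_add _ _ _
    rw [coeff_mul, Finset.Nat.sum_antidiagonal_eq_sum_range_succ_mk, Finset.sum_range_succ',
      Nat.sub_zero] at h1
    have h2 : 0 ≤ ∑ k ∈ Finset.range j, coeff (k + 1) E * coeff (j - (k + 1)) B :=
      Finset.sum_nonneg fun k hk =>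
        mul_nonneg (hE _) (ih _ (by have := Finset.mem_range.mp hk; omega))
    have h3 := hA j
    nlinarith

/-! ### Coefficient asymptotics of products -/

/-- The coefficients of `A` satisfy `Aⱼ Rʲ ∼ c j ^ (-3/2)`, or `o(j ^ (-3/2))` when `c = 0`. -/
def Tail (R : ℝ) (A : ℝ⟦X⟧) (c : ℝ) : Prop :=
  Tendsto (fun j : ℕ => coeff j A * R ^ j * (j * √j)) atTop (𝓝 c)

/-- The coefficients of `A` satisfy `Aⱼ Rʲ ∼ c j ^ (-1/2)`, or `o(j ^ (-1/2))` when `c = 0`. -/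
def SqrtTail (R : ℝ) (A : ℝ⟦X⟧) (c : ℝ) : Prop :=
  Tendsto (fun j : ℕ => coeff j A * R ^ j * √j) atTop (𝓝 c)

lemma summable_inv_mul_sqrt : Summable fun j : ℕ => (((j : ℝ) + 1) * √((j : ℝ) + 1))⁻¹ := by
  have h := (summable_nat_add_iff 1).mpr (Real.summable_nat_rpow_inv.mpr (by norm_num : (1:ℝ) < 3 / 2))
  refine h.congr fun j => ?_
  have h0 : (0 : ℝ) < (j : ℝ) + 1 := by positivity
  rw [Nat.cast_add_one, show (3 / 2 : ℝ) = 1 + 1 / 2 by norm_num, Real.rpow_add h0, Real.rpow_one,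
    Real.sqrt_eq_rpow]

lemma exists_bound_of_tendsto_mul {u f f' : ℕ → ℝ} {c : ℝ} (hf' : ∀ j, 0 < f' j) {K : ℝ}
    (hff' : ∀ j, 1 ≤ j → f' j ≤ K * f j) (h : Tendsto (fun j => u j * f j) atTop (𝓝 c)) :
    ∃ M, 0 < M ∧ ∀ j, |u j| ≤ M * (f' j)⁻¹ := by
  obtain ⟨M, hM⟩ := (Metric.isBounded_range_of_tendsto _ h).exists_norm_le
  have hM' : ∀ j, |u j * f j| ≤ M := fun j => by simpa using hM _ ⟨j, rfl⟩
  refine ⟨|K| * |M| + |u 0| * f' 0 + 1, by have := hf' 0; positivity, fun j => ?_⟩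
  rw [← div_eq_mul_inv, le_div_iff₀ (hf' j)]
  have h0 := mul_nonneg (abs_nonneg (u 0)) (hf' 0).le
  have h0' := mul_nonneg (abs_nonneg K) (abs_nonneg M)
  rcases Nat.eq_zero_or_pos j with rfl | hj
  · linarith
  · have h1 : |u j| * f' j ≤ |u j| * (|K| * |f j|) := by
      gcongr
      calc f' j ≤ K * f j := hff' j hj
        _ ≤ |K * f j| := le_abs_self _
        _ = _ := abs_mul _ _
    have h2 : |u j| * (|K| * |f j|) ≤ |K| * |M| := by
      have := (hM' j).trans (le_abs_self M)
      rw [abs_mul] at this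
      nlinarith [abs_nonneg K]
    linarith

lemma exists_bound_of_tendsto_mul_sqrt {u : ℕ → ℝ} {c : ℝ}
    (h : Tendsto (fun j : ℕ => u j * √j) atTop (𝓝 c)) :
    ∃ M, 0 < M ∧ ∀ j : ℕ, |u j| ≤ M * (√((j : ℝ) + 1))⁻¹ := by
  refine exists_bound_of_tendsto_mul (K := √2) (fun j => by positivity) (fun j hj => ?_) h
  rw [← Real.sqrt_mul (by norm_num)]
  have : (1 : ℝ) ≤ j := by exact_mod_cast hj
  exact Real.sqrt_le_sqrt (by linarith)

lemma Tail.exists_bound {R : ℝ} {A : ℝ⟦X⟧} {c : ℝ} (h : Tail R A c) :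
    ∃ M, 0 < M ∧ ∀ j : ℕ, |coeff j A * R ^ j| ≤ M * (((j : ℝ) + 1) * √((j : ℝ) + 1))⁻¹ := by
  refine exists_bound_of_tendsto_mul (K := 2 * √2) (fun j => by positivity) (fun j hj => ?_) h
  have h1 : (1 : ℝ) ≤ j := by exact_mod_cast hj
  have h2 : √((j : ℝ) + 1) ≤ √2 * √j := by
    rw [← Real.sqrt_mul (by norm_num)]
    exact Real.sqrt_le_sqrt (by linarith)
  calc ((j : ℝ) + 1) * √((j : ℝ) + 1) ≤ (2 * j) * (√2 * √j) := by gcongr; linarith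
    _ = _ := by ring

lemma Tail.absConv {R : ℝ} {A : ℝ⟦X⟧} {c : ℝ} (h : Tail R A c) : AbsConv R A := by
  obtain ⟨M, -, hM⟩ := h.exists_bound
  exact Summable.of_nonneg_of_le (fun _ => abs_nonneg _) hM (summable_inv_mul_sqrt.mul_left M)

lemma sum_range_inv_sqrt_le (n : ℕ) :
    ∑ k ∈ Finset.range n, (√((k : ℝ) + 1))⁻¹ ≤ 2 * √n := by
  induction n with
  | zero => simp
  | succ n ih =>
    rw [Finset.sum_range_succ, Nat.cast_add_one]
    have ha : 0 < √((n : ℝ) + 1) := by positivity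
    have h1 : √((n : ℝ) + 1) ^ 2 = n + 1 := Real.sq_sqrt (by positivity)
    have h2 : √(n : ℝ) ^ 2 = n := Real.sq_sqrt (by positivity)
    have h3 : (√((n : ℝ) + 1))⁻¹ ≤ 2 * √((n : ℝ) + 1) - 2 * √n := by
      rw [inv_le_iff_one_le_mul₀ ha]
      nlinarith [sq_nonneg (√((n : ℝ) + 1) - √n)]
    linarith

/-- If `uⱼ ∼ c j ^ (-1/2)` and `bⱼ = O(j ^ (-3/2))`, then the convolution `u * b` is asymptotic to
`c (∑ b) j ^ (-1/2)`. -/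
lemma tendsto_convolution_mul_sqrt {u b : ℕ → ℝ} {c M : ℝ}
    (hu : Tendsto (fun j : ℕ => u j * √j) atTop (𝓝 c))
    (hb : ∀ j : ℕ, |b j| ≤ M * (((j : ℝ) + 1) * √((j : ℝ) + 1))⁻¹) :
    Tendsto (fun j : ℕ => (∑ kl ∈ Finset.HasAntidiagonal.antidiagonal j, u kl.1 * b kl.2) * √j) atTop
      (𝓝 (c * ∑' j, b j)) := by
  obtain ⟨U, hU0, hU⟩ := exists_bound_of_tendsto_mul_sqrt hu
  have hM : 0 ≤ M := by
    have := (abs_nonneg _).trans (hb 0)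
    simpa using this
  have hbs : Summable fun j => |b j| :=
    Summable.of_nonneg_of_le (fun _ => abs_nonneg _) hb (summable_inv_mul_sqrt.mul_left M)
  -- The terms whose `b`-index is at most half of `j` are dominated by a multiple of `|b|`.
  have key1 : Tendsto (fun j : ℕ => ∑' k, if 2 * k ≤ j then b k * (u (j - k) * √j) else 0) atTop
      (𝓝 (∑' k, b k * c)) := by
    refine tendsto_tsum_of_dominated_convergence (bound := fun k => |b k| * (U * √2))
      (hbs.mul_right _) (fun k => ?_) (Eventually.of_forall fun j k => ?_)
    · have h1 : Tendsto (fun j : ℕ => u (j - k) * √((j - k : ℕ) : ℝ)) atTop (𝓝 c) :=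
        hu.comp (tendsto_sub_atTop_nat k)
      have h2 : Tendsto (fun j : ℕ => √(((j + k : ℕ) : ℝ) / j)) atTop (𝓝 1) := by
        have h3 : Tendsto (fun j : ℕ => ((j + k : ℕ) : ℝ) / j) atTop (𝓝 1) := by
          have h4 := (tendsto_const_div_atTop_nhds_zero_nat (k : ℝ)).const_add 1
          rw [add_zero] at h4
          refine h4.congr' ?_
          filter_upwards [eventually_gt_atTop 0] with j hj
          have : (j : ℝ) ≠ 0 := by exact_mod_cast hj.ne'
          push_cast
          field_simp
        rw [← Real.sqrt_one]
        exact (Real.continuous_sqrt.tendsto 1).comp h3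
      have h5 : Tendsto (fun j : ℕ => √((j : ℝ) / ((j - k : ℕ) : ℝ))) atTop (𝓝 1) := by
        refine (h2.comp (tendsto_sub_atTop_nat k)).congr' ?_
        filter_upwards [eventually_ge_atTop k] with j hj
        simp only [Function.comp, Nat.sub_add_cancel hj]
      have h6 : Tendsto (fun j : ℕ => u (j - k) * √j) atTop (𝓝 c) := by
        have h7 := h1.mul h5
        rw [mul_one] at h7
        refine h7.congr' ?_
        filter_upwards [eventually_gt_atTop k] with j hj
        have h8 : 0 < √((j - k : ℕ) : ℝ) := Real.sqrt_pos.mpr (by exact_mod_cast Nat.sub_pos_of_lt hj)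
        rw [Real.sqrt_div (by positivity)]
        field_simp
      refine (h6.const_mul (b k)).congr' ?_
      filter_upwards [eventually_ge_atTop (2 * k)] with j hj
      rw [if_pos hj]
    · split_ifs with hk
      · rw [Real.norm_eq_abs, abs_mul, abs_mul, abs_of_nonneg (Real.sqrt_nonneg _)]
        refine mul_le_mul_of_nonneg_left ?_ (abs_nonneg _)
        have h1 := hU (j - k)
        have h2 : √(j : ℝ) ≤ √2 * √(((j - k : ℕ) : ℝ) + 1) := by
          rw [← Real.sqrt_mul (by norm_num)]
          refine Real.sqrt_le_sqrt ?_
          have : (j : ℝ) ≤ 2 * ((j - k : ℕ) : ℝ) := by exact_mod_cast (by omega : j ≤ 2 * (j - k))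
          linarith
        calc |u (j - k)| * √(j : ℝ)
            ≤ (U * (√(((j - k : ℕ) : ℝ) + 1))⁻¹) * (√2 * √(((j - k : ℕ) : ℝ) + 1)) := by gcongr
          _ = U * √2 := by field_simp
      · simp only [norm_zero]; positivity
  -- The other terms contribute `O(j ^ (-3/2) * j ^ (1/2))`, before multiplication by `√j`.
  have key2 : Tendsto (fun j : ℕ => ∑ k ∈ Finset.range (j + 1),
      if 2 * k ≤ j then 0 else b k * (u (j - k) * √j)) atTop (𝓝 0) := by
    have hlim : Tendsto (fun j : ℕ => 4 * √2 * M * U * 1 / √((j : ℝ) + 1)) atTop (𝓝 0) := by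
      refine Tendsto.div_atTop tendsto_const_nhds ?_
      exact Real.tendsto_sqrt_atTop.comp
        (tendsto_atTop_add_const_right _ _ tendsto_natCast_atTop_atTop)
    refine squeeze_zero_norm (fun j => ?_) hlim
    have hj : (0 : ℝ) < (j : ℝ) + 1 := by positivity
    have hs : 0 < √((j : ℝ) + 1) := by positivity
    have hterm : ∀ k ∈ Finset.range (j + 1), ‖if 2 * k ≤ j then 0 else b k * (u (j - k) * √j)‖
        ≤ 2 * √2 * M * U * ((j : ℝ) + 1)⁻¹ * (√(((j - k : ℕ) : ℝ) + 1))⁻¹ := by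
      intro k hk
      split_ifs with h
      · simp only [norm_zero]; positivity
      · rw [Real.norm_eq_abs, abs_mul, abs_mul, abs_of_nonneg (Real.sqrt_nonneg _)]
        have h1 : (j : ℝ) + 1 ≤ 2 * ((k : ℝ) + 1) := by exact_mod_cast (by omega : j + 1 ≤ 2 * (k + 1))
        have h2 : √((j : ℝ) + 1) ≤ √2 * √((k : ℝ) + 1) := by
          rw [← Real.sqrt_mul (by norm_num)]
          exact Real.sqrt_le_sqrt h1
        have h3 : |b k| ≤ M * (2 * √2 * (((j : ℝ) + 1) * √((j : ℝ) + 1))⁻¹) := by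
          refine (hb k).trans ?_
          gcongr
          rw [← div_eq_mul_inv, inv_eq_one_div, div_le_div_iff₀ (by positivity) (by positivity), one_mul]
          calc ((j : ℝ) + 1) * √((j : ℝ) + 1) ≤ (2 * ((k : ℝ) + 1)) * (√2 * √((k : ℝ) + 1)) := by
                gcongr
            _ = _ := by ring
        calc |b k| * (|u (j - k)| * √(j : ℝ))
            ≤ M * (2 * √2 * (((j : ℝ) + 1) * √((j : ℝ) + 1))⁻¹) *
              (U * (√(((j - k : ℕ) : ℝ) + 1))⁻¹ * √((j : ℝ) + 1)) := by
                gcongr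
                · exact hU _
                · linarith
          _ = _ := by field_simp
    refine (norm_sum_le_of_le _ hterm).trans ?_
    rw [← Finset.mul_sum]
    have h1 : ∑ k ∈ Finset.range (j + 1), (√(((j - k : ℕ) : ℝ) + 1))⁻¹ ≤ 2 * √((j : ℝ) + 1) := by
      have := Finset.sum_range_reflect (fun k : ℕ => (√((k : ℝ) + 1))⁻¹) (j + 1)
      simp only [Nat.add_sub_cancel] at this
      rw [this]
      exact_mod_cast sum_range_inv_sqrt_le (j + 1)
    calc 2 * √2 * M * U * ((j : ℝ) + 1)⁻¹ * ∑ k ∈ Finset.range (j + 1), (√(((j - k : ℕ) : ℝ) + 1))⁻¹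
        ≤ 2 * √2 * M * U * ((j : ℝ) + 1)⁻¹ * (2 * √((j : ℝ) + 1)) := by gcongr
      _ = 4 * √2 * M * U * (√((j : ℝ) + 1) / ((j : ℝ) + 1)) := by ring
      _ = 4 * √2 * M * U * (1 / √((j : ℝ) + 1)) := by
          rw [Real.sqrt_div_self', one_div]
      _ = _ := by ring
  have key := key1.add key2
  rw [add_zero, tsum_mul_right, mul_comm] at key
  refine key.congr fun j => ?_
  rw [tsum_eq_sum (s := Finset.range (j + 1)) fun k hk => if_neg (by
    have := Finset.mem_range.not.mp hk; omega), ← Finset.sum_add_distrib,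
    Finset.Nat.sum_antidiagonal_eq_sum_range_succ_mk, Finset.sum_mul]
  simp only
  rw [← Finset.sum_range_reflect]
  simp only [Nat.add_sub_cancel]
  refine Finset.sum_congr rfl fun k hk => ?_
  have hk' : k ≤ j := Nat.lt_succ_iff.mp (Finset.mem_range.mp hk)
  rw [Nat.sub_sub_self hk']
  split_ifs <;> ring

lemma SqrtTail.mul {R : ℝ} {A B : ℝ⟦X⟧} {c d : ℝ} (hA : SqrtTail R A c) (hB : Tail R B d) :
    SqrtTail R (A * B) (c * ev R B) := by
  obtain ⟨M, -, hM⟩ := hB.exists_bound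
  refine (tendsto_convolution_mul_sqrt (u := fun j => coeff j A * R ^ j) hA hM).congr fun j => ?_
  rw [coeff_mul_pow_mul]

lemma Tail.mul {R : ℝ} {A B : ℝ⟦X⟧} {c d : ℝ} (hA : Tail R A c) (hB : Tail R B d) :
    Tail R (A * B) (c * ev R B + d * ev R A) := by
  obtain ⟨M, -, hM⟩ := hA.exists_bound
  obtain ⟨N, -, hN⟩ := hB.exists_bound
  -- The operator `X d/dX` turns a tail of order `-3/2` into one of order `-1/2`.
  have h1 := tendsto_convolution_mul_sqrt (u := fun j => j * (coeff j A * R ^ j))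
    (hA.congr fun j => by ring) hN
  have h2 := tendsto_convolution_mul_sqrt (u := fun j => j * (coeff j B * R ^ j))
    (hB.congr fun j => by ring) hM
  refine (h1.add h2).congr fun j => ?_
  rw [← Finset.Nat.sum_antidiagonal_swap (n := j)
    (f := fun kl => (kl.1 : ℝ) * (coeff kl.1 B * R ^ kl.1) * (coeff kl.2 A * R ^ kl.2)),
    ← add_mul, ← Finset.sum_add_distrib, coeff_mul_pow_mul, ← mul_assoc]
  congr 1
  rw [Finset.sum_mul]
  refine Finset.sum_congr rfl fun kl hkl => ?_
  have : (j : ℝ) = kl.1 + kl.2 := by exact_mod_cast (Finset.HasAntidiagonal.mem_antidiagonal.mp hkl).symm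
  rw [this, Prod.fst_swap, Prod.snd_swap]
  ring

lemma Tail.add {R : ℝ} {A B : ℝ⟦X⟧} {c d : ℝ} (hA : Tail R A c) (hB : Tail R B d) :
    Tail R (A + B) (c + d) := by
  refine (Tendsto.add hA hB).congr fun j => ?_
  rw [map_add]; ring

lemma Tail.sub {R : ℝ} {A B : ℝ⟦X⟧} {c d : ℝ} (hA : Tail R A c) (hB : Tail R B d) :
    Tail R (A - B) (c - d) := by
  refine (Tendsto.sub hA hB).congr fun j => ?_
  rw [map_sub]; ring

lemma Tail.of_coeff_eq_zero {R : ℝ} {A : ℝ⟦X⟧} (N : ℕ) (h : ∀ j, N ≤ j → coeff j A = 0) :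
    Tail R A 0 := by
  refine tendsto_const_nhds.congr' ?_
  filter_upwards [eventually_ge_atTop N] with j hj
  rw [h j hj]; ring

lemma tail_C (R c : ℝ) : Tail R (C c) 0 :=
  Tail.of_coeff_eq_zero 1 fun j hj => by rw [coeff_C, if_neg (by omega)]

lemma tail_X (R : ℝ) : Tail R X 0 :=
  Tail.of_coeff_eq_zero 2 fun j hj => by rw [coeff_X, if_neg (by omega)]

lemma tail_one (R : ℝ) : Tail R 1 0 := by simpa using tail_C R 1

lemma Tail.C_mul {R : ℝ} {A : ℝ⟦X⟧} {c : ℝ} (hA : Tail R A c) (a : ℝ) :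
    Tail R (C a * A) (a * c) := by
  refine (Tendsto.const_mul a hA).congr fun j => ?_
  rw [coeff_C_mul]; ring

lemma Tail.pow {R : ℝ} {A : ℝ⟦X⟧} {c : ℝ} (hA : Tail R A c) (n : ℕ) :
    Tail R (A ^ n) (n * ev R A ^ (n - 1) * c) := by
  induction n with
  | zero => simpa using tail_one R
  | succ n ih =>
    rw [pow_succ]
    have h := ih.mul hA
    rw [ev_pow hA.absConv] at h
    convert h using 1
    rcases n with _ | n
    · simp
    · simp only [Nat.add_sub_cancel]
      push_cast
      ring

lemma Tail.unique {R : ℝ} {A : ℝ⟦X⟧} {c d : ℝ} (h : Tail R A c) (h' : Tail R A d) : c = d :=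
  tendsto_nhds_unique h h'

/-! ### Inversion of power series with polynomial-type tails -/

/-- The coefficients of `A` satisfy `Aⱼ Rʲ = O(j ^ (-3/2))`. -/
def TailO (R : ℝ) (A : ℝ⟦X⟧) : Prop :=
  ∃ M, ∀ j : ℕ, |coeff j A * R ^ j| ≤ M * (((j : ℝ) + 1) * √((j : ℝ) + 1))⁻¹

lemma TailO.absConv {R : ℝ} {A : ℝ⟦X⟧} (h : TailO R A) : AbsConv R A := by
  obtain ⟨M, hM⟩ := h
  exact Summable.of_nonneg_of_le (fun _ => abs_nonneg _) hM (summable_inv_mul_sqrt.mul_left M)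

lemma tailO_iff {R : ℝ} {A : ℝ⟦X⟧} :
    TailO R A ↔ ∃ M, ∀ j : ℕ, |coeff j A * R ^ j| * (((j : ℝ) + 1) * √((j : ℝ) + 1)) ≤ M := by
  refine exists_congr fun M => forall_congr' fun j => ?_
  rw [← div_eq_mul_inv, le_div_iff₀ (by positivity)]

/-- In a splitting `j = k + l` one has `j + 1 ≤ K (l + 1)` or `j + 1 ≤ K / (K - 1) (k + 1)`, so the
weight `(j + 1) ^ (3/2)` is controlled by those of the parts. The factor `K ^ (3/2)` at `l` can be taken
close to `1`, which is what makes the inversion of `1 - A` work. -/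
lemma weight_le_add {K : ℝ} (hK : 1 < K) (k l : ℕ) :
    (((k + l : ℕ) : ℝ) + 1) * √(((k + l : ℕ) : ℝ) + 1) ≤
      K * √K * (((l : ℝ) + 1) * √((l : ℝ) + 1)) +
      K / (K - 1) * √(K / (K - 1)) * (((k : ℝ) + 1) * √((k : ℝ) + 1)) := by
  have hK1 : 0 < K - 1 := by linarith
  have hN : 0 < K / (K - 1) := by positivity
  have aux : ∀ (m : ℕ) (c : ℝ), 0 < c → ((k + l : ℕ) : ℝ) + 1 ≤ c * ((m : ℝ) + 1) →
      (((k + l : ℕ) : ℝ) + 1) * √(((k + l : ℕ) : ℝ) + 1) ≤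
        c * √c * (((m : ℝ) + 1) * √((m : ℝ) + 1)) := by
    intro m c hc h
    calc (((k + l : ℕ) : ℝ) + 1) * √(((k + l : ℕ) : ℝ) + 1)
        ≤ (c * ((m : ℝ) + 1)) * √(c * ((m : ℝ) + 1)) := by gcongr
      _ = _ := by rw [Real.sqrt_mul hc.le]; ring
  rcases le_or_gt (((k + l : ℕ) : ℝ) + 1) (K * ((l : ℝ) + 1)) with h | h
  · have := aux l K (by linarith) h
    have : 0 ≤ K / (K - 1) * √(K / (K - 1)) * (((k : ℝ) + 1) * √((k : ℝ) + 1)) := by positivity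
    linarith
  · have h1 : ((k + l : ℕ) : ℝ) + 1 ≤ K / (K - 1) * ((k : ℝ) + 1) := by
      rw [div_mul_eq_mul_div, le_div_iff₀ hK1]
      push_cast at h ⊢
      nlinarith
    have := aux k _ hN h1
    have : 0 ≤ K * √K * (((l : ℝ) + 1) * √((l : ℝ) + 1)) := by positivity
    linarith

lemma sum_antidiagonal_le_mul_tsum {u v : ℕ → ℝ} {M : ℝ} (hu : ∀ j, 0 ≤ u j) (hM : 0 ≤ M)
    (hs : Summable u) (j : ℕ) (hv : ∀ l, l ≤ j → v l ≤ M) :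
    ∑ kl ∈ Finset.HasAntidiagonal.antidiagonal j, u kl.1 * v kl.2 ≤ (∑' k, u k) * M := by
  rw [Finset.Nat.sum_antidiagonal_eq_sum_range_succ_mk]
  calc ∑ k ∈ Finset.range j.succ, u k * v (j - k)
      ≤ ∑ k ∈ Finset.range j.succ, u k * M :=
        Finset.sum_le_sum fun k _ => mul_le_mul_of_nonneg_left (hv _ (Nat.sub_le _ _)) (hu k)
    _ = (∑ k ∈ Finset.range j.succ, u k) * M := (Finset.sum_mul _ _ _).symm
    _ ≤ _ := mul_le_mul_of_nonneg_right (hs.sum_le_tsum _ fun k _ => hu k) hM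

/-- A weighted convolution is bounded by the two one-sided bounds coming from `weight_le_add`. -/
lemma abs_coeff_mul_weight_le {R : ℝ} (A B : ℝ⟦X⟧) {K : ℝ} (hK : 1 < K) (j : ℕ) :
    |coeff j (A * B) * R ^ j| * (((j : ℝ) + 1) * √((j : ℝ) + 1)) ≤
      K * √K * (∑ kl ∈ Finset.HasAntidiagonal.antidiagonal j, |coeff kl.1 A * R ^ kl.1| *
        (|coeff kl.2 B * R ^ kl.2| * (((kl.2 : ℝ) + 1) * √((kl.2 : ℝ) + 1)))) +
      K / (K - 1) * √(K / (K - 1)) * (∑ kl ∈ Finset.HasAntidiagonal.antidiagonal j,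
        |coeff kl.1 B * R ^ kl.1| *
        (|coeff kl.2 A * R ^ kl.2| * (((kl.2 : ℝ) + 1) * √((kl.2 : ℝ) + 1)))) := by
  rw [← Finset.Nat.sum_antidiagonal_swap (n := j) (f := fun kl => |coeff kl.1 B * R ^ kl.1| *
        (|coeff kl.2 A * R ^ kl.2| * (((kl.2 : ℝ) + 1) * √((kl.2 : ℝ) + 1)))),
    Finset.mul_sum, Finset.mul_sum, ← Finset.sum_add_distrib, coeff_mul_pow_mul]
  refine (mul_le_mul_of_nonneg_right (Finset.abs_sum_le_sum_abs _ _) (by positivity)).trans ?_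
  rw [Finset.sum_mul]
  refine Finset.sum_le_sum fun kl hkl => ?_
  have h := weight_le_add hK kl.1 kl.2
  rw [Finset.HasAntidiagonal.mem_antidiagonal.mp hkl] at h
  rw [abs_mul, Prod.fst_swap, Prod.snd_swap]
  have := mul_le_mul_of_nonneg_left h
    (mul_nonneg (abs_nonneg (coeff kl.1 A * R ^ kl.1)) (abs_nonneg (coeff kl.2 B * R ^ kl.2)))
  linarith

lemma TailO.mul {R : ℝ} {A B : ℝ⟦X⟧} (hA : TailO R A) (hB : TailO R B) : TailO R (A * B) := by
  have hAs := hA.absConv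
  have hBs := hB.absConv
  rw [tailO_iff] at hA hB ⊢
  obtain ⟨M, hM⟩ := hA
  obtain ⟨N, hN⟩ := hB
  have hM0 : 0 ≤ M := le_trans (by positivity) (hM 0)
  have hN0 : 0 ≤ N := le_trans (by positivity) (hN 0)
  refine ⟨_, fun j => (abs_coeff_mul_weight_le A B (by norm_num : (1 : ℝ) < 2) j).trans
    (add_le_add (mul_le_mul_of_nonneg_left (sum_antidiagonal_le_mul_tsum (fun _ => abs_nonneg _)
      hN0 hAs j fun l _ => hN l) (by positivity))
    (mul_le_mul_of_nonneg_left (sum_antidiagonal_le_mul_tsum (fun _ => abs_nonneg _)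
      hM0 hBs j fun l _ => hM l) (by positivity)))⟩

/-- The inverse `B = 1 / (1 - A)` converges absolutely when `∑ |Aⱼ Rʲ| < 1`. -/
lemma AbsConv.inv_one_sub {R : ℝ} {A B : ℝ⟦X⟧} (hA : AbsConv R A)
    (hlt : ∑' j, |coeff j A * R ^ j| < 1) (h : B = 1 + A * B) : AbsConv R B := by
  set θ := ∑' j, |coeff j A * R ^ j| with hθ
  refine summable_of_sum_range_le (c := 1 / (1 - θ)) (fun _ => abs_nonneg _) fun n => ?_
  rw [le_div_iff₀ (by linarith)]
  set S := ∑ j ∈ Finset.range n, |coeff j B * R ^ j| with hS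
  have hS0 : 0 ≤ S := Finset.sum_nonneg fun _ _ => abs_nonneg _
  have h1 : ∀ j, |coeff j B * R ^ j| ≤ (if j = 0 then 1 else 0) +
      ∑ kl ∈ Finset.HasAntidiagonal.antidiagonal j,
        |coeff kl.1 A * R ^ kl.1| * |coeff kl.2 B * R ^ kl.2| := by
    intro j
    have : coeff j B * R ^ j = (if j = 0 then 1 else 0) + coeff j (A * B) * R ^ j := by
      conv_lhs => rw [h]
      rw [map_add, coeff_one, add_mul]
      rcases Nat.eq_zero_or_pos j with rfl | hj
      · simp
      · simp [hj.ne']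
    rw [this, coeff_mul_pow_mul]
    refine (abs_add_le _ _).trans (add_le_add ?_ ?_)
    · split_ifs <;> simp
    · refine (Finset.abs_sum_le_sum_abs _ _).trans_eq (Finset.sum_congr rfl fun kl _ => abs_mul _ _)
  have h2 : S ≤ 1 + ∑ j ∈ Finset.range n, ∑ kl ∈ Finset.HasAntidiagonal.antidiagonal j,
        |coeff kl.1 A * R ^ kl.1| * |coeff kl.2 B * R ^ kl.2| := by
    refine (Finset.sum_le_sum fun j _ => h1 j).trans ?_
    rw [Finset.sum_add_distrib]
    gcongr
    rw [Finset.sum_ite_eq']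
    split_ifs <;> simp
  have h3 : ∑ j ∈ Finset.range n, ∑ kl ∈ Finset.HasAntidiagonal.antidiagonal j,
        |coeff kl.1 A * R ^ kl.1| * |coeff kl.2 B * R ^ kl.2| ≤
      (∑ k ∈ Finset.range n, |coeff k A * R ^ k|) * S := by
    rw [hS, Finset.sum_mul_sum, ← Finset.sum_product']
    refine le_trans (le_of_eq ?_) (Finset.sum_le_sum_of_subset_of_nonneg
      (Finset.filter_subset (fun kl : ℕ × ℕ => kl.1 + kl.2 < n) _) fun _ _ _ => by positivity)
    rw [← Finset.sum_fiberwise_of_maps_to (g := fun kl : ℕ × ℕ => kl.1 + kl.2)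
      (t := Finset.range n) (fun kl hkl => by
        simp only [Finset.mem_filter] at hkl; exact Finset.mem_range.mpr hkl.2)]
    refine Finset.sum_congr rfl fun j hj => Finset.sum_congr ?_ fun _ _ => rfl
    have hj := Finset.mem_range.mp hj
    ext kl
    simp only [Finset.HasAntidiagonal.mem_antidiagonal, Finset.mem_filter, Finset.mem_product,
      Finset.mem_range]
    omega
  have h4 : ∑ k ∈ Finset.range n, |coeff k A * R ^ k| ≤ θ :=
    Summable.sum_le_tsum _ (fun k _ => abs_nonneg _) hA
  nlinarith

/-- The inverse `B = 1 / (1 - A)` inherits the bound `O(j ^ (-3/2))`. The weighted coefficient `Qⱼ` of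
`B` satisfies `Qⱼ ≤ K ^ (3/2) θ max_{l ≤ j} Qₗ + O(1)` with `θ = ∑ |Aₖ Rᵏ|`, and `K > 1` is chosen with
`K ^ (3/2) θ < 1`. -/
lemma TailO.inv_one_sub {R : ℝ} {A B : ℝ⟦X⟧} (hA : TailO R A)
    (hlt : ∑' j, |coeff j A * R ^ j| < 1) (h : B = 1 + A * B) : TailO R B := by
  have hAs := hA.absConv
  have hBs := hAs.inv_one_sub hlt h
  rw [tailO_iff] at hA ⊢
  obtain ⟨M, hM⟩ := hA
  have hM0 : 0 ≤ M := le_trans (by positivity) (hM 0)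
  set θ := ∑' j, |coeff j A * R ^ j| with hθ
  have hθ0 : 0 ≤ θ := tsum_nonneg fun _ => abs_nonneg _
  obtain ⟨K, hK, hKθ⟩ : ∃ K : ℝ, 1 < K ∧ K * √K * θ < 1 := by
    have hc : ContinuousAt (fun K : ℝ => K * √K * θ) 1 := by fun_prop
    have h1 : ∀ᶠ K in 𝓝 (1 : ℝ), K * √K * θ < 1 :=
      hc.eventually_lt continuousAt_const (by simpa using hlt)
    obtain ⟨K, hK1, hK2⟩ := ((h1.filter_mono nhdsWithin_le_nhds).and
      (self_mem_nhdsWithin : Set.Ioi (1 : ℝ) ∈ 𝓝[>] 1)).exists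
    exact ⟨K, hK2, hK1⟩
  set L := K / (K - 1) * √(K / (K - 1)) with hL
  have hL0 : 0 ≤ L := by
    have : 0 < K - 1 := by linarith
    positivity
  set Y := ∑' j, |coeff j B * R ^ j|
  have hY0 : 0 ≤ Y := tsum_nonneg fun _ => abs_nonneg _
  refine ⟨(1 + L * (Y * M)) / (1 - K * √K * θ), fun j => ?_⟩
  induction j using Nat.strong_induction_on with
  | _ j ih =>
    by_contra! hj
    set Q := |coeff j B * R ^ j| * (((j : ℝ) + 1) * √((j : ℝ) + 1)) with hQ
    have hle : ∀ l, l ≤ j →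
        |coeff l B * R ^ l| * (((l : ℝ) + 1) * √((l : ℝ) + 1)) ≤ Q := by
      intro l hl
      rcases hl.lt_or_eq with hl | rfl
      · exact (ih l hl).trans hj.le
      · exact le_rfl
    have hQ0 : 0 ≤ Q := by positivity
    have h1 := abs_coeff_mul_weight_le (R := R) A B hK j
    have h2 := sum_antidiagonal_le_mul_tsum (fun k => abs_nonneg (coeff k A * R ^ k)) hQ0 hAs j hle
    have h3 := sum_antidiagonal_le_mul_tsum (fun k => abs_nonneg (coeff k B * R ^ k)) hM0 hBs j
      fun l _ => hM l
    have h4 : Q ≤ 1 + |coeff j (A * B) * R ^ j| * (((j : ℝ) + 1) * √((j : ℝ) + 1)) := by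
      have : coeff j B * R ^ j = (if j = 0 then 1 else 0) * R ^ j + coeff j (A * B) * R ^ j := by
        conv_lhs => rw [h]
        rw [map_add, coeff_one, add_mul]
      rw [hQ, this]
      rcases Nat.eq_zero_or_pos j with rfl | hj0
      · simp only [if_true, pow_zero, mul_one]
        have := abs_add_le 1 (coeff 0 (A * B))
        simp only [abs_one] at this
        simpa using this
      · rw [if_neg hj0.ne', zero_mul, zero_add]
        linarith
    have h5 : K * √K * (θ * Q) + L * (Y * M) ≥
        |coeff j (A * B) * R ^ j| * (((j : ℝ) + 1) * √((j : ℝ) + 1)) :=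
      h1.trans (add_le_add (mul_le_mul_of_nonneg_left h2 (by positivity))
        (mul_le_mul_of_nonneg_left h3 hL0))
    rw [div_lt_iff₀ (by linarith)] at hj
    linarith

lemma Tail.tailO {R : ℝ} {A : ℝ⟦X⟧} {c : ℝ} (h : Tail R A c) : TailO R A := by
  obtain ⟨M, -, hM⟩ := h.exists_bound
  exact ⟨M, hM⟩

/-- The tail of `1 / (1 - A)`, when `∑ |Aⱼ Rʲ| < 1`: differentiation gives
`B' = B² A'` for `B = 1 / (1 - A)`. -/
lemma Tail.inv_one_sub {R : ℝ} {A B : ℝ⟦X⟧} {c : ℝ} (hA : Tail R A c)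
    (hlt : ∑' j, |coeff j A * R ^ j| < 1) (h : B = 1 + A * B) : Tail R B (c * ev R (B * B)) := by
  have hB := hA.tailO.inv_one_sub hlt h
  obtain ⟨M, hM⟩ := hB.mul hB
  have h1 := tendsto_convolution_mul_sqrt (u := fun j => j * (coeff j A * R ^ j))
    (hA.congr fun j => by ring) hM
  have hd : d⁄dX ℝ B = d⁄dX ℝ A * (B * B) := by
    have h2 : d⁄dX ℝ B = A * d⁄dX ℝ B + B * d⁄dX ℝ A := by
      conv_lhs => rw [h]
      simp [Derivation.leibniz]
    have h3 : B * (1 - A) = 1 := by linear_combination h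
    linear_combination (B * h2 - (d⁄dX ℝ B) * h3)
  have hcoeff : ∀ (E : ℝ⟦X⟧) j, coeff j (X * d⁄dX ℝ E) = j * coeff j E := by
    intro E j
    rcases j with _ | j
    · simp
    · rw [coeff_succ_X_mul, coeff_derivative]
      push_cast
      ring
  have hd' : X * d⁄dX ℝ B = (X * d⁄dX ℝ A) * (B * B) := by rw [hd]; ring
  refine h1.congr fun j => ?_
  have h2 := coeff_mul_pow_mul R (X * d⁄dX ℝ A) (B * B) j
  rw [← hd'] at h2
  rw [hcoeff] at h2
  simp only [hcoeff] at h2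
  rw [show coeff j B * R ^ j * (↑j * √(j : ℝ)) = (j * coeff j B * R ^ j) * √(j : ℝ) by ring, h2]
  congr 1
  exact Finset.sum_congr rfl fun kl _ => by ring

/-! ### Removing a pole at a positive point -/

lemma coeff_eq_sum_of_mul_one_sub {B M : ℝ⟦X⟧} {η s : ℝ} (hη : η * s = 1)
    (h : B * (1 - C η * X) = M) (j : ℕ) :
    coeff j B * s ^ j = ∑ k ∈ Finset.range (j + 1), coeff k M * s ^ k := by
  induction j with
  | zero => rw [← h]; simp
  | succ j ih =>
    rw [Finset.sum_range_succ, ← ih, ← h, mul_sub, mul_one, map_sub,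
      show B * (C η * X) = C η * B * X by ring, coeff_succ_mul_X, coeff_C_mul, pow_succ]
    linear_combination (coeff j B * s ^ j) * hη

/-- A simple pole of `B` at `s`, with `(1 - η X) B` absolutely convergent at `s = 1 / η`. -/
lemma tendsto_coeff_of_simple_pole {B M : ℝ⟦X⟧} {η s : ℝ} (hη : η * s = 1)
    (h : B * (1 - C η * X) = M) (hM : AbsConv s M) :
    Tendsto (fun j => coeff j B * s ^ j) atTop (𝓝 (ev s M)) := by
  simp_rw [coeff_eq_sum_of_mul_one_sub hη h]
  exact hM.summable.hasSum.tendsto_sum_nat.comp (tendsto_add_atTop_nat 1)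

lemma tendsto_coeff_mul {A B : ℝ⟦X⟧} {s c : ℝ}
    (hB : Tendsto (fun j => coeff j B * s ^ j) atTop (𝓝 c)) (hA : AbsConv s A) :
    Tendsto (fun j => coeff j (B * A) * s ^ j) atTop (𝓝 (c * ev s A)) := by
  obtain ⟨M, hM⟩ := (Metric.isBounded_range_of_tendsto _ hB).exists_norm_le
  have key : Tendsto (fun j : ℕ => ∑' k, if k ≤ j then
      (coeff k A * s ^ k) * (coeff (j - k) B * s ^ (j - k)) else 0) atTop
      (𝓝 (∑' k, (coeff k A * s ^ k) * c)) := by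
    refine tendsto_tsum_of_dominated_convergence (bound := fun k => |coeff k A * s ^ k| * |M|)
      (Summable.mul_right _ hA) (fun k => ?_) (Eventually.of_forall fun j k => ?_)
    · refine ((hB.comp (tendsto_sub_atTop_nat k)).const_mul _).congr' ?_
      filter_upwards [eventually_ge_atTop k] with j hj
      rw [if_pos hj]; rfl
    · split_ifs with hk
      · rw [norm_mul, Real.norm_eq_abs]
        exact mul_le_mul_of_nonneg_left ((hM _ ⟨j - k, rfl⟩).trans (le_abs_self M)) (abs_nonneg _)
      · rw [norm_zero]; positivity
  rw [tsum_mul_right, mul_comm] at key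
  refine key.congr fun j => ?_
  rw [tsum_eq_sum (s := Finset.range (j + 1)) fun k hk => if_neg (by
    have := Finset.mem_range.not.mp hk; omega), mul_comm B A, coeff_mul_pow_mul,
    Finset.Nat.sum_antidiagonal_eq_sum_range_succ_mk]
  exact Finset.sum_congr rfl fun k hk => if_pos (Nat.lt_succ_iff.mp (Finset.mem_range.mp hk))

/-- A null sequence with increments `nⱼ ∼ c j ^ (-3/2)` is asymptotic to `-2 c j ^ (-1/2)`. -/
lemma tendsto_mul_sqrt_of_sub {z n : ℕ → ℝ} {c : ℝ} (hz : Tendsto z atTop (𝓝 0))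
    (hn : ∀ j, z (j + 1) - z j = n (j + 1))
    (h : Tendsto (fun j : ℕ => n j * (j * √j)) atTop (𝓝 c)) :
    Tendsto (fun j : ℕ => z j * √j) atTop (𝓝 (-2 * c)) := by
  -- Comparison with the telescoping sequence `f j = 2 / √(j + 1)`.
  set f : ℕ → ℝ := fun j => 2 / √((j : ℝ) + 1) with hf
  have hsq : Tendsto (fun j : ℕ => √((j : ℝ) + 1)) atTop atTop :=
    Real.tendsto_sqrt_atTop.comp (tendsto_atTop_add_const_right _ _ tendsto_natCast_atTop_atTop)
  have hf0 : Tendsto f atTop (𝓝 0) := tendsto_const_nhds.div_atTop hsq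
  have hratio : Tendsto (fun j : ℕ => √(j : ℝ) / √((j : ℝ) + 1)) atTop (𝓝 1) := by
    have h1 := (Real.continuous_sqrt.tendsto 1).comp (tendsto_natCast_div_add_atTop (1 : ℝ))
    rw [Real.sqrt_one] at h1
    refine h1.congr fun j => ?_
    rw [Function.comp, Real.sqrt_div (by positivity)]
  have hff : ∀ j, f j - f (j + 1) =
      2 / (√((j : ℝ) + 1) * √((j : ℝ) + 2) * (√((j : ℝ) + 1) + √((j : ℝ) + 2))) := by
    intro j
    have h1 : √((j : ℝ) + 1) ^ 2 = j + 1 := Real.sq_sqrt (by positivity)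
    have h2 : √((j : ℝ) + 2) ^ 2 = j + 2 := Real.sq_sqrt (by positivity)
    have h3 : 0 < √((j : ℝ) + 1) := by positivity
    have h4 : 0 < √((j : ℝ) + 2) := by positivity
    simp only [hf, Nat.cast_add_one, add_assoc, one_add_one_eq_two]
    rw [div_sub_div _ _ h3.ne' h4.ne', div_eq_div_iff (by positivity) (by positivity)]
    linear_combination (2 * √((j : ℝ) + 1) * √((j : ℝ) + 2)) * (h2 - h1)
  have hfpos : ∀ j, 0 < f j - f (j + 1) := fun j => by rw [hff]; positivity
  have hq : Tendsto (fun j : ℕ => (f j - f (j + 1)) * (((j + 1 : ℕ) : ℝ) * √((j + 1 : ℕ) : ℝ))) atTop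
      (𝓝 1) := by
    have h1 := (hratio.comp (tendsto_add_atTop_nat 1))
    have h2 := (h1.mul (((h1.const_mul 2)).div (h1.add_const 1) (by norm_num)))
    norm_num at h2
    refine h2.congr fun j => ?_
    have h1 : √((j : ℝ) + 1) ^ 2 = j + 1 := Real.sq_sqrt (by positivity)
    have h3 : 0 < √((j : ℝ) + 1) := by positivity
    have h4 : 0 < √((j : ℝ) + 2) := by positivity
    rw [hff]
    simp only [Nat.cast_add_one, add_assoc, one_add_one_eq_two]
    rw [← h1]
    simp only [Real.sqrt_sq h3.le]
    field_simp
  have hlim : Tendsto (fun j => n (j + 1) / (f j - f (j + 1))) atTop (𝓝 c) := by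
    have h1 := (h.comp (tendsto_add_atTop_nat 1)).div hq one_ne_zero
    rw [div_one] at h1
    refine h1.congr fun j => ?_
    have : 0 < ((j + 1 : ℕ) : ℝ) * √((j + 1 : ℕ) : ℝ) := by positivity
    exact mul_div_mul_right _ _ this.ne'
  have hmain : Tendsto (fun j => (z j + c * f j) * √(j : ℝ)) atTop (𝓝 0) := by
    rw [Metric.tendsto_atTop]
    intro ε hε
    obtain ⟨K, hK⟩ := (Metric.tendsto_atTop.mp hlim) (ε / 4) (by positivity)
    refine ⟨K, fun j hj => ?_⟩
    have hstep : ∀ m, |n (j + m + 1) - c * (f (j + m) - f (j + m + 1))| ≤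
        ε / 4 * (f (j + m) - f (j + m + 1)) := by
      intro m
      have h1 := (hK (j + m) (by omega)).le
      have h2 := hfpos (j + m)
      rw [Real.dist_eq] at h1
      have h3 : n (j + m + 1) - c * (f (j + m) - f (j + m + 1)) =
          (n (j + m + 1) / (f (j + m) - f (j + m + 1)) - c) * (f (j + m) - f (j + m + 1)) := by
        field_simp
      rw [h3, abs_mul, abs_of_pos h2]
      exact mul_le_mul_of_nonneg_right h1 h2.le
    have hshift : Tendsto (fun m : ℕ => j + m) atTop atTop :=
      tendsto_atTop_mono (fun m => Nat.le_add_left m j) tendsto_id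
    have hlow : 0 ≤ z j + (c + ε / 4) * f j := by
      have hanti : Antitone fun m => z (j + m) + (c + ε / 4) * f (j + m) :=
        antitone_nat_of_succ_le fun m => by
          have h1 := abs_le.mp (hstep m)
          have h2 := hn (j + m)
          rw [← add_assoc]
          linarith
      have hl : Tendsto (fun m => z (j + m) + (c + ε / 4) * f (j + m)) atTop (𝓝 0) := by
        simpa using (hz.comp hshift).add ((hf0.comp hshift).const_mul (c + ε / 4))
      exact hanti.le_of_tendsto hl 0
    have hup : z j + (c - ε / 4) * f j ≤ 0 := by
      have hmono : Monotone fun m => z (j + m) + (c - ε / 4) * f (j + m) :=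
        monotone_nat_of_le_succ fun m => by
          have h1 := abs_le.mp (hstep m)
          have h2 := hn (j + m)
          rw [← add_assoc]
          linarith
      have hl : Tendsto (fun m => z (j + m) + (c - ε / 4) * f (j + m)) atTop (𝓝 0) := by
        simpa using (hz.comp hshift).add ((hf0.comp hshift).const_mul (c - ε / 4))
      exact hmono.ge_of_tendsto hl 0
    have h1 : |z j + c * f j| ≤ ε / 4 * f j := abs_le.mpr ⟨by linarith, by linarith⟩
    have h2 : f j * √(j : ℝ) ≤ 2 := by
      rw [hf, div_mul_eq_mul_div, div_le_iff₀ (by positivity)]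
      have : √(j : ℝ) ≤ √((j : ℝ) + 1) := Real.sqrt_le_sqrt (by linarith)
      linarith
    rw [dist_zero_right, Real.norm_eq_abs, abs_mul, abs_of_nonneg (Real.sqrt_nonneg _)]
    calc |z j + c * f j| * √(j : ℝ) ≤ ε / 4 * f j * √(j : ℝ) := by gcongr
      _ = ε / 4 * (f j * √(j : ℝ)) := by ring
      _ ≤ ε / 4 * 2 := by gcongr
      _ < ε := by linarith
  have h2 := hmain.sub (hratio.const_mul (2 * c))
  simp only [mul_one, zero_sub] at h2
  rw [neg_mul]
  refine h2.congr fun j => ?_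
  simp only [hf]
  ring

/-- Division of a series with a square-root singularity at `R`, vanishing there, by `1 - X / R`. -/
lemma Tail.sqrtTail_of_mul_one_sub {B N : ℝ⟦X⟧} {η R c : ℝ} (hη : η * R = 1)
    (h : B * (1 - C η * X) = N) (hN : Tail R N c) (h0 : ev R N = 0) : SqrtTail R B (-2 * c) := by
  refine tendsto_mul_sqrt_of_sub (n := fun j => coeff j N * R ^ j) ?_ (fun j => ?_) hN
  · rw [← h0]
    exact tendsto_coeff_of_simple_pole hη h hN.absConv
  · rw [coeff_eq_sum_of_mul_one_sub hη h, coeff_eq_sum_of_mul_one_sub hη h,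
      Finset.sum_range_succ _ (j + 1), add_sub_cancel_left]

/-! ### The square root `√(1 - η X)` -/

/-- The generating function of the Catalan numbers with real coefficients. -/
noncomputable def catalanReal : ℝ⟦X⟧ := PowerSeries.map (Nat.castRingHom ℝ) catalanSeries

lemma catalanReal_eq : catalanReal ^ 2 * X + 1 = catalanReal := by
  have := congrArg (PowerSeries.map (Nat.castRingHom ℝ)) catalanSeries_sq_mul_X_add_one
  simpa [catalanReal] using this

/-- The power series of `√(1 - η y)`, written as `1 - 2 z C(z)` with `z = η y / 4` and the Catalan
generating function `C`. -/
noncomputable def sqrtSeries (η : ℝ) : ℝ⟦X⟧ := rescale (η / 4) (1 - C 2 * X * catalanReal)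

lemma sqrtSeries_mul_self (η : ℝ) : sqrtSeries η * sqrtSeries η = 1 - C η * X := by
  have h : (1 - C 2 * X * catalanReal) * (1 - C 2 * X * catalanReal) = 1 - C (4 : ℝ) * X := by
    rw [map_ofNat C 2, map_ofNat C 4]
    linear_combination 4 * X * catalanReal_eq
  rw [sqrtSeries, ← map_mul, h]
  ext n
  rw [coeff_rescale, map_sub, map_sub, coeff_C_mul, coeff_C_mul, coeff_one, coeff_X]
  split_ifs with h0 h1 h1
  · omega
  · subst h0; simp
  · subst h1; ring
  · simp

lemma coeff_zero_sqrtSeries (η : ℝ) : coeff 0 (sqrtSeries η) = 1 := by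
  simp [sqrtSeries]

lemma coeff_succ_sqrtSeries (η : ℝ) (n : ℕ) :
    coeff (n + 1) (sqrtSeries η) = -(2 * catalan n * (η / 4) ^ (n + 1)) := by
  rw [sqrtSeries, coeff_rescale, map_sub, show C (2:ℝ) * X * catalanReal = C 2 * (catalanReal * X) by ring,
    coeff_C_mul, coeff_succ_mul_X]
  simp [coeff_one, catalanReal]
  ring

lemma tendsto_centralBinom_mul_sqrt :
    Tendsto (fun n : ℕ => (n.centralBinom : ℝ) / 4 ^ n * √((n : ℝ) + 1)) atTop (𝓝 (1 / √Real.pi)) := by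
  have h1 : ∀ n : ℕ, ((n.centralBinom : ℝ) / 4 ^ n) ^ 2 * (2 * n + 1) = (Real.Wallis.W n)⁻¹ := by
    intro n
    have h2 : (n.centralBinom : ℝ) = (2 * n).factorial / (n.factorial * n.factorial) := by
      rw [Nat.centralBinom_eq_two_mul_choose, Nat.cast_choose ℝ (by omega : n ≤ 2 * n)]
      congr 4
      omega
    have h3 : ((2 * n).factorial : ℝ) ≠ 0 := by positivity
    have h4 : (n.factorial : ℝ) ≠ 0 := by positivity
    rw [Real.Wallis.W_eq_factorial_ratio, h2, pow_mul, show (2 : ℝ) ^ 4 = 4 ^ 2 by norm_num, ← pow_mul,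
      mul_comm 2 n, pow_mul]
    rw [mul_comm n 2] at *
    field_simp
  have h2 : Tendsto (fun n : ℕ => ((n : ℝ) + 1) / (2 * n + 1)) atTop (𝓝 (1 / 2)) := by
    have h3 : Tendsto (fun n : ℕ => 1 / 2 + 1 / 4 * (1 / ((n : ℝ) + 1 / 2))) atTop (𝓝 (1 / 2)) := by
      have h4 : Tendsto (fun n : ℕ => 1 / ((n : ℝ) + 1 / 2)) atTop (𝓝 0) :=
        tendsto_const_nhds.div_atTop
          (tendsto_atTop_add_const_right _ _ tendsto_natCast_atTop_atTop)
      have h5 := (h4.const_mul (1 / 4)).const_add (1 / 2)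
      rwa [mul_zero, add_zero] at h5
    refine h3.congr fun n => ?_
    field_simp
    ring
  have h3 := (Real.Wallis.tendsto_W_nhds_pi_div_two.inv₀ (by positivity)).mul h2
  have h4 := (Real.continuous_sqrt.tendsto _).comp h3
  rw [show √((Real.pi / 2)⁻¹ * (1 / 2)) = 1 / √Real.pi by
    rw [one_div (√Real.pi), ← Real.sqrt_inv]; congr 1; field_simp] at h4
  refine h4.congr fun n => ?_
  rw [Function.comp, ← h1, show ((n.centralBinom : ℝ) / 4 ^ n) ^ 2 * (2 * n + 1) * (((n : ℝ) + 1) / (2 * n + 1)) =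
    ((n.centralBinom : ℝ) / 4 ^ n) ^ 2 * ((n : ℝ) + 1) by field_simp, Real.sqrt_mul (by positivity),
    Real.sqrt_sq (by positivity)]

/-- The Catalan asymptotics give the tail of `√(1 - y / R)`. -/
lemma tail_sqrtSeries {η R : ℝ} (h : η * R = 1) :
    Tail R (sqrtSeries η) (-(1 / (2 * √Real.pi))) := by
  refine (tendsto_add_atTop_iff_nat 1).mp ?_
  have h1 := tendsto_centralBinom_mul_sqrt.const_mul (-(1 / 2))
  rw [show -(1 / 2) * (1 / √Real.pi) = -(1 / (2 * √Real.pi)) by ring] at h1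
  refine h1.congr fun n => ?_
  have h2 : (n.centralBinom : ℝ) = (n + 1) * catalan n := by
    exact_mod_cast (succ_mul_catalan_eq_centralBinom n).symm
  have h3 : (η / 4) ^ (n + 1) * R ^ (n + 1) = 1 / (4 * 4 ^ n) := by
    rw [← mul_pow, show η / 4 * R = 1 / 4 by linear_combination h / 4, div_pow, one_pow, pow_succ']
  rw [coeff_succ_sqrtSeries, h2, show -(2 * (catalan n : ℝ) * (η / 4) ^ (n + 1)) * R ^ (n + 1) =
    -(2 * catalan n) * ((η / 4) ^ (n + 1) * R ^ (n + 1)) by ring, h3]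
  push_cast
  field_simp
  ring

lemma ev_sqrtSeries_eq_zero {η R : ℝ} (h : η * R = 1) : ev R (sqrtSeries η) = 0 := by
  have hs := (tail_sqrtSeries h).absConv
  have h1 := congrArg (ev R) (sqrtSeries_mul_self η)
  rw [ev_mul hs hs, ev_sub (absConv_one R) ((absConv_C R η).mul (absConv_X R)), ev_one,
    ev_mul (absConv_C R η) (absConv_X R), ev_C, ev_X, h, sub_self] at h1
  exact mul_self_eq_zero.mp h1

/-- The tail of a series vanishes to leading order strictly inside its disc of convergence. -/
lemma Tail.of_lt {R R' : ℝ} {A : ℝ⟦X⟧} {c : ℝ} (h : Tail R A c) (h0 : 0 ≤ R') (hR : R' < R) :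
    Tail R' A 0 := by
  have hR0 : 0 < R := h0.trans_lt hR
  have h1 := Tendsto.mul h (tendsto_pow_atTop_nhds_zero_of_lt_one (div_nonneg h0 hR0.le)
    ((div_lt_one hR0).mpr hR))
  rw [mul_zero] at h1
  refine h1.congr fun j => ?_
  rw [div_pow]
  field_simp

lemma ev_sqrtSeries {η R R' : ℝ} (h : η * R = 1) (h0 : 0 ≤ R') (hR : R' < R) :
    ev R' (sqrtSeries η) = √(1 - η * R') := by
  have hη : 0 < η := by
    have := h0.trans_lt hR
    by_contra! h2
    nlinarith
  have hs := (tail_sqrtSeries h).absConv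
  have hs' := hs.mono h0 hR.le
  have h1 := congrArg (ev R') (sqrtSeries_mul_self η)
  rw [ev_mul hs' hs', ev_sub (absConv_one R') ((absConv_C R' η).mul (absConv_X R')), ev_one,
    ev_mul (absConv_C R' η) (absConv_X R'), ev_C, ev_X] at h1
  have h2 : ∀ j, 0 ≤ coeff j (1 - sqrtSeries η) := by
    intro j
    rcases j with _ | n
    · rw [map_sub, coeff_zero_sqrtSeries]; simp
    · rw [map_sub, coeff_succ_sqrtSeries, coeff_one, if_neg (by omega)]
      have : 0 ≤ 2 * (catalan n : ℝ) * (η / 4) ^ (n + 1) := by positivity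
      linarith
  have h3 := ev_mono ((absConv_one R).sub hs) h2 h0 hR.le
  rw [ev_sub (absConv_one R') hs', ev_sub (absConv_one R) hs, ev_one, ev_one,
    ev_sqrtSeries_eq_zero h] at h3
  rw [← h1, Real.sqrt_mul_self (by linarith)]

/-! ### The balance equations -/

lemma IsStationary.eq_sum {p q muH muL : ℝ} {π : ℕ → ℕ → ℝ} (hπ : IsStationary p q muH muL π)
    (t : ℕ × ℕ) (S : Finset (ℕ × ℕ)) (hS : ∀ s, s ∉ S → transProb p q muH muL s t = 0) :
    π t.1 t.2 = ∑ s ∈ S, π s.1 s.2 * transProb p q muH muL s t :=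
  (hπ.balance t).unique (hasSum_sum_of_ne_finset_zero fun s hs => by rw [hS s hs, mul_zero])

lemma transProb_eq_zero {p q muH muL : ℝ} {s t : ℕ × ℕ}
    (h : ∀ aH aL dH dL, nextState s aH aL dH dL ≠ t) : transProb p q muH muL s t = 0 := by
  simp only [transProb, h, if_false, Finset.sum_const_zero]

lemma nextState_bounds (s : ℕ × ℕ) (aH aL dH dL : Bool) :
    s.1 ≤ (nextState s aH aL dH dL).1 + 1 ∧ (nextState s aH aL dH dL).1 ≤ s.1 + 1 ∧
    s.2 ≤ (nextState s aH aL dH dL).2 + 1 ∧ (nextState s aH aL dH dL).2 ≤ s.2 + 1 := by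
  have h1 := Bool.toNat_le aH
  have h2 := Bool.toNat_le aL
  have h3 := Bool.toNat_le dH
  have h4 := Bool.toNat_le dL
  unfold nextState
  split_ifs <;> simp only <;> omega

lemma balance_succ_zero {p q muH muL : ℝ} {π : ℕ → ℕ → ℝ} (hπ : IsStationary p q muH muL π)
    (k : ℕ) : π (k + 1) 0 = (1 - q) * (p * (1 - muH) * π k 0 +
      (p * muH + (1 - p) * (1 - muH)) * π (k + 1) 0 + (1 - p) * muH * π (k + 2) 0) := by
  have h := hπ.eq_sum (k + 1, 0) ({k, k + 1, k + 2} ×ˢ {0, 1}) fun s hs => transProb_eq_zero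
    fun aH aL dH dL he => hs (by
      have := nextState_bounds s aH aL dH dL
      rw [he] at this
      simp only [Finset.mem_product, Finset.mem_insert, Finset.mem_singleton]
      simp only at this
      omega)
  rw [Finset.sum_product, Finset.sum_insert (by simp), Finset.sum_insert (by simp),
    Finset.sum_singleton] at h
  simp only [transProb, nextState, bern, Fintype.sum_bool, Finset.sum_pair (zero_ne_one)] at h
  rcases k with _ | k <;> simp [add_assoc] at h <;> simp [add_assoc] <;> linear_combination h

lemma balance_succ_succ {p q muH muL : ℝ} {π : ℕ → ℕ → ℝ} (hπ : IsStationary p q muH muL π)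
    (k n : ℕ) : π (k + 1) (n + 1) = (1 - q) * (p * (1 - muH) * π k (n + 1) +
      (p * muH + (1 - p) * (1 - muH)) * π (k + 1) (n + 1) + (1 - p) * muH * π (k + 2) (n + 1)) +
      q * (p * (1 - muH) * π k n +
      (p * muH + (1 - p) * (1 - muH)) * π (k + 1) n + (1 - p) * muH * π (k + 2) n) := by
  have h := hπ.eq_sum (k + 1, n + 1) ({k, k + 1, k + 2} ×ˢ {n, n + 1, n + 2}) fun s hs =>
    transProb_eq_zero fun aH aL dH dL he => hs (by
      have := nextState_bounds s aH aL dH dL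
      rw [he] at this
      simp only [Finset.mem_product, Finset.mem_insert, Finset.mem_singleton]
      simp only at this
      omega)
  simp only [Finset.sum_product, Finset.sum_insert (show k ∉ ({k + 1, k + 2} : Finset ℕ) by simp),
    Finset.sum_insert (show k + 1 ∉ ({k + 2} : Finset ℕ) by simp), Finset.sum_insert (show n ∉ ({n + 1, n + 2} : Finset ℕ) by simp),
    Finset.sum_insert (show n + 1 ∉ ({n + 2} : Finset ℕ) by simp), Finset.sum_singleton] at h
  simp only [transProb, nextState, bern, Fintype.sum_bool] at h
  rcases k with _ | k <;> simp [add_assoc] at h <;> simp [add_assoc] <;> linear_combination h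

lemma balance_zero_zero {p q muH muL : ℝ} {π : ℕ → ℕ → ℝ} (hπ : IsStationary p q muH muL π) :
    π 0 0 = (1 - q) * (p * muH * π 0 0 + (1 - p) * muH * π 1 0 + (1 - p) * (1 - muL) * π 0 0) +
      (1 - p) * muL * ((1 - q) * π 0 1 + q * π 0 0) + (1 - p) * muL * (1 - q) * π 0 0 := by
  have h := hπ.eq_sum (0, 0) ({0, 1} ×ˢ {0, 1}) fun s hs =>
    transProb_eq_zero fun aH aL dH dL he => hs (by
      have := nextState_bounds s aH aL dH dL
      rw [he] at this
      simp only [Finset.mem_product, Finset.mem_insert, Finset.mem_singleton]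
      simp only at this
      omega)
  rw [Finset.sum_product, Finset.sum_pair zero_ne_one, Finset.sum_pair zero_ne_one,
    Finset.sum_pair zero_ne_one] at h
  simp only [transProb, nextState, bern, Fintype.sum_bool] at h
  simp at h
  linear_combination h

lemma balance_zero_succ {p q muH muL : ℝ} {π : ℕ → ℕ → ℝ} (hπ : IsStationary p q muH muL π)
    (n : ℕ) : π 0 (n + 1) =
      (1 - q) * (p * muH * π 0 (n + 1) + (1 - p) * muH * π 1 (n + 1) +
        (1 - p) * (1 - muL) * π 0 (n + 1)) +
      q * (p * muH * π 0 n + (1 - p) * muH * π 1 n + (1 - p) * (1 - muL) * π 0 n) +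
      (1 - p) * muL * ((1 - q) * π 0 (n + 2) + q * π 0 (n + 1)) := by
  have h := hπ.eq_sum (0, n + 1) ({0, 1} ×ˢ {n, n + 1, n + 2}) fun s hs =>
    transProb_eq_zero fun aH aL dH dL he => hs (by
      have := nextState_bounds s aH aL dH dL
      rw [he] at this
      simp only [Finset.mem_product, Finset.mem_insert, Finset.mem_singleton]
      simp only at this
      omega)
  rw [Finset.sum_product, Finset.sum_pair zero_ne_one,
    Finset.sum_insert (by simp), Finset.sum_insert (by simp),
    Finset.sum_singleton, Finset.sum_insert (by simp), Finset.sum_insert (by simp),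
    Finset.sum_singleton] at h
  simp only [transProb, nextState, bern, Fintype.sum_bool] at h
  rcases n with _ | n <;> simp [add_assoc] at h <;> simp [add_assoc] <;> linear_combination h

/-! ### Generating functions -/

/-- The generating function `∑ⱼ π i j yʲ`. -/
noncomputable def genFun (π : ℕ → ℕ → ℝ) (i : ℕ) : ℝ⟦X⟧ := PowerSeries.mk (π i)

/-- The generating function `q y + 1 - q` of the low-priority arrivals in a slot. -/
noncomputable def arrSer (q : ℝ) : ℝ⟦X⟧ := C q * X + C (1 - q)

lemma coeff_add (n : ℕ) (A B : ℝ⟦X⟧) : coeff n (A + B) = coeff n A + coeff n B := map_add _ _ _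

lemma coeff_zero_arrSer_mul (q : ℝ) (A : ℝ⟦X⟧) : coeff 0 (arrSer q * A) = (1 - q) * coeff 0 A := by
  simp [arrSer]

lemma coeff_succ_arrSer_mul (q : ℝ) (A : ℝ⟦X⟧) (n : ℕ) :
    coeff (n + 1) (arrSer q * A) = q * coeff n A + (1 - q) * coeff (n + 1) A := by
  rw [arrSer, add_mul, map_add, coeff_C_mul, mul_assoc, coeff_C_mul, coeff_succ_X_mul]

lemma genFun_balance {p q muH muL : ℝ} {π : ℕ → ℕ → ℝ} (hπ : IsStationary p q muH muL π) (k : ℕ) :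
    genFun π (k + 1) = arrSer q * (C (p * (1 - muH)) * genFun π k +
      C (p * muH + (1 - p) * (1 - muH)) * genFun π (k + 1) + C ((1 - p) * muH) * genFun π (k + 2)) := by
  ext n
  rcases n with _ | n
  · rw [coeff_zero_arrSer_mul]
    simpa only [coeff_add, coeff_C_mul, genFun, coeff_mk] using balance_succ_zero hπ k
  · rw [coeff_succ_arrSer_mul, add_comm (q * _)]
    simpa only [coeff_add, coeff_C_mul, genFun, coeff_mk] using balance_succ_succ hπ k n

lemma genFun_balance_zero {p q muH muL : ℝ} {π : ℕ → ℕ → ℝ} (hπ : IsStationary p q muH muL π) :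
    X * genFun π 0 = arrSer q * (X * (C (p * muH + (1 - p) * (1 - muL)) * genFun π 0 +
      C ((1 - p) * muH) * genFun π 1) + C ((1 - p) * muL) * genFun π 0) +
      C ((1 - p) * muL * (1 - q) * π 0 0) * (X - 1) := by
  ext n
  rcases n with _ | n
  · rw [coeff_zero_X_mul, map_add, coeff_zero_arrSer_mul, map_add, coeff_zero_X_mul]
    simp [genFun]
    ring
  rw [coeff_succ_X_mul, coeff_add, coeff_succ_arrSer_mul, coeff_C_mul, map_sub, coeff_one,
    if_neg (by omega), coeff_X, coeff_add, coeff_add, coeff_succ_X_mul, coeff_C_mul, coeff_C_mul]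
  rcases n with _ | n
  · rw [coeff_zero_X_mul]
    simp only [coeff_add, coeff_C_mul, genFun, coeff_mk, zero_add, if_true]
    linear_combination balance_zero_zero hπ
  · rw [coeff_succ_X_mul]
    simp only [coeff_add, coeff_C_mul, genFun, coeff_mk]
    rw [if_neg (by omega)]
    linear_combination balance_zero_succ hπ n

/-! ### Parameters and branch points -/

/-- The standing assumptions on the parameters of the queue. -/
structure Params (p q muH muL : ℝ) : Prop where
  hp : 0 < p
  hq : 0 < q
  hmuH : 0 < muH
  hmuL : 0 < muL
  hsum : p + q + muH + muL = 1
  hle : muL ≤ muH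
  hrho : rho p q muH muL < 1

/-- Probability of no change in the number of high-priority customers. -/
def stay (p muH : ℝ) : ℝ := p * muH + (1 - p) * (1 - muH)

/-- The geometric mean of the up and down probabilities `p (1 - muH)` and `(1 - p) muH`. -/
noncomputable def gmean (p muH : ℝ) : ℝ := √(p * muH * (1 - p) * (1 - muH))

section

variable {p q muH muL : ℝ} (h : Params p q muH muL)
include h

lemma Params.p_lt_one : 0 < 1 - p := by linarith [h.hq, h.hmuH, h.hmuL, h.hsum]
lemma Params.muH_lt_one : 0 < 1 - muH := by linarith [h.hq, h.hp, h.hmuL, h.hsum]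
lemma Params.muL_lt_one : 0 < 1 - muL := by linarith [h.hq, h.hp, h.hmuH, h.hsum]
lemma Params.q_lt_one : 0 < 1 - q := by linarith [h.hmuH, h.hp, h.hmuL, h.hsum]

lemma Params.p_lt_muH : p < muH := by
  have h1 := h.hrho
  have h2 : 0 < q / muL := div_pos h.hq h.hmuL
  rw [rho] at h1
  rw [← div_lt_one h.hmuH]
  linarith

lemma Params.gmean_pos : 0 < gmean p muH :=
  Real.sqrt_pos.mpr (mul_pos (mul_pos (mul_pos h.hp h.hmuH) h.p_lt_one) h.muH_lt_one)

lemma Params.gmean_sq : gmean p muH ^ 2 = p * muH * (1 - p) * (1 - muH) :=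
  Real.sq_sqrt (mul_pos (mul_pos (mul_pos h.hp h.hmuH) h.p_lt_one) h.muH_lt_one).le

lemma Params.stay_pos : 0 < stay p muH :=
  add_pos (mul_pos h.hp h.hmuH) (mul_pos h.p_lt_one h.muH_lt_one)

lemma Params.kappa_pos : 0 < 1 - p - muH := by linarith [h.hq, h.hmuL, h.hsum]

lemma Params.stay_mul : (stay p muH - 2 * gmean p muH) * (stay p muH + 2 * gmean p muH) =
    (1 - p - muH) ^ 2 := by
  rw [stay]
  linear_combination -4 * h.gmean_sq

lemma Params.stay_add_pos : 0 < stay p muH + 2 * gmean p muH := by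
  linarith [h.stay_pos, h.gmean_pos]

lemma Params.stay_sub_pos : 0 < stay p muH - 2 * gmean p muH := by
  have h1 := h.stay_mul
  have h2 := pow_pos h.kappa_pos 2
  have h3 := h.stay_add_pos
  by_contra! h4
  nlinarith

lemma Params.stay_add_lt_one : stay p muH + 2 * gmean p muH < 1 := by
  have h1 : 2 * gmean p muH < 1 - stay p muH := by
    refine lt_of_pow_lt_pow_left₀ 2 ?_ ?_
    · rw [stay]
      have := mul_pos h.hp h.muH_lt_one
      have := mul_pos h.p_lt_one h.hmuH
      linarith
    · have h2 : 0 < (muH - p) ^ 2 := pow_pos (sub_pos.mpr h.p_lt_muH) 2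
      rw [mul_pow, h.gmean_sq, stay]
      nlinarith
  linarith

lemma Params.arr_yZero : (q * yZero p q muH + (1 - q)) * (stay p muH + 2 * gmean p muH) = 1 := by
  have h1 := h.stay_mul
  have h2 := h.kappa_pos
  have h3 : (p * muH - (1 - p) * (1 - muH)) ^ 2 = (1 - p - muH) ^ 2 := by ring
  have hq := h.hq
  rw [yZero, h3, ← gmean, ← stay]
  field_simp
  linear_combination h1

lemma Params.arr_yOne : (q * yOne p q muH + (1 - q)) * (stay p muH - 2 * gmean p muH) = 1 := by
  have h1 := h.stay_mul
  have h2 := h.kappa_pos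
  have h3 : (p * muH - (1 - p) * (1 - muH)) ^ 2 = (1 - p - muH) ^ 2 := by ring
  have hq := h.hq
  rw [yOne, h3, ← gmean, ← stay]
  field_simp
  linear_combination h1

lemma Params.one_lt_yZero : 1 < yZero p q muH := by
  have h1 := h.arr_yZero
  have h2 := h.stay_add_lt_one
  have h3 := h.stay_add_pos
  have h4 := h.hq
  by_contra! h5
  nlinarith [mul_nonneg h4.le (sub_nonneg.mpr h5)]

lemma Params.yZero_pos : 0 < yZero p q muH := by linarith [h.one_lt_yZero]

lemma Params.arr_yZero_pos : 0 < q * yZero p q muH + (1 - q) :=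
  add_pos (mul_pos h.hq h.yZero_pos) h.q_lt_one

lemma Params.yZero_lt_yOne : yZero p q muH < yOne p q muH := by
  have h1 := h.arr_yZero
  have h2 := h.arr_yOne
  have h3 := h.stay_sub_pos
  have h4 := h.gmean_pos
  have h5 := h.hq
  have h6 := h.arr_yZero_pos
  by_contra! h7
  have : q * yOne p q muH + (1 - q) ≤ q * yZero p q muH + (1 - q) := by nlinarith
  nlinarith

lemma Params.yOne_pos : 0 < yOne p q muH := h.yZero_pos.trans h.yZero_lt_yOne

lemma Params.yZero_add : q * (yZero p q muH + yOne p q muH) * (1 - p - muH) ^ 2 =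
    2 * stay p muH - 2 * (1 - q) * (1 - p - muH) ^ 2 := by
  have h3 := h.stay_mul
  rw [← h3]
  linear_combination (stay p muH - 2 * gmean p muH) * h.arr_yZero +
    (stay p muH + 2 * gmean p muH) * h.arr_yOne

lemma Params.yZero_mul : q ^ 2 * (yZero p q muH * yOne p q muH) * (1 - p - muH) ^ 2 =
    (1 - stay p muH * (1 - q)) ^ 2 - 4 * gmean p muH ^ 2 * (1 - q) ^ 2 := by
  have h1 := h.arr_yZero
  have h2 := h.arr_yOne
  have h3 := h.stay_mul
  have h4 : q * yZero p q muH * (stay p muH + 2 * gmean p muH) =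
    1 - (1 - q) * (stay p muH + 2 * gmean p muH) := by linear_combination h1
  have h5 : q * yOne p q muH * (stay p muH - 2 * gmean p muH) =
    1 - (1 - q) * (stay p muH - 2 * gmean p muH) := by linear_combination h2
  rw [← h3]
  linear_combination (q * yOne p q muH * (stay p muH - 2 * gmean p muH)) * h4 +
    (1 - (1 - q) * (stay p muH + 2 * gmean p muH)) * h5

end

/-! ### The branch of the kernel equation as a power series -/

/-- The power series of `√Δ(y)`. -/
noncomputable def discSeries (p q muH : ℝ) : ℝ⟦X⟧ :=
  C (q * (1 - p - muH) * √(yZero p q muH * yOne p q muH)) *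
    (sqrtSeries (yZero p q muH)⁻¹ * sqrtSeries (yOne p q muH)⁻¹)

/-- The constant `d` for which the coefficients of `√Δ` are asymptotic to `-d j ^ (-3/2) y₀⁻ʲ`. -/
noncomputable def discTail (p q muH : ℝ) : ℝ :=
  q * (1 - p - muH) * √(yZero p q muH * (yOne p q muH - yZero p q muH)) / (2 * √Real.pi)

section

variable {p q muH muL : ℝ} (h : Params p q muH muL)
include h

lemma Params.discTail_pos : 0 < discTail p q muH := by
  have h1 := Real.sqrt_pos.mpr (mul_pos h.yZero_pos (sub_pos.mpr h.yZero_lt_yOne))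
  exact div_pos (mul_pos (mul_pos h.hq h.kappa_pos) h1) (by positivity)

lemma Params.tail_discSeries :
    Tail (yZero p q muH) (discSeries p q muH) (-discTail p q muH) := by
  have h0 := h.yZero_pos
  have h1 := h.yOne_pos
  have e0 : (yZero p q muH)⁻¹ * yZero p q muH = 1 := inv_mul_cancel₀ h0.ne'
  have e1 : (yOne p q muH)⁻¹ * yOne p q muH = 1 := inv_mul_cancel₀ h1.ne'
  have h2 := ((tail_sqrtSeries e0).mul
    ((tail_sqrtSeries e1).of_lt h0.le h.yZero_lt_yOne)).C_mul
      (q * (1 - p - muH) * √(yZero p q muH * yOne p q muH))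
  rw [ev_sqrtSeries e1 h0.le h.yZero_lt_yOne] at h2
  have h3 : √(yZero p q muH * (yOne p q muH - yZero p q muH)) =
      √(yZero p q muH * yOne p q muH) * √(1 - (yOne p q muH)⁻¹ * yZero p q muH) := by
    rw [← Real.sqrt_mul (mul_pos h0 h1).le]
    congr 1
    field_simp
  have h4 : -discTail p q muH = q * (1 - p - muH) * √(yZero p q muH * yOne p q muH) *
      (-(1 / (2 * √Real.pi)) * √(1 - (yOne p q muH)⁻¹ * yZero p q muH) +
        0 * ev (yZero p q muH) (sqrtSeries (yZero p q muH)⁻¹)) := by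
    unfold discTail
    rw [h3]
    ring
  rw [h4]
  exact h2

lemma Params.ev_discSeries : ev (yZero p q muH) (discSeries p q muH) = 0 := by
  have h0 := h.yZero_pos
  have e0 : (yZero p q muH)⁻¹ * yZero p q muH = 1 := inv_mul_cancel₀ h0.ne'
  have e1 : (yOne p q muH)⁻¹ * yOne p q muH = 1 := inv_mul_cancel₀ h.yOne_pos.ne'
  have a0 := (tail_sqrtSeries e0).absConv
  have a1 := (tail_sqrtSeries e1).absConv.mono h0.le h.yZero_lt_yOne.le
  rw [discSeries, ev_mul (absConv_C _ _) (a0.mul a1), ev_mul a0 a1, ev_sqrtSeries_eq_zero e0]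
  ring

lemma Params.discSeries_mul_self : discSeries p q muH * discSeries p q muH =
    (C (stay p muH) * arrSer q - 1) ^ 2 - C (4 * gmean p muH ^ 2) * arrSer q ^ 2 := by
  have h0 := h.yZero_pos
  have h1 := h.yOne_pos
  have e : discSeries p q muH * discSeries p q muH =
      C ((q * (1 - p - muH)) ^ 2 * (yZero p q muH * yOne p q muH)) *
      ((1 - C (yZero p q muH)⁻¹ * X) * (1 - C (yOne p q muH)⁻¹ * X)) := by
    rw [← sqrtSeries_mul_self, ← sqrtSeries_mul_self, discSeries]
    have h2 : (q * (1 - p - muH)) ^ 2 * (yZero p q muH * yOne p q muH) =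
        (q * (1 - p - muH) * √(yZero p q muH * yOne p q muH)) *
        (q * (1 - p - muH) * √(yZero p q muH * yOne p q muH)) := by
      linear_combination (-(q * (1 - p - muH)) ^ 2) * Real.mul_self_sqrt (mul_pos h0 h1).le
    rw [h2, map_mul C (q * (1 - p - muH) * √(yZero p q muH * yOne p q muH))]
    ring
  have h2 := h.yZero_add
  have h3 := h.yZero_mul
  have e2 : C ((q * (1 - p - muH)) ^ 2 * (yZero p q muH * yOne p q muH)) *
      ((1 - C (yZero p q muH)⁻¹ * X) * (1 - C (yOne p q muH)⁻¹ * X)) =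
      C ((q * (1 - p - muH)) ^ 2 * (yZero p q muH * yOne p q muH)) -
      C ((q * (1 - p - muH)) ^ 2 * (yZero p q muH + yOne p q muH)) * X +
      C ((q * (1 - p - muH)) ^ 2) * X ^ 2 := by
    have i0 : C (yZero p q muH) * C (yZero p q muH)⁻¹ = (1 : ℝ⟦X⟧) := by
      rw [← map_mul, mul_inv_cancel₀ h0.ne', map_one]
    have i1 : C (yOne p q muH) * C (yOne p q muH)⁻¹ = (1 : ℝ⟦X⟧) := by
      rw [← map_mul, mul_inv_cancel₀ h1.ne', map_one]
    rw [map_mul, map_mul, map_mul, map_add]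
    generalize C ((q * (1 - p - muH)) ^ 2) = K
    linear_combination (-K * C (yOne p q muH) * X + K * X ^ 2 * C (yOne p q muH) * C (yOne p q muH)⁻¹) * i0 +
      (-K * C (yZero p q muH) * X + K * X ^ 2) * i1
  have c0 : (q * (1 - p - muH)) ^ 2 * (yZero p q muH * yOne p q muH) =
      (stay p muH * (1 - q) - 1) ^ 2 - 4 * gmean p muH ^ 2 * (1 - q) ^ 2 := by
    linear_combination h3
  have c2 : (q * (1 - p - muH)) ^ 2 = q ^ 2 * (stay p muH ^ 2 - 4 * gmean p muH ^ 2) := by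
    linear_combination -q ^ 2 * h.stay_mul
  have c1 : (q * (1 - p - muH)) ^ 2 * (yZero p q muH + yOne p q muH) =
      q * (2 * stay p muH - 2 * (1 - q) * (stay p muH ^ 2 - 4 * gmean p muH ^ 2)) := by
    linear_combination q * h2 + 2 * q * (1 - q) * h.stay_mul
  rw [e, e2, c0, c1, c2, arrSer]
  simp only [map_mul, map_pow, map_sub, map_one, map_ofNat]
  ring

lemma Params.coeff_zero_discSeries : 0 < coeff 0 (discSeries p q muH) := by
  have e : coeff 0 (discSeries p q muH) =
      q * (1 - p - muH) * √(yZero p q muH * yOne p q muH) := by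
    rw [discSeries, coeff_C_mul, coeff_mul]
    simp only [Finset.Nat.antidiagonal_zero, Finset.sum_singleton, coeff_zero_sqrtSeries, mul_one]
  rw [e]
  exact mul_pos (mul_pos h.hq h.kappa_pos) (Real.sqrt_pos.mpr (mul_pos h.yZero_pos h.yOne_pos))

end

/-- A power series solution of a quadratic fixed point equation with nonnegative data has
nonnegative coefficients if its constant term is nonnegative and below the double root. -/
lemma coeff_nonneg_of_quadratic {v A T : ℝ⟦X⟧} {s : ℝ} (hA : ∀ j, 0 ≤ coeff j A)
    (hT : ∀ j, 0 ≤ coeff j T) (hs : 0 ≤ s) (hv0 : 0 ≤ coeff 0 v)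
    (hlt : coeff 0 T + 2 * s * coeff 0 v < 1) (h : v = A + T * v + C s * (v * v)) (j : ℕ) :
    0 ≤ coeff j v := by
  induction j using Nat.strong_induction_on with
  | _ j ih =>
    rcases j with _ | j
    · exact hv0
    have h1 : coeff (j + 1) v = coeff (j + 1) A + coeff (j + 1) (T * v) + s * coeff (j + 1) (v * v) := by
      conv_lhs => rw [h]
      rw [map_add, map_add, coeff_C_mul]
    have hexp : ∀ E : ℝ⟦X⟧, coeff (j + 1) (E * v) =
        ∑ k ∈ Finset.range j, coeff (k + 1) E * coeff (j + 1 - (k + 1)) v +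
        coeff (j + 1) E * coeff 0 v + coeff 0 E * coeff (j + 1) v := fun E => by
      rw [coeff_mul, Finset.Nat.sum_antidiagonal_eq_sum_range_succ_mk, Finset.sum_range_succ',
        Finset.sum_range_succ, Nat.sub_zero, Nat.sub_self]
    rw [hexp, hexp] at h1
    have h2 : 0 ≤ ∑ k ∈ Finset.range j, coeff (k + 1) T * coeff (j + 1 - (k + 1)) v :=
      Finset.sum_nonneg fun k hk => mul_nonneg (hT _)
        (ih _ (by have := Finset.mem_range.mp hk; omega))
    have h3 : 0 ≤ ∑ k ∈ Finset.range j, coeff (k + 1) v * coeff (j + 1 - (k + 1)) v :=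
      Finset.sum_nonneg fun k hk => mul_nonneg (ih _ (by have := Finset.mem_range.mp hk; omega))
        (ih _ (by have := Finset.mem_range.mp hk; omega))
    have h4 := hA (j + 1)
    have h5 := mul_nonneg (hT (j + 1)) hv0
    have h6 := mul_nonneg hs h3
    have h7 : coeff (j + 1) v * (1 - (coeff 0 T + 2 * s * coeff 0 v)) ≥ 0 := by nlinarith
    exact nonneg_of_mul_nonneg_left h7 (by linarith)

lemma exists_eq_one_add_mul {A : ℝ⟦X⟧} (hA : coeff 0 A ≠ 1) : ∃ B : ℝ⟦X⟧, B = 1 + A * B := by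
  refine ⟨(1 - A)⁻¹, ?_⟩
  have h1 : constantCoeff (1 - A) ≠ 0 := by
    rw [map_sub, map_one, ← coeff_zero_eq_constantCoeff_apply]
    exact sub_ne_zero.mpr (Ne.symm hA)
  linear_combination PowerSeries.mul_inv_cancel (1 - A) h1

lemma coeff_arrSer_nonneg {q : ℝ} (h0 : 0 ≤ q) (h1 : 0 ≤ 1 - q) (j : ℕ) :
    0 ≤ coeff j (arrSer q) := by
  rw [arrSer, map_add, coeff_C_mul, coeff_X, coeff_C]
  split_ifs <;> simp <;> linarith

lemma absConv_arrSer (R q : ℝ) : AbsConv R (arrSer q) :=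
  ((absConv_C R q).mul (absConv_X R)).add (absConv_C R (1 - q))

lemma ev_arrSer (R q : ℝ) : ev R (arrSer q) = q * R + (1 - q) := by
  rw [arrSer, ev_add ((absConv_C R q).mul (absConv_X R)) (absConv_C R (1 - q)),
    ev_mul (absConv_C R q) (absConv_X R), ev_C, ev_C, ev_X]

lemma tail_arrSer (R q : ℝ) : Tail R (arrSer q) 0 := by
  have := ((tail_X R).C_mul q).add (tail_C R (1 - q))
  rwa [mul_zero, add_zero] at this

lemma arrSer_ne_zero {q : ℝ} (hq : 0 < q) : arrSer q ≠ 0 := by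
  intro h
  have := congrArg (coeff 1) h
  rw [arrSer, map_add, coeff_C_mul, coeff_one_X, coeff_C, if_neg one_ne_zero, map_zero] at this
  linarith

/-- The power series `r` is the branch of the solutions of `c(y) r² + b(y) r + a(y) = 0` that
is a power series with nonnegative coefficients, in the form `r = (q y + 1 - q) P(r)`. The field
`eq_disc` is the solution formula for the quadratic equation; `tail` records the square-root singularity
of `r` at `y₀`. -/
structure IsBranch (p q muH : ℝ) (r : ℝ⟦X⟧) : Prop where
  nonneg : ∀ j, 0 ≤ coeff j r
  eq : r = arrSer q * (C (p * (1 - muH)) + C (stay p muH) * r + C ((1 - p) * muH) * (r * r))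
  eq_disc : C (2 * ((1 - p) * muH)) * (arrSer q * r) =
    1 - C (stay p muH) * arrSer q - discSeries p q muH
  tail : Tail (yZero p q muH) r
    (discTail p q muH / (2 * ((1 - p) * muH) * (q * yZero p q muH + (1 - q))))

/-- The branch is built from `v = (q y + 1 - q) r = (1 - t (q y + 1 - q) - √Δ) / (2 s)`, which has
nonnegative coefficients because it solves a quadratic fixed point equation with nonnegative data; then
`r = (p (1 - μ_h) (q y + 1 - q) + t v) / (1 - s v)`. Here `s = (1 - p) μ_h` and `t = stay p μ_h`. -/
lemma Params.exists_isBranch {p q muH muL : ℝ} (h : Params p q muH muL) :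
    ∃ r, IsBranch p q muH r := by
  set s := (1 - p) * muH with hs
  have hs0 : 0 < s := mul_pos h.p_lt_one h.hmuH
  set t := stay p muH with ht
  have ht0 : 0 < t := h.stay_pos
  set g := arrSer q with hg
  set D := discSeries p q muH with hD
  set R := yZero p q muH with hR
  have hR0 : 0 < R := h.yZero_pos
  have hg0 : 0 < q * R + (1 - q) := h.arr_yZero_pos
  obtain ⟨v, hv⟩ : ∃ v : ℝ⟦X⟧, v = C (1 / (2 * s)) * (1 - C t * g - D) := ⟨_, rfl⟩
  have hgn : ∀ j, 0 ≤ coeff j g := coeff_arrSer_nonneg h.hq.le h.q_lt_one.le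
  have hCs : C (2 * s) * C (1 / (2 * s)) = (1 : ℝ⟦X⟧) := by
    rw [← map_mul, mul_one_div_cancel (by positivity), map_one]
  have hv2 : C (2 * s) * v = 1 - C t * g - D := by
    rw [hv]
    linear_combination (1 - C t * g - D) * hCs
  have hDD : D * D = (C t * g - 1) ^ 2 - C (4 * gmean p muH ^ 2) * g ^ 2 := h.discSeries_mul_self
  have hgm : gmean p muH ^ 2 = p * (1 - muH) * s := by rw [h.gmean_sq, hs]; ring
  have hveq : v = C (p * (1 - muH)) * (g * g) + C t * g * v + C s * (v * v) := by
    have h4 : C (4 * s) * (C (p * (1 - muH)) * (g * g) + C t * g * v + C s * (v * v) - v) = (0 : ℝ⟦X⟧) := by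
      have e1 : (C (4 * gmean p muH ^ 2) : ℝ⟦X⟧) = 4 * C (p * (1 - muH)) * C s := by
        rw [hgm]; simp only [map_mul, map_ofNat]; ring
      have e2 : (C (2 * s) : ℝ⟦X⟧) = 2 * C s := by simp only [map_mul, map_ofNat]
      have e3 : (C (4 * s) : ℝ⟦X⟧) = 4 * C s := by simp only [map_mul, map_ofNat]
      rw [e1] at hDD
      rw [e2] at hv2
      rw [e3]
      linear_combination (2 * C s * v + (C t * g - 1) + (-D)) * hv2 + hDD
    have h5 : (C (4 * s) : ℝ⟦X⟧) ≠ 0 := by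
      intro h6
      have h7 := congrArg (coeff 0) h6
      simp at h7
      exact hs0.ne' h7
    have h6 := (mul_eq_zero.mp h4).resolve_left h5
    linear_combination -h6
  have hcg0 : coeff 0 g = 1 - q := by simp [hg, arrSer]
  have hD0 : 0 < coeff 0 D := h.coeff_zero_discSeries
  have hv0' : 2 * s * coeff 0 v = 1 - t * (1 - q) - coeff 0 D := by
    have := congrArg (coeff 0) hv2
    rw [coeff_C_mul, map_sub, map_sub, coeff_C_mul, hcg0, coeff_one, if_pos rfl] at this
    exact this
  have htg : t * (1 - q) < 1 := by
    have h1 := h.stay_add_lt_one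
    have h2 := h.gmean_pos
    have h3 := h.hq
    nlinarith [h.q_lt_one]
  have hv0 : 0 ≤ coeff 0 v := by
    have h1 : coeff 0 D * coeff 0 D ≤ (1 - t * (1 - q)) * (1 - t * (1 - q)) := by
      have h2 := congrArg (coeff 0) hDD
      rw [map_sub, coeff_C_mul, pow_two, pow_two g] at h2
      simp only [coeff_mul, Finset.Nat.antidiagonal_zero, Finset.sum_singleton, map_sub,
        coeff_one, if_true, hcg0, coeff_zero_C] at h2
      nlinarith [sq_nonneg (gmean p muH * (1 - q))]
    have h2 := abs_le_of_sq_le_sq (by nlinarith : coeff 0 D ^ 2 ≤ (1 - t * (1 - q)) ^ 2) (by linarith)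
    have h3 : 0 ≤ 2 * s * coeff 0 v := by rw [hv0']; linarith [(abs_le.mp h2).2]
    exact nonneg_of_mul_nonneg_right h3 (by positivity)
  have hvn : ∀ j, 0 ≤ coeff j v := by
    refine coeff_nonneg_of_quadratic (A := C (p * (1 - muH)) * (g * g)) (T := C t * g) (s := s)
      (fun j => ?_) (fun j => ?_) hs0.le hv0 ?_ hveq
    · rw [coeff_C_mul]
      exact mul_nonneg (mul_pos h.hp h.muH_lt_one).le (coeff_mul_nonneg hgn hgn j)
    · rw [coeff_C_mul]
      exact mul_nonneg ht0.le (hgn j)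
    · rw [coeff_C_mul, hcg0, hv0']
      linarith
  -- The tail and the value of `v` at the branch point.
  have hvt : Tail R v (discTail p q muH / (2 * s)) := by
    have h1 := (((tail_one R).sub ((tail_arrSer R q).C_mul t)).sub h.tail_discSeries).C_mul (1 / (2 * s))
    rw [← hv] at h1
    convert h1 using 1
    ring
  have hve : 2 * s * ev R v = 1 - t * (q * R + (1 - q)) := by
    have h1 := congrArg (ev R) hv2
    rw [ev_mul (absConv_C _ _) hvt.absConv, ev_C, ev_sub ((absConv_one R).sub
      ((absConv_C R t).mul (absConv_arrSer R q))) h.tail_discSeries.absConv, ev_sub (absConv_one R)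
      ((absConv_C R t).mul (absConv_arrSer R q)), ev_mul (absConv_C R t) (absConv_arrSer R q),
      ev_C, ev_one, ev_arrSer, h.ev_discSeries] at h1
    linarith
  have hsv : ev R (C s * v) < 1 := by
    rw [ev_mul (absConv_C _ _) hvt.absConv, ev_C]
    nlinarith
  have hsvn : ∀ j, 0 ≤ coeff j (C s * v) := fun j => by
    rw [coeff_C_mul]; exact mul_nonneg hs0.le (hvn j)
  have hsvt := hvt.C_mul s
  have hsv0 : coeff 0 (C s * v) < 1 :=
    (coeff_zero_le_ev hsvt.absConv hR0.le hsvn).trans_lt hsv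
  obtain ⟨B, hB⟩ := exists_eq_one_add_mul hsv0.ne
  have hBn := coeff_nonneg_of_eq_add_mul (A := 1) (fun j => by
    rw [coeff_one]; split_ifs <;> norm_num) hsvn hsv0 hB
  have hBt := hsvt.inv_one_sub (by rwa [tsum_abs_eq_ev hR0.le hsvn]) hB
  obtain ⟨r, hr⟩ : ∃ r : ℝ⟦X⟧, r = (C (p * (1 - muH)) * g + C t * v) * B := ⟨_, rfl⟩
  have hgr : g * r = v := by
    have h1 : (1 - C s * v) * (g * r - v) = 0 := by
      rw [hr]
      linear_combination (g * (C (p * (1 - muH)) * g + C t * v)) * hB - hveq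
    refine sub_eq_zero.mp ((mul_eq_zero.mp h1).resolve_left fun h2 => ?_)
    have h3 := congrArg (coeff 0) h2
    rw [map_sub, coeff_one, if_pos rfl, map_zero] at h3
    linarith
  have hreq : r = g * (C (p * (1 - muH)) + C t * r + C s * (r * r)) := by
    have h1 : r * (1 - C s * v) = C (p * (1 - muH)) * g + C t * v := by
      rw [hr]
      linear_combination (C (p * (1 - muH)) * g + C t * v) * hB
    linear_combination h1 - (C t + C s * r) * hgr
  have hrt := (((tail_arrSer R q).C_mul (p * (1 - muH))).add (hvt.C_mul t)).mul hBt
  rw [← hg, ← hr] at hrt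
  refine ⟨r, fun j => ?_, hreq, by rw [← hg, hgr, hv2], ?_⟩
  · rw [hr]
    refine coeff_mul_nonneg (fun j => ?_) hBn j
    rw [map_add, coeff_C_mul, coeff_C_mul]
    exact add_nonneg (mul_nonneg (mul_pos h.hp h.muH_lt_one).le (hgn j))
      (mul_nonneg ht0.le (hvn j))
  · -- The tail of `r` exists, and its constant is determined by `g r = v`.
    have h1 := (tail_arrSer R q).mul hrt
    rw [← hg, hgr, zero_mul, zero_add, ev_arrSer] at h1
    have h2 := h1.unique hvt
    refine (congrArg (Tail R r) ?_).mp hrt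
    rw [eq_div_iff (by positivity), mul_right_comm, ← mul_assoc, mul_comm _ (2 * s)]
    rw [eq_div_iff (by positivity)] at h2
    linear_combination h2

/-! ### Values of the branch -/

/-- The critical value `r(y₀)` of the branch `r`. -/
noncomputable def rCrit (p muH : ℝ) : ℝ := gmean p muH / ((1 - p) * muH)

/-- The quadratic equation for the value of the branch at a point of `[0, y₀]`. -/
lemma IsBranch.ev_eq {p q muH : ℝ} {r : ℝ⟦X⟧} (hr : IsBranch p q muH r) {y : ℝ} (h0 : 0 ≤ y) (hy : y ≤ yZero p q muH) :
    ev y r = (q * y + (1 - q)) *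
      (p * (1 - muH) + stay p muH * ev y r + (1 - p) * muH * ev y r ^ 2) := by
  have hra := hr.tail.absConv.mono h0 hy
  have hg := absConv_arrSer y q
  have h1 := congrArg (ev y) hr.eq
  have a1 := (absConv_C y (stay p muH)).mul hra
  have a2 := (absConv_C y ((1 - p) * muH)).mul (hra.mul hra)
  have a3 := (absConv_C y (p * (1 - muH))).add a1
  rw [ev_mul hg (a3.add a2), ev_add a3 a2, ev_add (absConv_C _ _) a1, ev_mul (absConv_C _ _) hra,
    ev_mul (absConv_C _ _) (hra.mul hra), ev_mul hra hra, ev_C, ev_C, ev_C, ev_arrSer] at h1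
  linear_combination h1

section

variable {p q muH muL : ℝ} (h : Params p q muH muL)
include h

lemma Params.up_pos : 0 < p * (1 - muH) := mul_pos h.hp h.muH_lt_one

lemma Params.down_pos : 0 < (1 - p) * muH := mul_pos h.p_lt_one h.hmuH

lemma Params.down_mul_rCrit : (1 - p) * muH * rCrit p muH = gmean p muH :=
  mul_div_cancel₀ _ h.down_pos.ne'

lemma Params.down_mul_rCrit_sq : (1 - p) * muH * rCrit p muH ^ 2 = p * (1 - muH) := by
  refine mul_left_cancel₀ h.down_pos.ne' ?_
  linear_combination ((1 - p) * muH * rCrit p muH + gmean p muH) * h.down_mul_rCrit + h.gmean_sq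

lemma Params.rCrit_pos : 0 < rCrit p muH := div_pos h.gmean_pos h.down_pos

lemma Params.rCrit_lt_one : rCrit p muH < 1 := by
  have h1 := h.down_mul_rCrit_sq
  have h2 : p * (1 - muH) < (1 - p) * muH := by linarith [h.p_lt_muH]
  have h3 := h.rCrit_pos
  have h4 := h.down_pos
  by_contra! h5
  nlinarith [mul_le_mul_of_nonneg_left (one_le_pow₀ h5 : 1 ≤ rCrit p muH ^ 2) h4.le]

variable {r : ℝ⟦X⟧} (hr : IsBranch p q muH r)
include hr

lemma IsBranch.ev_yZero : ev (yZero p q muH) r = rCrit p muH := by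
  have hg := absConv_arrSer (yZero p q muH) q
  have hra := hr.tail.absConv
  have h1 := congrArg (ev (yZero p q muH)) hr.eq_disc
  rw [ev_mul (absConv_C _ _) (hg.mul hra), ev_mul hg hra, ev_sub ((absConv_one _).sub
    ((absConv_C _ _).mul hg)) h.tail_discSeries.absConv, ev_sub (absConv_one _)
    ((absConv_C _ _).mul hg), ev_mul (absConv_C _ _) hg, h.ev_discSeries, ev_C, ev_C, ev_one,
    ev_arrSer] at h1
  refine mul_left_cancel₀ (mul_pos h.down_pos h.arr_yZero_pos).ne' ?_
  linear_combination h1 / 2 - h.arr_yZero / 2 - (q * yZero p q muH + (1 - q)) * h.down_mul_rCrit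

lemma IsBranch.coeff_zero_lt_one : coeff 0 r < 1 :=
  (coeff_zero_le_ev hr.tail.absConv h.yZero_pos.le hr.nonneg).trans_lt
    ((hr.ev_yZero h).trans_lt h.rCrit_lt_one)

lemma IsBranch.coeff_one_pos : 0 < coeff 1 r := by
  have h1 := congrArg (coeff 1) hr.eq
  rw [coeff_succ_arrSer_mul] at h1
  simp only [coeff_add, coeff_C_mul] at h1
  rw [coeff_zero_C, zero_add, coeff_C, if_neg one_ne_zero] at h1
  have h2 := mul_pos h.hq h.up_pos
  have h3 := mul_nonneg h.stay_pos.le (hr.nonneg 0)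
  have h4 := mul_nonneg h.down_pos.le (coeff_mul_nonneg hr.nonneg hr.nonneg 0)
  have h5 := mul_nonneg h.stay_pos.le (hr.nonneg 1)
  have h6 := mul_nonneg h.down_pos.le (coeff_mul_nonneg hr.nonneg hr.nonneg 1)
  rw [h1]
  have h7 := mul_nonneg h.q_lt_one.le (add_nonneg h5 h6)
  have h8 := mul_nonneg h.hq.le (add_nonneg h3 h4)
  linarith

lemma IsBranch.ev_le {y : ℝ} (h0 : 0 ≤ y) (hy : y ≤ yZero p q muH) : ev y r ≤ rCrit p muH :=
  (ev_mono hr.tail.absConv hr.nonneg h0 hy).trans_eq (hr.ev_yZero h)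

/-- At `y = 1` the two solutions of the kernel equation are `1` and `p (1 - μ_h) / ((1 - p) μ_h)`. -/
lemma IsBranch.down_mul_ev_one : (1 - p) * muH * ev 1 r = p * (1 - muH) := by
  have h1 := hr.ev_eq zero_le_one h.one_lt_yZero.le
  have h2 := (hr.ev_le h zero_le_one h.one_lt_yZero.le).trans_lt h.rCrit_lt_one
  refine mul_left_cancel₀ (sub_pos.mpr h2).ne' ?_
  rw [stay] at h1
  linear_combination h1

end

/-! ### The generating functions in terms of the branch -/

lemma coeff_mul_of_lower_eq_zero {A B : ℝ⟦X⟧} {n : ℕ} (hB : ∀ m < n, coeff m B = 0) :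
    coeff n (A * B) = coeff 0 A * coeff n B := by
  rw [coeff_mul, Finset.sum_eq_single (0, n)]
  · intro kl hkl hne
    have h1 := Finset.HasAntidiagonal.mem_antidiagonal.mp hkl
    have h2 : kl.1 ≠ 0 := fun h0 => hne (Prod.ext h0 (by simpa [h0] using h1))
    rw [hB kl.2 (by omega), mul_zero]
  · intro h1
    exact absurd (Finset.HasAntidiagonal.mem_antidiagonal.mpr (zero_add n)) h1

lemma IsStationary.le_one {p q muH muL : ℝ} {π : ℕ → ℕ → ℝ} (hπ : IsStationary p q muH muL π)
    (i j : ℕ) : π i j ≤ 1 :=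
  le_hasSum hπ.hasSum_one (i, j) fun s _ => hπ.nonneg s.1 s.2

lemma eq_zero_of_geometric_of_bounded {e : ℕ → ℝ} {a b M : ℝ} (ha : 0 < a) (hab : a < b)
    (he : ∀ k, a * e (k + 1) = b * e k) (hM : ∀ k, |e k| ≤ M) (k : ℕ) : e k = 0 := by
  have h1 : ∀ m, e (k + m) = (b / a) ^ m * e k := by
    intro m
    induction m with
    | zero => simp
    | succ m ih =>
      have h2 := he (k + m)
      rw [ih] at h2
      rw [← add_assoc, pow_succ]
      field_simp
      linear_combination h2
  by_contra hne
  obtain ⟨m, hm⟩ := ((tendsto_pow_atTop_atTop_of_one_lt ((one_lt_div ha).mpr hab)).eventually_gt_atTop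
    (M / |e k|)).exists
  have h3 := hM (k + m)
  rw [h1, abs_mul, abs_of_pos (pow_pos (div_pos (ha.trans hab) ha) m)] at h3
  rw [div_lt_iff₀ (abs_pos.mpr hne)] at hm
  linarith

/-- The generating functions `Πᵢ` form a geometric sequence with ratio `r`: a nonzero component along
the other solution of the linear recurrence would have unbounded lowest coefficients. -/
theorem genFun_eq {p q muH muL : ℝ} {π : ℕ → ℕ → ℝ} (h : Params p q muH muL)
    (hπ : IsStationary p q muH muL π) {r : ℝ⟦X⟧} (hr : IsBranch p q muH r) (i : ℕ) :
    genFun π i = genFun π 0 * r ^ i := by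
  set V : ℝ⟦X⟧ := 1 - C (stay p muH) * arrSer q - C ((1 - p) * muH) * (arrSer q * r) with hV
  set E : ℕ → ℝ⟦X⟧ := fun k => genFun π (k + 1) - r * genFun π k with hE
  have hrec : ∀ k, C ((1 - p) * muH) * arrSer q * E (k + 1) = V * E k := by
    intro k
    have h1 := genFun_balance hπ k
    rw [← stay] at h1
    have h2 := hr.eq
    simp only [hE, hV]
    linear_combination genFun π k * h2 - h1
  have hc0 : coeff 0 (C ((1 - p) * muH) * arrSer q) = (1 - p) * muH * (1 - q) := by
    rw [coeff_C_mul]; simp [arrSer]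
  have hV0 : coeff 0 V = 1 - stay p muH * (1 - q) - (1 - p) * muH * (1 - q) * coeff 0 r := by
    rw [hV, map_sub, map_sub, coeff_C_mul, coeff_C_mul, coeff_zero_arrSer_mul, coeff_one, if_pos rfl]
    simp [arrSer]
    ring
  have hlt : (1 - p) * muH * (1 - q) < coeff 0 V := by
    have h1 := hr.coeff_zero_lt_one h
    have h2 := congrArg (coeff 0) hr.eq
    rw [coeff_zero_arrSer_mul, coeff_add, coeff_add, coeff_C_mul, coeff_C_mul, coeff_zero_C,
      coeff_mul] at h2
    simp only [Finset.Nat.antidiagonal_zero, Finset.sum_singleton] at h2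
    rw [stay] at h2
    have h3 : (1 - coeff 0 r) * (coeff 0 V - (1 - p) * muH * (1 - q)) = q := by
      rw [hV0, stay]
      linear_combination -h2
    have h4 := h.hq
    by_contra! h5
    nlinarith
  have hzero : ∀ n k, coeff n (E k) = 0 := by
    intro n
    induction n using Nat.strong_induction_on with
    | _ n ih =>
      refine eq_zero_of_geometric_of_bounded (a := (1 - p) * muH * (1 - q)) (b := coeff 0 V)
        (M := 1 + ∑ kl ∈ Finset.HasAntidiagonal.antidiagonal n, coeff kl.1 r)
        (mul_pos h.down_pos h.q_lt_one) hlt (fun k => ?_) (fun k => ?_)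
      · have h1 := congrArg (coeff n) (hrec k)
        rwa [coeff_mul_of_lower_eq_zero fun m hm => ih m hm _,
          coeff_mul_of_lower_eq_zero fun m hm => ih m hm _, hc0] at h1
      · simp only [hE, map_sub, coeff_mul]
        refine (abs_sub _ _).trans (add_le_add ?_ ?_)
        · rw [genFun, coeff_mk, abs_of_nonneg (hπ.nonneg _ _)]
          exact hπ.le_one _ _
        · refine (Finset.abs_sum_le_sum_abs _ _).trans (Finset.sum_le_sum fun kl _ => ?_)
          rw [genFun, coeff_mk, abs_of_nonneg (mul_nonneg (hr.nonneg _) (hπ.nonneg _ _))]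
          exact mul_le_of_le_one_right (hr.nonneg _) (hπ.le_one _ _)
  have hstep : ∀ k, genFun π (k + 1) = r * genFun π k := fun k =>
    sub_eq_zero.mp (PowerSeries.ext fun n => by rw [map_zero]; exact hzero n k)
  induction i with
  | zero => simp
  | succ i ih => rw [hstep, ih]; ring

/-- Constant coefficient of the quadratic polynomial `W(z) = quadC + quadB z + quadA z²` for which
`Π₀ = K (1 - r) P(r) / W(r)`. -/
def quadC (p q muH : ℝ) : ℝ := (1 - q) * (p * (1 - muH))

/-- Leading coefficient of `W`. -/
def quadA (p q muH muL : ℝ) : ℝ := (1 - p) * ((1 - q) * muH - muL)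

/-- Linear coefficient of `W`. -/
def quadB (p q muH muL : ℝ) : ℝ := -q - quadC p q muH - quadA p q muH muL

/-- The polynomial `P(z) = p (1 - μ_h) + (p μ_h + (1 - p) (1 - μ_h)) z + (1 - p) μ_h z²` at `r`. -/
noncomputable def stepSer (p muH : ℝ) (r : ℝ⟦X⟧) : ℝ⟦X⟧ :=
  C (p * (1 - muH)) + C (stay p muH) * r + C ((1 - p) * muH) * (r * r)

/-- The polynomial `W` at `r`. -/
noncomputable def quadSer (p q muH muL : ℝ) (r : ℝ⟦X⟧) : ℝ⟦X⟧ :=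
  C (quadC p q muH) + C (quadB p q muH muL) * r + C (quadA p q muH muL) * (r * r)

/-- The constant `K = (1 - p) μ_l (1 - q) π₀₀ = μ_l (1 - ρ)` in the formula for `Π₀`; the equality is
`massC_eq`. -/
noncomputable def massC (p q muH muL : ℝ) : ℝ := muL * (1 - rho p q muH muL)

/-- The boundary equation, after elimination of `y` by `r = (q y + 1 - q) P(r)` and cancellation of the
common factor `p (1 - μ_h) - (1 - p) μ_h r`. -/
lemma genFun_mul_quadSer_aux {p q muH muL : ℝ} {π : ℕ → ℕ → ℝ} (h : Params p q muH muL)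
    (hπ : IsStationary p q muH muL π) {r : ℝ⟦X⟧} (hr : IsBranch p q muH r) :
    genFun π 0 * quadSer p q muH muL r =
      C ((1 - p) * muL * (1 - q) * π 0 0) * ((1 - r) * stepSer p muH r) := by
  set K : ℝ⟦X⟧ := C ((1 - p) * muL * (1 - q) * π 0 0) with hK
  set P := stepSer p muH r with hP
  set u : ℝ⟦X⟧ := C (p * (1 - muH)) - C ((1 - p) * muH) * r with hu
  have hrP : r = arrSer q * P := hr.eq
  have h0 := genFun_balance_zero hπ
  have h1 : genFun π 1 = genFun π 0 * r := by simpa using genFun_eq h hπ hr 1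
  rw [h1, ← hK] at h0
  have h2 : genFun π 0 * (C ((1 - p) * muL) * r -
      X * (C (p * (1 - muH)) - C ((1 - p) * (muH - muL)) * r)) = K * (1 - X) * P := by
    refine mul_left_cancel₀ (arrSer_ne_zero h.hq) ?_
    have hc : (C (stay p muH) : ℝ⟦X⟧) - C (p * muH + (1 - p) * (1 - muL)) =
        -C ((1 - p) * (muH - muL)) := by
      rw [← map_sub, ← map_neg, stay]
      congr 1
      ring
    simp only [hP, stepSer] at hrP ⊢
    linear_combination -r * h0 + (genFun π 0 * X + K * (1 - X)) * hrP +
      (arrSer q * X * genFun π 0 * r) * hc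
  have hg : arrSer q = C q * X + C (1 - q) := rfl
  have h3 : genFun π 0 * (C ((1 - p) * muL) * C q * r * P -
      (r - C (1 - q) * P) * (C (p * (1 - muH)) - C ((1 - p) * (muH - muL)) * r)) =
      K * (P - r) * P := by
    have hc : (C (1 - q) : ℝ⟦X⟧) = 1 - C q := by rw [map_sub, map_one]
    rw [hg, hc] at hrP
    rw [hc]
    linear_combination C q * P * h2 +
      (-genFun π 0 * (C (p * (1 - muH)) - C ((1 - p) * (muH - muL)) * r) + K * P) * hrP
  have hPr : P - r = (1 - r) * u := by
    simp only [hP, stepSer, hu, stay, map_mul, map_add, map_sub, map_one]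
    ring
  have hden : C ((1 - p) * muL) * C q * r * P -
      (r - C (1 - q) * P) * (C (p * (1 - muH)) - C ((1 - p) * (muH - muL)) * r) =
      u * quadSer p q muH muL r := by
    simp only [hP, stepSer, hu, quadSer, quadB, quadA, quadC, stay, map_mul, map_add, map_sub,
      map_one, map_neg]
    ring
  have hu0 : u ≠ 0 := by
    intro h4
    have h5 := congrArg (coeff 1) h4
    rw [hu, map_sub, coeff_C, if_neg one_ne_zero, coeff_C_mul, map_zero] at h5
    have := mul_pos h.down_pos (hr.coeff_one_pos h)
    linarith
  rw [hPr, hden] at h3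
  refine mul_left_cancel₀ hu0 ?_
  linear_combination h3

lemma absConv_genFun {p q muH muL : ℝ} {π : ℕ → ℕ → ℝ} (hπ : IsStationary p q muH muL π) (k : ℕ) :
    AbsConv 1 (genFun π k) := by
  have h1 := hπ.hasSum_one.summable.prod_factor k
  refine h1.congr fun j => ?_
  rw [genFun, coeff_mk, one_pow, mul_one, abs_of_nonneg (hπ.nonneg _ _)]

/-- The value of `W` at `r(1) = p (1 - μ_h) / ((1 - p) μ_h)`; it is positive since `ρ < 1`. -/
lemma Params.quad_eval {p q muH muL : ℝ} (h : Params p q muH muL) {x : ℝ}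
    (hx : (1 - p) * muH * x = p * (1 - muH)) :
    quadC p q muH + quadB p q muH muL * x + quadA p q muH muL * x ^ 2 = massC p q muH muL * x := by
  have h4 : muH * (quadC p q muH + quadB p q muH muL * x + quadA p q muH muL * x ^ 2) =
      (muL * muH - muL * p - q * muH) * x := by
    rw [quadB, quadA, quadC]
    linear_combination (-muH * (1 - q) + ((1 - q) * muH - muL) * x) * hx
  have hH := h.hmuH
  have hL := h.hmuL
  rw [massC, rho]
  field_simp
  linear_combination h4

/-- The normalisation `∑ π = 1` determines `π₀₀`. -/
lemma massC_eq {p q muH muL : ℝ} {π : ℕ → ℕ → ℝ} (h : Params p q muH muL)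
    (hπ : IsStationary p q muH muL π) {r : ℝ⟦X⟧} (hr : IsBranch p q muH r) :
    (1 - p) * muL * (1 - q) * π 0 0 = massC p q muH muL := by
  have hra : AbsConv 1 r := hr.tail.absConv.mono zero_le_one h.one_lt_yZero.le
  have hr1 := hr.down_mul_ev_one h
  have hrlt : ev 1 r < 1 :=
    (hr.ev_le h zero_le_one h.one_lt_yZero.le).trans_lt h.rCrit_lt_one
  have hr0 : 0 < ev 1 r := by
    have h1 := h.up_pos
    have h2 := h.down_pos
    rw [← hr1] at h1
    exact pos_of_mul_pos_right h1 h2.le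
  have hP0 := absConv_genFun hπ 0
  have hsum : ev 1 (genFun π 0) = 1 - ev 1 r := by
    have h1 := hπ.hasSum_one.summable.tsum_prod
    rw [hπ.hasSum_one.tsum_eq] at h1
    have h2 : ∀ k, ∑' j, π k j = ev 1 (genFun π 0) * ev 1 r ^ k := by
      intro k
      rw [← ev_pow hra, ← ev_mul hP0 (hra.pow k), ← genFun_eq h hπ hr k, ev]
      simp [genFun]
    simp only [h2] at h1
    rw [tsum_mul_left, tsum_geometric_of_lt_one hr0.le hrlt] at h1
    have : 1 - ev 1 r ≠ 0 := by linarith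
    field_simp at h1
    linarith
  have h2 := congrArg (ev 1) (genFun_mul_quadSer_aux h hπ hr)
  have hC := absConv_C 1
  have a1 : AbsConv 1 (stepSer p muH r) :=
    ((hC _).add ((hC _).mul hra)).add ((hC _).mul (hra.mul hra))
  have a2 : AbsConv 1 (quadSer p q muH muL r) :=
    ((hC _).add ((hC _).mul hra)).add ((hC _).mul (hra.mul hra))
  have e1 : ev 1 (stepSer p muH r) = ev 1 r := by
    have h3 : ev 1 r = ev 1 (arrSer q * stepSer p muH r) := congrArg (ev 1) hr.eq
    rw [ev_mul (absConv_arrSer 1 q) a1, ev_arrSer] at h3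
    linear_combination -h3
  have e2 : ev 1 (quadSer p q muH muL r) = quadC p q muH + quadB p q muH muL * ev 1 r +
      quadA p q muH muL * ev 1 r ^ 2 := by
    rw [quadSer, ev_add ((hC _).add ((hC _).mul hra)) ((hC _).mul (hra.mul hra)),
      ev_add (hC _) ((hC _).mul hra), ev_mul (hC _) hra, ev_mul (hC _) (hra.mul hra),
      ev_mul hra hra, ev_C, ev_C, ev_C]
    ring
  rw [ev_mul hP0 a2, ev_mul (hC _) (((absConv_one 1).sub hra).mul a1), ev_mul
    ((absConv_one 1).sub hra) a1, ev_sub (absConv_one 1) hra, ev_one, ev_C, hsum, e1, e2] at h2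
  have h3 : (quadC p q muH + quadB p q muH muL * ev 1 r + quadA p q muH muL * ev 1 r ^ 2) =
      ((1 - p) * muL * (1 - q) * π 0 0) * ev 1 r :=
    mul_left_cancel₀ (sub_pos.mpr hrlt).ne' (by linear_combination h2)
  refine mul_right_cancel₀ hr0.ne' ?_
  rw [← h3, h.quad_eval hr1]

/-! ### The zeros of the denominator -/

/-- At a point `(y, z)` of the kernel curve, `h₂` is a multiple of `W(z)`. -/
lemma kernel_point {p q muH muL y z : ℝ}
    (hz : z = (q * y + (1 - q)) * (p * (1 - muH) + stay p muH * z + (1 - p) * muH * z ^ 2)) :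
    q * z ^ 2 * (bTwo p q muH muL y + y * ((1 - p) * muH * (q * y + (1 - q)) * z)) =
      (q * y + (1 - q)) ^ 2 * ((p * (1 - muH) - (1 - p) * muH * z) *
        (quadC p q muH + quadB p q muH muL * z + quadA p q muH muL * z ^ 2)) := by
  set g := q * y + (1 - q) with hg
  set P := p * (1 - muH) + stay p muH * z + (1 - p) * muH * z ^ 2 with hP
  have h1 : z * (bTwo p q muH muL y + y * ((1 - p) * muH * g * z)) =
      g * ((1 - p) * muL * z - y * (p * (1 - muH) - (1 - p) * (muH - muL) * z)) := by
    have hb : bTwo p q muH muL y =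
        g * ((1 - p) * muL + (p * muH + (1 - p) * (1 - muL)) * y) - y := by
      rw [bTwo, hg]; ring
    rw [hb]
    rw [hP, stay] at hz
    linear_combination -y * hz
  have h2 : (p * (1 - muH) - (1 - p) * muH * z) *
        (quadC p q muH + quadB p q muH muL * z + quadA p q muH muL * z ^ 2) =
      (1 - p) * muL * q * z * P - (z - (1 - q) * P) * (p * (1 - muH) - (1 - p) * (muH - muL) * z) := by
    rw [hP, quadB, quadA, quadC, stay]
    ring
  have h3 : q * z * ((1 - p) * muL * z - y * (p * (1 - muH) - (1 - p) * (muH - muL) * z)) =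
      g * ((1 - p) * muL * q * z * P -
        (z - (1 - q) * P) * (p * (1 - muH) - (1 - p) * (muH - muL) * z)) := by
    linear_combination ((1 - p) * muL * q * z + (1 - q) * (p * (1 - muH) - (1 - p) * (muH - muL) * z)) * hz
      + (-(z * (p * (1 - muH) - (1 - p) * (muH - muL) * z))) * hg
  rw [h2]
  linear_combination q * z * h1 + g * h3

lemma F_eq_two_mul (p q muH muL y : ℝ) :
    F p q muH muL y = 2 * bTwo p q muH muL y - y * kerB p q muH y := by
  rw [F, bTwo, kerB]; ring

section

variable {p q muH muL : ℝ} (h : Params p q muH muL)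
include h

lemma Params.massC_pos : 0 < massC p q muH muL := mul_pos h.hmuL (sub_pos.mpr h.hrho)

lemma Params.quadC_pos : 0 < quadC p q muH := mul_pos h.q_lt_one h.up_pos

lemma Params.rCrit_kernel : rCrit p muH = (q * yZero p q muH + (1 - q)) *
    (p * (1 - muH) + stay p muH * rCrit p muH + (1 - p) * muH * rCrit p muH ^ 2) := by
  linear_combination -rCrit p muH * h.arr_yZero + (q * yZero p q muH + (1 - q)) * (h.down_mul_rCrit_sq - 2 * rCrit p muH * h.down_mul_rCrit)

/-- The inequality `W(-r(y₀)) > 0` keeps the second zero of `W` outside the disc of radius `r(y₀)`. -/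
lemma Params.quad_neg_rCrit_pos :
    0 < quadC p q muH + quadB p q muH muL * (-rCrit p muH) + quadA p q muH muL * (-rCrit p muH) ^ 2 := by
  have h0 := h.rCrit_pos
  have h1 : (p * (1 - muH) - (1 - p) * muH * (-rCrit p muH)) *
        (quadC p q muH + quadB p q muH muL * (-rCrit p muH) +
          quadA p q muH muL * (-rCrit p muH) ^ 2) =
      (1 - p) * muL * q * rCrit p muH ^ 2 * (stay p muH - 2 * gmean p muH) +
      rCrit p muH * (1 - (1 - q) * (stay p muH - 2 * gmean p muH)) *
        (p * (1 - muH) + (1 - p) * (muH - muL) * rCrit p muH) := by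
    have hP : p * (1 - muH) + stay p muH * (-rCrit p muH) + (1 - p) * muH * (-rCrit p muH) ^ 2 =
        -rCrit p muH * (stay p muH - 2 * gmean p muH) := by
      linear_combination 2 * rCrit p muH * h.down_mul_rCrit - h.down_mul_rCrit_sq
    have h2 : (p * (1 - muH) - (1 - p) * muH * (-rCrit p muH)) *
        (quadC p q muH + quadB p q muH muL * (-rCrit p muH) +
          quadA p q muH muL * (-rCrit p muH) ^ 2) =
      (1 - p) * muL * q * (-rCrit p muH) *
        (p * (1 - muH) + stay p muH * (-rCrit p muH) + (1 - p) * muH * (-rCrit p muH) ^ 2) -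
      (-rCrit p muH - (1 - q) *
        (p * (1 - muH) + stay p muH * (-rCrit p muH) + (1 - p) * muH * (-rCrit p muH) ^ 2)) *
      (p * (1 - muH) - (1 - p) * (muH - muL) * (-rCrit p muH)) := by
      rw [quadB, quadA, quadC, stay]
      ring
    rw [h2, hP]
    ring
  have h3 : 0 < p * (1 - muH) - (1 - p) * muH * (-rCrit p muH) := by
    have := mul_pos h.down_pos h0
    linarith [h.up_pos]
  have h4 : 0 < 1 - (1 - q) * (stay p muH - 2 * gmean p muH) := by
    have h5 := h.stay_add_lt_one
    have h6 := h.gmean_pos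
    have h7 := h.stay_sub_pos
    have h8 := h.hq
    nlinarith
  have h5 : 0 < p * (1 - muH) + (1 - p) * (muH - muL) * rCrit p muH :=
    add_pos_of_pos_of_nonneg h.up_pos
      (mul_nonneg (mul_nonneg h.p_lt_one.le (sub_nonneg.mpr h.hle)) h0.le)
  have h6 : 0 < (1 - p) * muL * q * rCrit p muH ^ 2 * (stay p muH - 2 * gmean p muH) :=
    mul_pos (mul_pos (mul_pos (mul_pos h.p_lt_one h.hmuL) h.hq) (pow_pos h0 2)) h.stay_sub_pos
  refine pos_of_mul_pos_right (a := p * (1 - muH) - (1 - p) * muH * (-rCrit p muH)) ?_ h3.le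
  rw [h1]
  exact add_pos h6 (mul_pos (mul_pos h0 h4) h5)

end

/-- The factorisation `W(z) = (w - z) (l₀ + l₁ z)`, where `w` is the zero of `W` in `(0, 1)`, and the
other factor has no zero in the disc of radius `r(y₀)`. -/
structure QuadFactor (p q muH muL w l₀ l₁ : ℝ) : Prop where
  w_pos : 0 < w
  w_lt_one : w < 1
  eqC : w * l₀ = quadC p q muH
  eqB : w * l₁ - l₀ = quadB p q muH muL
  eqA : -l₁ = quadA p q muH muL
  l₀_pos : 0 < l₀
  l_one_pos : 0 < l₀ + l₁
  abs_lt : |l₁| * rCrit p muH < l₀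

lemma Params.exists_quadFactor {p q muH muL : ℝ} (h : Params p q muH muL) :
    ∃ w l₀ l₁, QuadFactor p q muH muL w l₀ l₁ := by
  have h0 := h.quadC_pos
  have h1 : quadC p q muH + quadB p q muH muL * 1 + quadA p q muH muL * 1 ^ 2 = -q := by
    rw [quadB]; ring
  have hcont : ContinuousOn (fun z : ℝ => quadC p q muH + quadB p q muH muL * z +
      quadA p q muH muL * z ^ 2) (Set.Icc 0 1) := by fun_prop
  obtain ⟨w, hw, hw0⟩ := intermediate_value_Icc' zero_le_one hcont
    (show (0 : ℝ) ∈ Set.Icc _ _ by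
      rw [h1]
      constructor
      · linarith [h.hq]
      · simpa using h0.le)
  simp only at hw0
  have hwpos : 0 < w := by
    rcases hw.1.lt_or_eq with h2 | h2
    · exact h2
    · rw [← h2] at hw0
      norm_num at hw0
      linarith
  have hwlt : w < 1 := by
    rcases hw.2.lt_or_eq with h2 | h2
    · exact h2
    · rw [h2, h1] at hw0
      linarith [h.hq]
  have hl0 : w * (quadC p q muH / w) = quadC p q muH := mul_div_cancel₀ _ hwpos.ne'
  have hfac : ∀ z, quadC p q muH + quadB p q muH muL * z + quadA p q muH muL * z ^ 2 =
      (w - z) * (quadC p q muH / w + -quadA p q muH muL * z) := by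
    intro z
    have : w * quadB p q muH muL = -quadC p q muH - quadA p q muH muL * w ^ 2 := by
      linear_combination hw0
    field_simp
    linear_combination z * this
  have hlpos : 0 < quadC p q muH / w := div_pos h0 hwpos
  have hl1 : 0 < quadC p q muH / w + -quadA p q muH muL := by
    have h2 := hfac 1
    rw [h1, mul_one] at h2
    have h3 := h.hq
    by_contra! h4
    nlinarith
  refine ⟨w, quadC p q muH / w, -quadA p q muH muL, hwpos, hwlt, hl0, ?_, neg_neg _, hlpos, hl1, ?_⟩
  · field_simp
    linear_combination -hw0
  · have hr0 := h.rCrit_pos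
    have hr1 := h.rCrit_lt_one
    have h2 := h.quad_neg_rCrit_pos (muL := muL)
    rw [hfac] at h2
    have h3 : 0 < w - -rCrit p muH := by linarith
    have h4 := pos_of_mul_pos_right h2 h3.le
    rcases abs_cases (-quadA p q muH muL) with ⟨h5, -⟩ | ⟨h5, -⟩
    · rw [h5]
      linarith
    · rw [h5]
      nlinarith

lemma QuadFactor.eval {p q muH muL w l₀ l₁ : ℝ} (hQ : QuadFactor p q muH muL w l₀ l₁) (z : ℝ) :
    quadC p q muH + quadB p q muH muL * z + quadA p q muH muL * z ^ 2 =
      (w - z) * (l₀ + l₁ * z) := by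
  rw [← hQ.eqC, ← hQ.eqB, ← hQ.eqA]; ring

lemma QuadFactor.linear_pos {p q muH muL w l₀ l₁ : ℝ} (hQ : QuadFactor p q muH muL w l₀ l₁) {z : ℝ}
    (h0 : 0 ≤ z) (h1 : z ≤ 1) : 0 < l₀ + l₁ * z := by
  have h2 := hQ.l₀_pos
  have h3 := hQ.l_one_pos
  rcases h0.lt_or_eq with h4 | h4
  · nlinarith
  · rw [← h4]; linarith

/-- The value of `F` at the branch point has the sign of `r(y₀) - w`. -/
lemma Params.F_yZero {p q muH muL w l₀ l₁ : ℝ} (h : Params p q muH muL)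
    (hQ : QuadFactor p q muH muL w l₀ l₁) :
    ∃ k, 0 < k ∧ F p q muH muL (yZero p q muH) = k * (rCrit p muH - w) := by
  have h0 := h.rCrit_pos
  have h1 := h.rCrit_lt_one
  have hL := hQ.linear_pos h0.le h1.le
  have hk := kernel_point (muL := muL) h.rCrit_kernel
  have hg := h.arr_yZero_pos
  have hs := h.down_pos
  have hq := h.hq
  rw [hQ.eval] at hk
  have hF : F p q muH muL (yZero p q muH) = 2 * (bTwo p q muH muL (yZero p q muH) + yZero p q muH *
      ((1 - p) * muH * (q * yZero p q muH + (1 - q)) * rCrit p muH)) := by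
    rw [F_eq_two_mul, kerB, ← stay]
    linear_combination (-yZero p q muH) * (h.arr_yZero + 2 * (q * yZero p q muH + (1 - q)) * h.down_mul_rCrit)
  refine ⟨2 * (q * yZero p q muH + (1 - q)) ^ 2 * ((1 - p) * muH * rCrit p muH * (1 - rCrit p muH)) *
    (l₀ + l₁ * rCrit p muH) / (q * rCrit p muH ^ 2), ?_, ?_⟩
  · have := sub_pos.mpr h1
    positivity
  · rw [hF, div_mul_eq_mul_div, eq_div_iff (by positivity)]
    have h2 : p * (1 - muH) - (1 - p) * muH * rCrit p muH =
        -((1 - p) * muH * rCrit p muH * (1 - rCrit p muH)) := by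
      linear_combination -h.down_mul_rCrit_sq
    rw [h2] at hk
    linear_combination 2 * hk

/-! ### The zeros `1 / η₁` and `1 / η₂` -/

section

variable {p q muH muL : ℝ} (h : Params p q muH muL)
include h

lemma Params.eta_den_pos : 0 < (1 - p) * (1 - q) * muL :=
  mul_pos (mul_pos h.p_lt_one h.q_lt_one) h.hmuL

lemma Params.gap_pos : 0 < muH - (1 - p) * muL := by
  have := mul_pos h.hp h.hmuL
  linarith [h.hle]

lemma Params.etaB_sq_lt : etaB p q muH muL ^ 2 < etaDisc p q muH muL := by
  rw [etaDisc]
  have := mul_pos (mul_pos (mul_pos (mul_pos h.p_lt_one h.q_lt_one) h.gap_pos) h.muL_lt_one) h.hq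
  linarith

lemma Params.sqrt_etaDisc_sq : √(etaDisc p q muH muL) ^ 2 = etaDisc p q muH muL :=
  Real.sq_sqrt ((sq_nonneg _).trans h.etaB_sq_lt.le)

lemma Params.abs_etaB_lt : |etaB p q muH muL| < √(etaDisc p q muH muL) := by
  rw [← Real.sqrt_sq_eq_abs]
  exact Real.sqrt_lt_sqrt (sq_nonneg _) h.etaB_sq_lt

lemma Params.eta1_pos : 0 < eta1 p q muH muL := by
  have h1 := h.eta_den_pos
  have h2 := (abs_lt.mp h.abs_etaB_lt).1
  exact div_pos (by linarith) (by linarith)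

lemma Params.eta2_neg : eta2 p q muH muL < 0 := by
  have h1 := h.eta_den_pos
  have h2 := (abs_lt.mp h.abs_etaB_lt).2
  exact div_neg_of_neg_of_pos (by linarith) (by linarith)

lemma Params.eta_add : (1 - p) * (1 - q) * muL * (eta1 p q muH muL + eta2 p q muH muL) =
    etaB p q muH muL := by
  have h1 := h.eta_den_pos
  rw [eta1, eta2, ← add_div, mul_div_assoc']
  rw [div_eq_iff (by linarith)]
  ring

lemma Params.eta_mul : (1 - p) * (1 - q) * muL ^ 2 * (eta1 p q muH muL * eta2 p q muH muL) =
    -(q * (1 - muL) * (muH - (1 - p) * muL)) := by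
  have h1 := h.eta_den_pos
  have h2 := h.sqrt_etaDisc_sq
  have h3 : 4 * ((1 - p) * (1 - q) * muL) ^ 2 * (eta1 p q muH muL * eta2 p q muH muL) =
      etaB p q muH muL ^ 2 - √(etaDisc p q muH muL) ^ 2 := by
    have h4 : 2 * (1 - p) * (1 - q) * muL ≠ 0 := by linarith
    rw [eta1, eta2, div_mul_div_comm, mul_div_assoc', div_eq_iff (mul_ne_zero h4 h4)]
    ring
  rw [h2, etaDisc] at h3
  have h4 : (4 * ((1 - p) * (1 - q))) ≠ 0 := by
    have := mul_pos h.p_lt_one h.q_lt_one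
    positivity
  refine mul_left_cancel₀ h4 ?_
  linear_combination h3

end

/-- The constant `4 (1 - p)² (1 - q) μ_l²` of the factorisation `Params.F_sq_sub`. -/
def normC (p q muL : ℝ) : ℝ := 4 * (1 - p) ^ 2 * (1 - q) * muL ^ 2

/-- The zeros of `F² - y² Δ` are `1`, `1 / η₁`, `1 / η₂` and `-(1 - q) / q`. -/
lemma Params.F_sq_sub {p q muH muL : ℝ} (h : Params p q muH muL) (y : ℝ) :
    F p q muH muL y ^ 2 - y ^ 2 * disc p q muH y =
      normC p q muL * (q * y + (1 - q)) * (1 - y) *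
        ((1 - eta1 p q muH muL * y) * (1 - eta2 p q muH muL * y)) := by
  have h1 := h.eta_add
  have h2 := h.eta_mul
  have h3 : normC p q muL * ((1 - eta1 p q muH muL * y) * (1 - eta2 p q muH muL * y)) =
      normC p q muL - 4 * (1 - p) * muL * etaB p q muH muL * y -
        4 * (1 - p) * (q * (1 - muL) * (muH - (1 - p) * muL)) * y ^ 2 := by
    rw [normC]
    linear_combination (-4 * (1 - p) * muL * y) * h1 + (4 * (1 - p) * y ^ 2) * h2
  calc F p q muH muL y ^ 2 - y ^ 2 * disc p q muH y
      = (q * y + (1 - q)) * (1 - y) * (normC p q muL - 4 * (1 - p) * muL * etaB p q muH muL * y -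
        4 * (1 - p) * (q * (1 - muL) * (muH - (1 - p) * muL)) * y ^ 2) := by
        rw [F, disc, kerA, kerB, kerC, normC, etaB]
        ring
    _ = _ := by rw [← h3]; ring

/-- If the zero `w` of `W` lies in `(0, r(y₀)]`, then `w` solves the kernel equation at `1 / η₁`, and this
point lies in `(1, y₀]`. -/
lemma Params.exists_pole {p q muH muL w l₀ l₁ : ℝ} (h : Params p q muH muL)
    (hQ : QuadFactor p q muH muL w l₀ l₁) (hw : w ≤ rCrit p muH) :
    ∃ s, 1 < s ∧ s ≤ yZero p q muH ∧ eta1 p q muH muL * s = 1 ∧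
      w = (q * s + (1 - q)) * (p * (1 - muH) + stay p muH * w + (1 - p) * muH * w ^ 2) ∧
      bTwo p q muH muL s = -(s * ((1 - p) * muH * (q * s + (1 - q)) * w)) ∧
      (w = rCrit p muH → s = yZero p q muH) := by
  have hw0 := hQ.w_pos
  have hs := h.down_pos
  have ha := h.up_pos
  have ht := h.stay_pos
  have hq := h.hq
  set P := p * (1 - muH) + stay p muH * w + (1 - p) * muH * w ^ 2 with hP
  have hP0 : 0 < P := by positivity
  obtain ⟨s, hsdef⟩ : ∃ s, s = (w / P - (1 - q)) / q := ⟨_, rfl⟩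
  have hgs : q * s + (1 - q) = w / P := by rw [hsdef]; field_simp; ring
  have hker : w = (q * s + (1 - q)) * P := by rw [hgs]; field_simp
  have hrk := h.rCrit_kernel
  set r₀ := rCrit p muH with hr0
  set P₀ := p * (1 - muH) + stay p muH * r₀ + (1 - p) * muH * r₀ ^ 2 with hP₀
  have hr0pos : 0 < r₀ := h.rCrit_pos
  have hP₀0 : 0 < P₀ := by positivity
  have hg0 : q * yZero p q muH + (1 - q) = r₀ / P₀ := by
    rw [eq_div_iff hP₀0.ne']; exact hrk.symm
  -- The zero `w` exceeds `r(1)`, since `W(r(1)) > 0`.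
  have hs1 : p * (1 - muH) < (1 - p) * muH * w := by
    have h1 := h.quad_eval (x := r₀ ^ 2) (by rw [hr0]; exact h.down_mul_rCrit_sq)
    rw [hQ.eval] at h1
    have h2 : r₀ ^ 2 ≤ 1 := pow_le_one₀ hr0pos.le h.rCrit_lt_one.le
    have h3 := hQ.linear_pos (sq_nonneg r₀) h2
    have h4 := mul_pos h.massC_pos (pow_pos hr0pos 2)
    rw [← h1] at h4
    have h5 := pos_of_mul_pos_left h4 h3.le
    have h6 : (1 - p) * muH * r₀ ^ 2 = p * (1 - muH) := by rw [hr0]; exact h.down_mul_rCrit_sq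
    nlinarith
  have h1s : 1 < s := by
    have h1 : P < w := by
      have h2 : P - w = (1 - w) * (p * (1 - muH) - (1 - p) * muH * w) := by rw [hP, stay]; ring
      have h3 := hQ.w_lt_one
      nlinarith
    have h2 : 1 < w / P := (one_lt_div hP0).mpr h1
    rw [← hgs] at h2
    by_contra! h3
    nlinarith
  have hspos : 0 < s := by linarith
  have hlt : w < r₀ → s < yZero p q muH := by
    intro hlt
    have h1 : w / P < r₀ / P₀ := by
      rw [div_lt_div_iff₀ hP0 hP₀0]
      have h2 : r₀ * P - w * P₀ = (1 - p) * muH * r₀ * (r₀ - w) ^ 2 := by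
        have h6 : (1 - p) * muH * r₀ ^ 2 = p * (1 - muH) := by rw [hr0]; exact h.down_mul_rCrit_sq
        rw [hP, hP₀]
        linear_combination (w - r₀) * h6
      have h3 : 0 < (1 - p) * muH * r₀ * (r₀ - w) ^ 2 := by
        have := sub_pos.mpr hlt
        positivity
      linarith
    rw [← hgs, ← hg0] at h1
    by_contra! h3
    nlinarith
  have heq : w = r₀ → s = yZero p q muH := by
    intro he
    have h1 : w / P = r₀ / P₀ := by rw [hP, hP₀, he]
    rw [← hgs, ← hg0] at h1
    exact mul_left_cancel₀ hq.ne' (by linarith)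
  have hb : bTwo p q muH muL s = -(s * ((1 - p) * muH * (q * s + (1 - q)) * w)) := by
    have h1 := kernel_point (muL := muL) hker
    rw [hQ.eval, sub_self, zero_mul, mul_zero, mul_zero] at h1
    have h2 := (mul_eq_zero.mp h1).resolve_left (by positivity)
    linarith
  refine ⟨s, h1s, ?_, ?_, hker, hb, heq⟩
  · rcases hw.lt_or_eq with h1 | h1
    · exact (hlt h1).le
    · exact (heq h1).le
  · have h1 := h.F_sq_sub s
    have h2 : F p q muH muL s ^ 2 - s ^ 2 * disc p q muH s = 0 := by
      rw [F_eq_two_mul, disc, hb, kerA, kerB, kerC, ← stay]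
      linear_combination (-4 * s ^ 2 * ((1 - p) * muH * (q * s + (1 - q)))) * hker
    rw [h2] at h1
    have h3 : 0 < normC p q muL := by
      have := h.p_lt_one
      have := h.q_lt_one
      have := h.hmuL
      unfold normC
      positivity
    have h4 : 0 < q * s + (1 - q) := by rw [hgs]; positivity
    have h5 : 0 < 1 - eta2 p q muH muL * s := by nlinarith [h.eta2_neg]
    have h6 : 1 - s ≠ 0 := by linarith
    have h7 := (mul_eq_zero.mp h1.symm).resolve_left (mul_ne_zero (mul_pos h3 h4).ne' h6)
    have h8 := (mul_eq_zero.mp h7).resolve_right h5.ne'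
    linarith

/-! ### The generating function of the boundary probabilities -/

/-- The series of the polynomial `b₂`. -/
noncomputable def bTwoSer (p q muH muL : ℝ) : ℝ⟦X⟧ :=
  arrSer q * (C ((1 - p) * muL) + C (p * muH + (1 - p) * (1 - muL)) * X) - X

/-- The series of the polynomial `F`. -/
noncomputable def fSer (p q muH muL : ℝ) : ℝ⟦X⟧ :=
  2 * bTwoSer p q muH muL - X * (C (stay p muH) * arrSer q - 1)

lemma absConv_bTwoSer (y p q muH muL : ℝ) : AbsConv y (bTwoSer p q muH muL) :=
  ((absConv_arrSer y q).mul ((absConv_C y _).add ((absConv_C y _).mul (absConv_X y)))).sub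
    (absConv_X y)

lemma ev_bTwoSer (y p q muH muL : ℝ) : ev y (bTwoSer p q muH muL) = bTwo p q muH muL y := by
  have a1 := (absConv_C y (p * muH + (1 - p) * (1 - muL))).mul (absConv_X y)
  have a2 := (absConv_C y ((1 - p) * muL)).add a1
  rw [bTwoSer, ev_sub ((absConv_arrSer y q).mul a2) (absConv_X y), ev_mul (absConv_arrSer y q) a2,
    ev_add (absConv_C _ _) a1, ev_mul (absConv_C _ _) (absConv_X y), ev_C, ev_C, ev_X, ev_arrSer, bTwo]
  ring

lemma fSer_eq (p q muH muL : ℝ) : fSer p q muH muL =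
    C 2 * bTwoSer p q muH muL - X * (C (stay p muH) * arrSer q - 1) := by
  rw [fSer, map_ofNat]

lemma absConv_fSer (y p q muH muL : ℝ) : AbsConv y (fSer p q muH muL) := by
  rw [fSer_eq]
  exact ((absConv_C y 2).mul (absConv_bTwoSer y p q muH muL)).sub ((absConv_X y).mul
    (((absConv_C y _).mul (absConv_arrSer y q)).sub (absConv_one y)))

lemma ev_fSer (y p q muH muL : ℝ) : ev y (fSer p q muH muL) = F p q muH muL y := by
  have a1 := (absConv_C y (stay p muH)).mul (absConv_arrSer y q)
  rw [fSer_eq, ev_sub ((absConv_C y 2).mul (absConv_bTwoSer y p q muH muL)) ((absConv_X y).mul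
    (a1.sub (absConv_one y))), ev_mul (absConv_C _ _) (absConv_bTwoSer y p q muH muL),
    ev_mul (absConv_X y) (a1.sub (absConv_one y)), ev_sub a1 (absConv_one y),
    ev_mul (absConv_C _ _) (absConv_arrSer y q), ev_C, ev_C, ev_X, ev_one, ev_arrSer, ev_bTwoSer,
    F_eq_two_mul, kerB, ← stay]

lemma tail_fSer (y p q muH muL : ℝ) : Tail y (fSer p q muH muL) 0 := by
  have h1 := (tail_arrSer y q).mul ((tail_C y ((1 - p) * muL)).add
    ((tail_X y).C_mul (p * muH + (1 - p) * (1 - muL))))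
  have h2 := ((h1.sub (tail_X y)).C_mul 2).sub ((tail_X y).mul
    (((tail_arrSer y q).C_mul (stay p muH)).sub (tail_one y)))
  rw [← bTwoSer, ← fSer_eq] at h2
  simpa using h2

section

variable {p q muH muL : ℝ} (h : Params p q muH muL) {π : ℕ → ℕ → ℝ}
  (hπ : IsStationary p q muH muL π) {r : ℝ⟦X⟧} (hr : IsBranch p q muH r)
include h hπ hr

lemma genFun_mul_quadSer : genFun π 0 * quadSer p q muH muL r =
    C (massC p q muH muL) * ((1 - r) * stepSer p muH r) := by
  rw [← massC_eq h hπ hr]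
  exact genFun_mul_quadSer_aux h hπ hr

/-- `Π₀ (F - y √Δ) = 2 K (1 - y)`. -/
lemma genFun_mul_fSer_sub : genFun π 0 * (fSer p q muH muL - X * discSeries p q muH) =
    C (2 * massC p q muH muL) * (1 - X) := by
  have h0 := genFun_balance_zero hπ
  have h1 : genFun π 1 = genFun π 0 * r := by simpa using genFun_eq h hπ hr 1
  rw [h1, massC_eq h hπ hr] at h0
  have h2 := hr.eq_disc
  have e1 : (C (2 * ((1 - p) * muH)) : ℝ⟦X⟧) = 2 * C ((1 - p) * muH) := by
    simp only [map_mul, map_ofNat]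
  have e2 : (C (2 * massC p q muH muL) : ℝ⟦X⟧) = 2 * C (massC p q muH muL) := by
    simp only [map_mul, map_ofNat]
  rw [e1] at h2
  rw [e2, fSer, bTwoSer]
  linear_combination (-2 : ℝ⟦X⟧) * h0 - genFun π 0 * X * h2

/-- `Π₀ = 2 K (F + y √Δ) / (4 (1 - p)² (1 - q) μ_l² (q y + 1 - q) (1 - η₁ y) (1 - η₂ y))`, obtained by
rationalising the denominator `F - y √Δ`. -/
lemma genFun_mul_eta : genFun π 0 * (1 - C (eta1 p q muH muL) * X) *
      (C (normC p q muL) * arrSer q * (1 - C (eta2 p q muH muL) * X)) =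
    C (2 * massC p q muH muL) * (fSer p q muH muL + X * discSeries p q muH) := by
  have h1 := genFun_mul_fSer_sub h hπ hr
  have hD := h.discSeries_mul_self
  have hid : fSer p q muH muL ^ 2 - X ^ 2 *
      ((C (stay p muH) * arrSer q - 1) ^ 2 - C (4 * gmean p muH ^ 2) * arrSer q ^ 2) =
      (1 - X) * ((1 - C (eta1 p q muH muL) * X) *
      (C (normC p q muL) * arrSer q * (1 - C (eta2 p q muH muL) * X))) := by
    have e3 : C (normC p q muL) * ((1 - C (eta1 p q muH muL) * X) * (1 - C (eta2 p q muH muL) * X)) =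
        C (normC p q muL) - C (4 * (1 - p) * muL * etaB p q muH muL) * X -
        C (4 * (1 - p) * (q * (1 - muL) * (muH - (1 - p) * muL))) * X ^ 2 := by
      have e1 : 4 * (1 - p) * muL * etaB p q muH muL =
          normC p q muL * (eta1 p q muH muL + eta2 p q muH muL) := by
        rw [normC]
        linear_combination (-4 * (1 - p) * muL) * h.eta_add
      have e2 : 4 * (1 - p) * (q * (1 - muL) * (muH - (1 - p) * muL)) =
          -(normC p q muL * (eta1 p q muH muL * eta2 p q muH muL)) := by
        rw [normC]
        linear_combination (4 * (1 - p)) * h.eta_mul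
      rw [e1, e2]
      simp only [map_mul, map_add, map_neg]
      ring
    have e4 : (1 - X) * ((1 - C (eta1 p q muH muL) * X) *
        (C (normC p q muL) * arrSer q * (1 - C (eta2 p q muH muL) * X))) = (1 - X) * arrSer q *
        (C (normC p q muL) - C (4 * (1 - p) * muL * etaB p q muH muL) * X -
        C (4 * (1 - p) * (q * (1 - muL) * (muH - (1 - p) * muL))) * X ^ 2) := by
      rw [← e3]; ring
    rw [e4, fSer, bTwoSer, arrSer, h.gmean_sq]
    simp only [normC, etaB, stay, map_mul, map_add, map_sub, map_one, map_pow, map_ofNat]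
    ring
  rw [← hD] at hid
  have hX : (1 - X : ℝ⟦X⟧) ≠ 0 := by
    intro h2
    have h3 := congrArg (coeff 0) h2
    simp at h3
  refine mul_left_cancel₀ hX ?_
  linear_combination (fSer p q muH muL + X * discSeries p q muH) * h1 - genFun π 0 * hid

/-- Division by the zero-free factor of `W(r)`: `Π₀ (w - r)` has a tail of order `-3/2` at `y₀`. -/
lemma exists_tail_genFun_mul_sub {w l₀ l₁ : ℝ} (hQ : QuadFactor p q muH muL w l₀ l₁) :
    ∃ c, Tail (yZero p q muH) (genFun π 0 * (C w - r)) c := by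
  have hR := h.yZero_pos.le
  have hl := hQ.l₀_pos
  have hA := hr.tail.C_mul (-l₁ / l₀)
  have hlt : ∑' j, |coeff j (C (-l₁ / l₀) * r) * yZero p q muH ^ j| < 1 := by
    have h1 : ∀ j, |coeff j (C (-l₁ / l₀) * r) * yZero p q muH ^ j| =
        |l₁| / l₀ * (coeff j r * yZero p q muH ^ j) := by
      intro j
      rw [coeff_C_mul, mul_assoc, abs_mul, abs_div, abs_neg, abs_of_pos hl,
        abs_of_nonneg (mul_nonneg (hr.nonneg j) (pow_nonneg hR j))]
    simp only [h1]
    rw [tsum_mul_left, ← ev, hr.ev_yZero h, div_mul_eq_mul_div, div_lt_one hl]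
    exact hQ.abs_lt
  obtain ⟨B, hB⟩ := exists_eq_one_add_mul (A := C (-l₁ / l₀) * r) (by
    have h1 := Summable.le_tsum hA.absConv 0 fun j _ => abs_nonneg _
    have h2 := h1.trans_lt hlt
    rw [pow_zero, mul_one] at h2
    exact ((le_abs_self _).trans_lt h2).ne)
  have hBt := hA.inv_one_sub hlt hB
  have hinv : (C l₀ + C l₁ * r) * (C (1 / l₀) * B) = 1 := by
    have e1 : C l₀ * C (1 / l₀) = (1 : ℝ⟦X⟧) := by
      rw [← map_mul, mul_one_div_cancel hl.ne', map_one]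
    have e2 : C l₁ * C (1 / l₀) = -(C (-l₁ / l₀) : ℝ⟦X⟧) := by
      rw [← map_mul, ← map_neg]
      congr 1
      ring
    linear_combination B * e1 + r * B * e2 + hB
  have h1 := genFun_mul_quadSer h hπ hr
  have h2 : quadSer p q muH muL r = (C w - r) * (C l₀ + C l₁ * r) := by
    rw [quadSer, ← hQ.eqC, ← hQ.eqB, ← hQ.eqA]
    simp only [map_mul, map_sub, map_neg]
    ring
  rw [h2] at h1
  have h3 : genFun π 0 * (C w - r) =
      C (massC p q muH muL) * ((1 - r) * stepSer p muH r) * (C (1 / l₀) * B) := by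
    linear_combination (C (1 / l₀) * B) * h1 - genFun π 0 * (C w - r) * hinv
  rw [h3]
  have hP := ((tail_C (yZero p q muH) (p * (1 - muH))).add (hr.tail.C_mul (stay p muH))).add
    ((hr.tail.mul hr.tail).C_mul ((1 - p) * muH))
  exact ⟨_, ((((tail_one _).sub hr.tail).mul hP).C_mul _).mul (hBt.C_mul _)⟩

/-- If `r(y₀) < w`, then `Π₀` itself has a tail of order `-3/2`. -/
lemma exists_tail_genFun {w l₀ l₁ : ℝ} (hQ : QuadFactor p q muH muL w l₀ l₁)
    (hw : rCrit p muH < w) : ∃ c, Tail (yZero p q muH) (genFun π 0) c := by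
  obtain ⟨c, hc⟩ := exists_tail_genFun_mul_sub h hπ hr hQ
  have hR := h.yZero_pos.le
  have hw0 := hQ.w_pos
  have hA := hr.tail.C_mul (1 / w)
  have hAn : ∀ j, 0 ≤ coeff j (C (1 / w) * r) := fun j => by
    rw [coeff_C_mul]
    exact mul_nonneg (by positivity) (hr.nonneg j)
  have hev : ev (yZero p q muH) (C (1 / w) * r) < 1 := by
    rw [ev_mul (absConv_C _ _) hr.tail.absConv, ev_C, hr.ev_yZero h, one_div_mul_eq_div]
    exact (div_lt_one hw0).mpr hw
  obtain ⟨B, hB⟩ := exists_eq_one_add_mul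
    ((coeff_zero_le_ev hA.absConv hR hAn).trans_lt hev).ne
  have hBt := hA.inv_one_sub (by rwa [tsum_abs_eq_ev hR hAn]) hB
  have e1 : C w * C (1 / w) = (1 : ℝ⟦X⟧) := by
    rw [← map_mul, mul_one_div_cancel hw0.ne', map_one]
  have h1 : genFun π 0 = genFun π 0 * (C w - r) * (C (1 / w) * B) := by
    linear_combination (-genFun π 0 * B) * e1 - genFun π 0 * hB
  rw [h1]
  exact ⟨_, hc.mul (hBt.C_mul _)⟩

/-- If `w` solves the kernel equation at `1 / η₁`, then `Π₀ (1 - η₁ y)` has a tail of order `-3/2` at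
`y₀`: `w - r` divides a multiple of `1 - η₁ y`, so the zero of `w - r` costs at most a simple pole. -/
lemma exists_tail_genFun_mul_eta {w l₀ l₁ s : ℝ} (hQ : QuadFactor p q muH muL w l₀ l₁)
    (hs : eta1 p q muH muL * s = 1)
    (hker : w = (q * s + (1 - q)) * (p * (1 - muH) + stay p muH * w + (1 - p) * muH * w ^ 2)) :
    ∃ c, Tail (yZero p q muH) (genFun π 0 * (1 - C (eta1 p q muH muL) * X)) c := by
  obtain ⟨c, hc⟩ := exists_tail_genFun_mul_sub h hπ hr hQ
  set P := p * (1 - muH) + stay p muH * w + (1 - p) * muH * w ^ 2 with hP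
  have hP0 : 0 < P := by
    have := hQ.w_pos
    have := h.up_pos
    have := h.down_pos
    have := h.stay_pos
    positivity
  have hq := h.hq
  set η := eta1 p q muH muL with hη
  set N : ℝ⟦X⟧ := C ((1 - p) * muH) * (arrSer q * (C w + r)) + (C (stay p muH) * arrSer q - 1) with hN
  have hNt : ∃ d, Tail (yZero p q muH) N d :=
    ⟨_, (((tail_arrSer _ q).mul ((tail_C _ w).add hr.tail)).C_mul _).add
      (((tail_arrSer _ q).C_mul _).sub (tail_one _))⟩
  obtain ⟨d, hd⟩ := hNt
  have h1 : (C w - r) * N = C (P * q) * (X - C s) := by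
    have h2 := hr.eq
    have h3 : (C w - r) * N = arrSer q * C P - C w := by
      rw [hN, hP]
      simp only [map_add, map_mul, map_pow] at h2 ⊢
      linear_combination h2
    rw [h3]
    have h4 : (C w : ℝ⟦X⟧) = (C q * C s + C (1 - q)) * C P := by
      simp only [← map_mul, ← map_add]
      rw [← hker]
    rw [h4, arrSer, map_mul]
    ring
  have h5 : genFun π 0 * (1 - C η * X) = C (-η / (P * q)) * (genFun π 0 * (C w - r) * N) := by
    have e1 : C (-η / (P * q)) * C (P * q) = (-C η : ℝ⟦X⟧) := by
      rw [← map_mul, ← map_neg]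
      congr 1
      field_simp
    have e2 : C η * C s = (1 : ℝ⟦X⟧) := by rw [← map_mul, hs, map_one]
    linear_combination (-C (-η / (P * q)) * genFun π 0) * h1 - genFun π 0 * (X - C s) * e1 -
      genFun π 0 * e2
  rw [h5]
  exact ⟨_, (hc.mul hd).C_mul _⟩

/-- The tail constants of the two sides of the rationalised formula for `Π₀`. -/
lemma tail_eta_const {c : ℝ}
    (hc : Tail (yZero p q muH) (genFun π 0 * (1 - C (eta1 p q muH muL) * X)) c) :
    c * (normC p q muL * (q * yZero p q muH + (1 - q)) * (1 - eta2 p q muH muL * yZero p q muH)) =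
      -(2 * massC p q muH muL * (yZero p q muH * discTail p q muH)) := by
  set R := yZero p q muH with hR
  have a2 := (tail_one R).sub ((tail_X R).C_mul (eta2 p q muH muL))
  have a3 := ((tail_arrSer R q).C_mul (normC p q muL)).mul a2
  have h1 := hc.mul a3
  have h3 := (((tail_fSer R p q muH muL).add ((tail_X R).mul h.tail_discSeries)).C_mul
    (2 * massC p q muH muL))
  rw [← genFun_mul_eta h hπ hr] at h3
  have h4 := h1.unique h3
  rw [ev_mul ((absConv_C _ _).mul (absConv_arrSer R q)) a2.absConv, ev_mul (absConv_C _ _)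
    (absConv_arrSer R q), ev_sub (absConv_one R) ((absConv_C _ _).mul (absConv_X R)),
    ev_mul (absConv_C _ _) (absConv_X R), ev_arrSer, ev_one, ev_C, ev_C, ev_X] at h4
  linear_combination h4

end

/-! ### Identification of the constants -/

lemma tailEquiv_of_tendsto {f g u : ℕ → ℝ} {c : ℝ} (hc : c ≠ 0)
    (h : Tendsto (fun j => f j * u j) atTop (𝓝 c)) (hg : ∀ᶠ j in atTop, g j = c * (u j)⁻¹) :
    TailEquiv f g := by
  have h1 := h.div_const c
  rw [div_self hc] at h1
  refine h1.congr' ?_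
  filter_upwards [hg] with j hj
  rw [hj]
  rcases eq_or_ne (u j) 0 with h0 | h0
  · simp [h0]
  · field_simp

section

variable {p q muH muL : ℝ} (h : Params p q muH muL)
include h

lemma Params.normC_pos : 0 < normC p q muL := by
  have := h.p_lt_one
  have := h.q_lt_one
  have := h.hmuL
  unfold normC
  positivity

lemma Params.pi00_div : pi00 p q muH muL / (2 * (1 - p) * muL) =
    2 * massC p q muH muL / normC p q muL := by
  have := h.p_lt_one
  have := h.q_lt_one
  have := h.hmuL
  rw [pi00, massC, normC]
  field_simp
  ring

lemma Params.one_sub_eta2_pos {s : ℝ} (hs : 0 < s) : 0 < 1 - eta2 p q muH muL * s := by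
  nlinarith [h.eta2_neg]

lemma Params.coefA_eq {s : ℝ} (hs : eta1 p q muH muL * s = 1) : coefA p q muH muL =
    2 * massC p q muH muL / (normC p q muL * (1 - eta2 p q muH muL * s)) := by
  have h1 := h.eta1_pos
  have h2 := h.eta2_neg
  have hs0 : 0 < s := pos_of_mul_pos_right (hs.symm ▸ one_pos) h1.le
  have h3 : eta1 p q muH muL / (eta1 p q muH muL - eta2 p q muH muL) =
      1 / (1 - eta2 p q muH muL * s) := by
    rw [div_eq_div_iff (by linarith) (h.one_sub_eta2_pos hs0).ne']
    linear_combination -eta2 p q muH muL * hs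
  rw [coefA, h.pi00_div, h3, div_mul_div_comm, mul_one]

/-- The two ratios in the constants `C1` and `C2` are both equal to the value `w` of the branch at a
zero `s` of `h₂(x₀(y), y)`. -/
lemma Params.ratio_eq {s η w : ℝ} (hs : 0 < s) (hη : η * s = 1)
    (hker : w = (q * s + (1 - q)) * (p * (1 - muH) + stay p muH * w + (1 - p) * muH * w ^ 2))
    (hb : bTwo p q muH muL s = -(s * ((1 - p) * muH * (q * s + (1 - q)) * w))) :
    (1 - (p * muH + (1 - p) * (1 - muL)) * (q * s + (1 - q)) -
        (1 - p) * muL * (q + (1 - q) * η)) / ((1 - p) * muH * (q * s + (1 - q))) = w ∧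
    p * (1 - muH) / ((1 - p) * muH - (1 - p) * muL * (1 - η)) = w := by
  have hg : 0 < q * s + (1 - q) := add_pos (mul_pos h.hq hs) h.q_lt_one
  have hb' : bTwo p q muH muL s =
      (q * s + (1 - q)) * ((1 - p) * muL + (p * muH + (1 - p) * (1 - muL)) * s) - s := by
    rw [bTwo]; ring
  rw [hb'] at hb
  constructor
  · rw [div_eq_iff (mul_pos h.down_pos hg).ne']
    refine mul_left_cancel₀ hs.ne' ?_
    linear_combination -hb - (1 - p) * muL * (1 - q) * hη
  · have h1 : w * ((1 - p) * muH - (1 - p) * muL * (1 - η)) = p * (1 - muH) := by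
      refine mul_left_cancel₀ (mul_pos hg hs).ne' ?_
      rw [stay] at hker
      linear_combination w * hb + s * hker + (1 - p) * muL * (q * s + (1 - q)) * w * hη
    have h2 := h.up_pos
    rw [← h1] at h2 ⊢
    rw [mul_div_cancel_right₀ _ (right_ne_zero_of_mul h2.ne')]

end

section

variable {p q muH muL : ℝ} (h : Params p q muH muL) {π : ℕ → ℕ → ℝ}
  (hπ : IsStationary p q muH muL π) {r : ℝ⟦X⟧} (hr : IsBranch p q muH r)
include h hπ hr

/-- The case of a simple pole at `1 / η₁ < y₀`. -/
theorem tailEquiv_pole {w l₀ l₁ : ℝ} (hQ : QuadFactor p q muH muL w l₀ l₁) (hw : w < rCrit p muH)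
    {i : ℕ} (hi : 1 ≤ i) :
    TailEquiv (fun j => π i j) (fun j => C1 p q muH muL i * eta1 p q muH muL ^ j) := by
  obtain ⟨s, h1s, hsR, hηs, hker, hb, -⟩ := h.exists_pole hQ hw.le
  have hs0 : 0 < s := by linarith
  have hsinv : (eta1 p q muH muL)⁻¹ = s :=
    inv_eq_of_mul_eq_one_right hηs
  have hg : 0 < q * s + (1 - q) := add_pos (mul_pos h.hq hs0) h.q_lt_one
  have hw0 := hQ.w_pos
  obtain ⟨c, hc⟩ := exists_tail_genFun_mul_eta h hπ hr hQ hηs hker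
  have hra := hr.tail.absConv.mono hs0.le hsR
  -- Both `w` and the value of the branch at `s` are the small solution of the kernel equation.
  have hev : ev s r = w := by
    have h1 := hr.ev_eq hs0.le hsR
    have h2 := hr.ev_le h hs0.le hsR
    have h3 : (ev s r - w) * (p * (1 - muH) - (1 - p) * muH * ev s r * w) = 0 := by
      refine mul_left_cancel₀ hg.ne' ?_
      linear_combination w * h1 - ev s r * hker
    have h4 : (1 - p) * muH * ev s r * w < p * (1 - muH) := by
      have h5 := h.down_mul_rCrit_sq
      have h6 := h.rCrit_pos
      have h7 := h.down_pos
      calc (1 - p) * muH * ev s r * w ≤ (1 - p) * muH * rCrit p muH * w := by gcongr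
        _ < (1 - p) * muH * rCrit p muH * rCrit p muH := by gcongr
        _ = _ := by rw [← h5]; ring
    linarith [(mul_eq_zero.mp h3).resolve_right (sub_pos.mpr h4).ne']
  have hD : ev s (discSeries p q muH) =
      1 - stay p muH * (q * s + (1 - q)) - 2 * ((1 - p) * muH) * ((q * s + (1 - q)) * w) := by
    have hga := absConv_arrSer s q
    have h1 : discSeries p q muH = 1 - C (stay p muH) * arrSer q -
        C (2 * ((1 - p) * muH)) * (arrSer q * r) := by linear_combination hr.eq_disc
    rw [h1, ev_sub ((absConv_one s).sub ((absConv_C s _).mul hga)) ((absConv_C s _).mul (hga.mul hra)),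
      ev_sub (absConv_one s) ((absConv_C s _).mul hga), ev_mul (absConv_C s _) hga,
      ev_mul (absConv_C s _) (hga.mul hra), ev_mul hga hra, ev_one, ev_C, ev_C, ev_arrSer, hev]
  have hF : F p q muH muL s = s * ev s (discSeries p q muH) := by
    rw [F_eq_two_mul, kerB, ← stay, hb, hD]
    ring
  have hFpos : 0 < F p q muH muL s := by
    rw [hF, hD]
    refine mul_pos hs0 (pos_of_mul_pos_right (a := w) ?_ hw0.le)
    have h1 : w * (1 - stay p muH * (q * s + (1 - q)) - 2 * ((1 - p) * muH) * ((q * s + (1 - q)) * w)) =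
        (q * s + (1 - q)) * ((1 - p) * muH) * ((rCrit p muH + w) * (rCrit p muH - w)) := by
      linear_combination hker - (q * s + (1 - q)) * h.down_mul_rCrit_sq
    rw [h1]
    have h2 := h.down_pos
    have h3 := h.rCrit_pos
    have h4 := sub_pos.mpr hw
    positivity
  have hMa := hc.absConv.mono hs0.le hsR
  have hDa := h.tail_discSeries.absConv.mono hs0.le hsR
  have hlam : ev s (genFun π 0 * (1 - C (eta1 p q muH muL) * X)) = Cl1 p q muH muL := by
    have h1 := congrArg (ev s) (genFun_mul_eta h hπ hr)
    have a1 := (absConv_one s).sub ((absConv_C s (eta2 p q muH muL)).mul (absConv_X s))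
    have a2 := (absConv_C s (normC p q muL)).mul (absConv_arrSer s q)
    rw [ev_mul hMa (a2.mul a1), ev_mul a2 a1, ev_mul (absConv_C s _) (absConv_arrSer s q),
      ev_sub (absConv_one s) ((absConv_C s _).mul (absConv_X s)), ev_mul (absConv_C s _) (absConv_X s),
      ev_mul (absConv_C s _) ((absConv_fSer s p q muH muL).add ((absConv_X s).mul hDa)),
      ev_add (absConv_fSer s p q muH muL) ((absConv_X s).mul hDa), ev_mul (absConv_X s) hDa,
      ev_fSer, ev_arrSer, ev_C, ev_C, ev_C, ev_X, ev_one, ← hF] at h1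
    have h2 := h.normC_pos
    have h3 := h.one_sub_eta2_pos hs0
    rw [Cl1, one_div, hsinv, h.coefA_eq hηs, eq_div_iff hg.ne']
    rw [mul_div_assoc', div_mul_eq_mul_div, eq_div_iff (by positivity)]
    linear_combination h1
  have hlim := (tendsto_coeff_mul (tendsto_coeff_of_simple_pole hηs rfl hMa) (hra.pow i))
  rw [← genFun_eq h hπ hr i, hlam, ev_pow hra, hev] at hlim
  obtain ⟨h1, h2⟩ := h.ratio_eq hs0 hηs hker hb
  have hC : C1 p q muH muL i = Cl1 p q muH muL * w ^ i := by
    rw [C1, hsinv, h1, h2, ← pow_succ', Nat.sub_add_cancel hi]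
    ring
  refine tailEquiv_of_tendsto (u := fun j => s ^ j) ?_ (c := C1 p q muH muL i) ?_ ?_
  · rw [hC, Cl1, one_div, hsinv, h.coefA_eq hηs]
    have h2 := h.normC_pos
    have h3 := h.one_sub_eta2_pos hs0
    have h4 := h.massC_pos
    positivity
  · rw [hC]
    refine hlim.congr fun j => ?_
    rw [genFun, coeff_mk]
  · refine Eventually.of_forall fun j => ?_
    rw [← inv_pow, ← hsinv, inv_inv]

/-- The case in which the pole and the branch point coincide. -/
theorem tailEquiv_critical {w l₀ l₁ : ℝ} (hQ : QuadFactor p q muH muL w l₀ l₁)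
    (hw : w = rCrit p muH) {i : ℕ} (hi : 1 ≤ i) :
    TailEquiv (fun j => π i j) (fun j => C2 p q muH muL i * (j : ℝ) ^ (-(1 / 2) : ℝ) *
      (yZero p q muH ^ j)⁻¹) := by
  obtain ⟨s, -, -, hηs, hker, hb, heq⟩ := h.exists_pole hQ hw.le
  have hsR := heq hw
  subst hsR
  have hR0 := h.yZero_pos
  have hg := h.arr_yZero_pos
  have hw0 := hQ.w_pos
  obtain ⟨c, hc⟩ := exists_tail_genFun_mul_eta h hπ hr hQ hηs hker
  have hconst := tail_eta_const h hπ hr hc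
  have h0 : ev (yZero p q muH) (genFun π 0 * (1 - C (eta1 p q muH muL) * X)) = 0 := by
    set R := yZero p q muH
    have h1 := congrArg (ev R) (genFun_mul_eta h hπ hr)
    have a1 := (absConv_one R).sub ((absConv_C R (eta2 p q muH muL)).mul (absConv_X R))
    have a2 := (absConv_C R (normC p q muL)).mul (absConv_arrSer R q)
    have hDa := h.tail_discSeries.absConv
    have hF0 : F p q muH muL R = 0 := by
      rw [F_eq_two_mul, kerB, ← stay, hb, hw]
      linear_combination (-R) * (h.arr_yZero + 2 * (q * R + (1 - q)) * h.down_mul_rCrit)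
    rw [ev_mul hc.absConv (a2.mul a1), ev_mul a2 a1, ev_mul (absConv_C R _) (absConv_arrSer R q),
      ev_sub (absConv_one R) ((absConv_C R _).mul (absConv_X R)), ev_mul (absConv_C R _) (absConv_X R),
      ev_mul (absConv_C R _) ((absConv_fSer R p q muH muL).add ((absConv_X R).mul hDa)),
      ev_add (absConv_fSer R p q muH muL) ((absConv_X R).mul hDa), ev_mul (absConv_X R) hDa,
      ev_fSer, hF0, h.ev_discSeries, ev_arrSer, ev_C, ev_C, ev_X, ev_one, mul_zero, add_zero,
      mul_zero] at h1
    exact (mul_eq_zero.mp h1).resolve_right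
      (mul_pos (mul_pos h.normC_pos hg) (h.one_sub_eta2_pos hR0)).ne'
  have hlim := (hc.sqrtTail_of_mul_one_sub hηs rfl h0).mul (hr.tail.pow i)
  rw [← genFun_eq h hπ hr i, ev_pow hr.tail.absConv, hr.ev_yZero h, ← hw] at hlim
  have hcl : Cl2 p q muH muL = -2 * c := by
    have h2 := h.normC_pos
    have h3 := h.one_sub_eta2_pos hR0
    have hpi : 0 < √Real.pi := by positivity
    rw [discTail] at hconst
    rw [Cl2, h.coefA_eq hηs, div_eq_iff (by positivity), div_mul_eq_mul_div, div_mul_eq_mul_div,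
      div_mul_eq_mul_div, div_mul_eq_mul_div, div_eq_iff (by positivity)]
    have h4 : c * (normC p q muL * (q * yZero p q muH + (1 - q)) *
        (1 - eta2 p q muH muL * yZero p q muH)) * (2 * √Real.pi) =
        -(2 * massC p q muH muL * (yZero p q muH * (q * (1 - p - muH) *
          √(yZero p q muH * (yOne p q muH - yZero p q muH))))) := by
      rw [hconst]
      field_simp
    linear_combination h4
  obtain ⟨h1, h2⟩ := h.ratio_eq (η := (yZero p q muH)⁻¹) hR0 (inv_mul_cancel₀ hR0.ne') hker hb
  have hC : C2 p q muH muL i = -2 * c * w ^ i := by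
    rw [C2, h1, h2, ← pow_succ', Nat.sub_add_cancel hi, hcl]
    ring
  refine tailEquiv_of_tendsto (u := fun j => yZero p q muH ^ j * √j) ?_ (c := C2 p q muH muL i) ?_ ?_
  · rw [hC]
    have h3 : c ≠ 0 := by
      rintro rfl
      rw [zero_mul] at hconst
      have := mul_pos (mul_pos two_pos h.massC_pos) (mul_pos hR0 h.discTail_pos)
      linarith
    have := hw0.ne'
    positivity
  · rw [hC]
    refine hlim.congr fun j => ?_
    rw [genFun, coeff_mk, mul_assoc]
  · refine Eventually.of_forall fun j => ?_
    rw [Real.rpow_neg (Nat.cast_nonneg j), ← Real.sqrt_eq_rpow, mul_inv]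
    ring

/-- The case in which the branch point is the dominant singularity. -/
theorem tailEquiv_branch {w l₀ l₁ : ℝ} (hQ : QuadFactor p q muH muL w l₀ l₁)
    (hw : rCrit p muH < w) (hF : F p q muH muL (yZero p q muH) < 0) {i : ℕ} (hi : 1 ≤ i) :
    TailEquiv (fun j => π i j) (fun j => C3 p q muH muL i * (j : ℝ) ^ (-(3 / 2) : ℝ) *
      (yZero p q muH ^ j)⁻¹) := by
  have hR0 := h.yZero_pos
  have hR1 := h.one_lt_yZero
  have hg := h.arr_yZero_pos
  have hd := h.discTail_pos
  have hs := h.down_pos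
  have hK := h.massC_pos
  have hn := h.normC_pos
  have hr0 := h.rCrit_pos
  have hgm := h.gmean_pos
  have hsr := h.down_mul_rCrit
  have hσ := h.arr_yZero
  have he2 := h.one_sub_eta2_pos hR0
  obtain ⟨a, ha⟩ := exists_tail_genFun h hπ hr hQ hw
  set R := yZero p q muH with hR
  set g := q * R + (1 - q) with hgdef
  set d := discTail p q muH with hddef
  set K := massC p q muH muL with hKdef
  have hdisc : disc p q muH R = 0 := by
    rw [disc, kerA, kerB, kerC, ← stay, ← hgdef]
    have := h.gmean_sq
    linear_combination (stay p muH * g - 1 - 2 * gmean p muH * g) * hσ + 4 * g ^ 2 * this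
  have hFsq : F p q muH muL R ^ 2 = normC p q muL * g * (1 - R) *
      ((1 - eta1 p q muH muL * R) * (1 - eta2 p q muH muL * R)) := by
    have := h.F_sq_sub R
    rw [hdisc] at this
    linear_combination this
  have he1 : 1 - eta1 p q muH muL * R ≠ 0 := by
    intro h1
    rw [h1] at hFsq
    have := pow_pos (neg_pos.mpr hF) 2
    nlinarith
  have hat : a * (1 - eta1 p q muH muL * R) *
      (normC p q muL * g * (1 - eta2 p q muH muL * R)) = -(2 * K * (R * d)) := by
    have h1 := ha.mul ((tail_one R).sub ((tail_X R).C_mul (eta1 p q muH muL)))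
    rw [ev_sub (absConv_one R) ((absConv_C _ _).mul (absConv_X R)),
      ev_mul (absConv_C _ _) (absConv_X R), ev_one, ev_C, ev_X] at h1
    have h2 := tail_eta_const h hπ hr h1
    linear_combination h2
  have haF : a * F p q muH muL R ^ 2 = 2 * K * (R * d) * (R - 1) := by
    rw [hFsq]
    linear_combination (1 - R) * hat
  have hapos : 0 < a := by
    have h1 := pow_pos (neg_pos.mpr hF) 2
    rw [neg_sq] at h1
    refine pos_of_mul_pos_left ?_ h1.le
    rw [haF]
    have := sub_pos.mpr hR1
    positivity
  have he0 : ev R (genFun π 0) * F p q muH muL R = 2 * K * (1 - R) := by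
    have h1 := congrArg (ev R) (genFun_mul_fSer_sub h hπ hr)
    have hDa := h.tail_discSeries.absConv
    rw [ev_mul ha.absConv ((absConv_fSer R p q muH muL).sub ((absConv_X R).mul hDa)),
      ev_sub (absConv_fSer R p q muH muL) ((absConv_X R).mul hDa), ev_mul (absConv_X R) hDa,
      ev_fSer, h.ev_discSeries, ev_mul (absConv_C _ _) ((absConv_one R).sub (absConv_X R)),
      ev_sub (absConv_one R) (absConv_X R), ev_C, ev_X, ev_one, mul_zero, sub_zero] at h1
    exact h1
  have hcl : Cl3 p q muH muL = a := by
    have h1 : Cl3 p q muH muL = -(R * d / g) * (coefA p q muH muL / (1 - eta1 p q muH muL * R) +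
        coefB p q muH muL / (1 - eta2 p q muH muL * R)) := by
      rw [Cl3, hddef, discTail, ← hR, ← hgdef]
      field_simp
      ring
    have h2 : coefA p q muH muL / (1 - eta1 p q muH muL * R) +
        coefB p q muH muL / (1 - eta2 p q muH muL * R) = 2 * K / normC p q muL /
        ((1 - eta1 p q muH muL * R) * (1 - eta2 p q muH muL * R)) := by
      have h3 : eta1 p q muH muL - eta2 p q muH muL ≠ 0 := by linarith [h.eta1_pos, h.eta2_neg]
      have h4 : eta2 p q muH muL - eta1 p q muH muL ≠ 0 := by linarith [h.eta1_pos, h.eta2_neg]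
      have h5 : eta2 p q muH muL / (eta2 p q muH muL - eta1 p q muH muL) =
          -(eta2 p q muH muL / (eta1 p q muH muL - eta2 p q muH muL)) := by
        rw [← neg_sub, div_neg]
      rw [coefA, coefB, h.pi00_div, h5]
      have he2' := he2.ne'
      field_simp
      ring
    rw [h1, h2]
    have he2' := he2.ne'
    clear h1 h2 hFsq
    generalize 1 - eta1 p q muH muL * R = e₁ at hat he1 ⊢
    generalize 1 - eta2 p q muH muL * R = e₂ at hat he2' ⊢
    field_simp
    linear_combination -hat
  have hx : hTwo p q muH muL (xZero p q muH R) R = F p q muH muL R / 2 := by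
    have hA : kerA p q muH R ≠ 0 := (mul_pos h.up_pos hg).ne'
    have hA' : aTwo p q muH R = R * kerA p q muH R := by rw [aTwo, kerA]; ring
    rw [hTwo, xZero, hdisc, Real.sqrt_zero, hA', F_eq_two_mul]
    field_simp
    ring
  have hratio : 2 * p * (1 - muH) * g / (1 - stay p muH * g) = rCrit p muH := by
    have h1 : 1 - stay p muH * g = 2 * gmean p muH * g := by linear_combination -hσ
    rw [h1, div_eq_iff (by positivity)]
    linear_combination (-2 * g) * h.down_mul_rCrit_sq + 2 * g * rCrit p muH * hsr
  have hbt : bTwo p q muH muL R = F p q muH muL R / 2 - R * (gmean p muH * g) := by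
    rw [F_eq_two_mul, kerB, ← stay, ← hgdef]
    linear_combination (R / 2) * hσ
  -- The relation between the value and the tail constant of `Π₀`.
  have hrel : d * ev R (genFun π 0) = -(F p q muH muL R * a / R) := by
    refine mul_right_cancel₀ hF.ne ?_
    rw [mul_assoc, he0]
    field_simp
    linear_combination haF
  have hC : C3 p q muH muL i = a * rCrit p muH ^ i + i * rCrit p muH ^ (i - 1) *
      (d / (2 * ((1 - p) * muH) * g)) * ev R (genFun π 0) := by
    obtain ⟨m, rfl⟩ := Nat.exists_eq_add_of_le' hi
    have hval : ev R (genFun π 0) = -(F p q muH muL R * a / R) / d := by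
      rw [eq_div_iff hd.ne', mul_comm, hrel]
    rw [C3, ← hR, ← hgdef, ← stay, hratio, hcl, hx, hbt, kerC, ← hgdef, Nat.add_sub_cancel,
      hval, ← hsr]
    generalize (1 - p) * muH = δ at hs ⊢
    push_cast
    field_simp
    ring
  have hlim := ha.mul (hr.tail.pow i)
  rw [← genFun_eq h hπ hr i, ev_pow hr.tail.absConv, hr.ev_yZero h, ← hC] at hlim
  refine tailEquiv_of_tendsto (u := fun j => R ^ j * (j * √j)) ?_ (c := C3 p q muH muL i) ?_ ?_
  · have h1 : 0 ≤ ev R (genFun π 0) := ev_nonneg hR0.le fun j => by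
      rw [genFun, coeff_mk]; exact hπ.nonneg 0 j
    have h2 : 0 < C3 p q muH muL i := by
      rw [hC]
      positivity
    exact h2.ne'
  · refine hlim.congr fun j => ?_
    rw [genFun, coeff_mk, mul_assoc]
  · filter_upwards [eventually_gt_atTop 0] with j hj
    have hj0 : (0 : ℝ) < j := by exact_mod_cast hj
    rw [Real.rpow_neg hj0.le, show (3 / 2 : ℝ) = 1 + 1 / 2 by norm_num, Real.rpow_add hj0,
      Real.rpow_one, ← Real.sqrt_eq_rpow, mul_inv (R ^ j)]
    ring

end

end PriorityQueue

theorem theorem5p2 (p q muH muL : ℝ) (hp : 0 < p) (hq : 0 < q) (hmuH : 0 < muH) (hmuL : 0 < muL)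
    (hsum : p + q + muH + muL = 1) (hle : muL ≤ muH)
    (hrho : PriorityQueue.rho p q muH muL < 1)
    (π : ℕ → ℕ → ℝ) (hπ : PriorityQueue.IsStationary p q muH muL π)
    (i : ℕ) (hi : 1 ≤ i) :
    (0 < PriorityQueue.F p q muH muL (PriorityQueue.yZero p q muH) →
      PriorityQueue.TailEquiv (fun j => π i j)
        (fun j => PriorityQueue.C1 p q muH muL i * PriorityQueue.eta1 p q muH muL ^ j)) ∧
    (PriorityQueue.F p q muH muL (PriorityQueue.yZero p q muH) = 0 →
      PriorityQueue.TailEquiv (fun j => π i j)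
        (fun j => PriorityQueue.C2 p q muH muL i * (j : ℝ) ^ (-(1 / 2) : ℝ) *
          (PriorityQueue.yZero p q muH ^ j)⁻¹)) ∧
    (PriorityQueue.F p q muH muL (PriorityQueue.yZero p q muH) < 0 →
      PriorityQueue.TailEquiv (fun j => π i j)
        (fun j => PriorityQueue.C3 p q muH muL i * (j : ℝ) ^ (-(3 / 2) : ℝ) *
          (PriorityQueue.yZero p q muH ^ j)⁻¹)) := by

  have h : PriorityQueue.Params p q muH muL := ⟨hp, hq, hmuH, hmuL, hsum, hle, hrho⟩
  obtain ⟨r, hr⟩ := h.exists_isBranch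
  obtain ⟨w, l₀, l₁, hQ⟩ := h.exists_quadFactor
  obtain ⟨k, hk, hF⟩ := h.F_yZero hQ
  refine ⟨fun h1 => ?_, fun h1 => ?_, fun h1 => ?_⟩
  · rw [hF] at h1
    exact PriorityQueue.tailEquiv_pole h hπ hr hQ
      (sub_pos.mp (pos_of_mul_pos_right h1 hk.le)) hi
  · rw [hF] at h1
    exact PriorityQueue.tailEquiv_critical h hπ hr hQ
      (sub_eq_zero.mp ((mul_eq_zero.mp h1).resolve_left hk.ne')).symm hi
  · refine PriorityQueue.tailEquiv_branch h hπ hr hQ ?_ h1 hi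
    rw [hF] at h1
    by_contra! h2
    nlinarith
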